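/- **Graphs.** A (finite) graph $\tau$ consists of finite sets $F_\tau$ of flags and $V_\tau$ of vertices, a map $\partial_\tau\colon F_\tau\to V_\tau$ and an involution $j_\tau$ of $F_\tau$; fixed points of $j_\tau$ are tails, two-element orbits are edges. A modular graph carries in addition a genus labeling $g\colon V_\tau\to\mathbb Z_{\ge0}$; it is stable if $2g(v)-2+\#\partial_\tau^{-1}(v)>0$ for every vertex $v$. A morphism $h\colon\tau\to\sigma$ of modular graphs consists of an injective map $h^F\colon F_\sigma\to F_\tau$, a surjective map $h_V\colon V_\tau\to V_\sigma$ and a fixed-point free involution $j_h$ of the set $F_\tau\setminus h^F(F_\sigma)$ of contracted flags, such that: an edge of $\tau$ with a contracted flag is an orbit of $j_h$; if $h^F(f)$ belongs to an edge of $\tau$, then $j_\tau h^F(f)=h^F(j_\sigma f)$; $h_V(\partial_\tau h^F(f))=\partial_\sigma f$; $h_V(\partial_\tau f)=h_V(\partial_\tau j_h f)$ for contracted $f$; any two vertices with the same image under $h_V$ are joined by a path of contracted edges (orbits of $j_h$); and, for every vertex $v$ of $\sigma$, $g(v)-1=\sum_{w\in h_V^{-1}(v)}(g(w)-1)+\#\{\text{contracted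 edges over }v\}$. Stable modular graphs form a category $\mathrm{MGr^{st}}$, symmetric monoidal under disjoint union. Composition is given by $(g\circ h)^F=h^F\circ g^F$, $(g\circ h)_V=g_V\circ h_V$, with $j_{g\circ h}$ equal to $j_h$ on the flags contracted by $h$ and induced by $j_g$ on the others. A grafting is a morphism that is bijective on flags and vertices; it is a grafting in the strict sense if source and target have the same $F,V,\partial,g$ and $h^F,h_V$ are identities. A modular operad in a symmetric monoidal category $\mathcal C$ is a (strong) symmetric monoidal functor $\mathrm{MGr^{st}}\to\mathcal C$ that sends graftings to isomorphisms. **Data.** Let $\mathcal C$ be a symmetric monoidal category with * objects $C(g,I)$ for all integers $g\ge0$ and finite sets $I$ with $2g-2+\#I>0$; * isomorphisms $c_s\colon C(g,I)\to C(g,J)$ for all bijections $s\colon I\to J$; * maps $c^l(i,i')\colon C(g,I)\to C(g+1,I\setminus\{i,i'\})$ for distinct $i,i'\in I$; * maps $c(i,i')\colon C(g,I)\otimes C(g',I')\to C(g+g',(I\sqcup I')\setminus\{i,i'\})$ for $i\in I$, $i'\in I'$. Suppose that the following hold, where sets that agree up to the canonical bijection sending each label to itself are identified (through $c_s$ for this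 bijection $s$), associators are suppressed, and bars denote restrictions to the remaining labels: 0. $c^l(i,i')=c^l(i',i)$, and $c(i,i')=c(i',i)\circ\beta$ with $\beta\colon C(g,I)\otimes C(g',I')\to C(g',I')\otimes C(g,I)$ the symmetry; 1. $c_{s'\circ s}=c_{s'}\circ c_s$ for $s\colon I\to J$, $s'\colon J\to K$; 2. $c_{\bar s}\circ c^l(i,i')=c^l(s(i),s(i'))\circ c_s$; 3. $c(s(i),s'(i'))\circ(c_s\otimes c_{s'})=c_{\overline{s\sqcup s'}}\circ c(i,i')$; 4. $c^l(i_1,i_1')\circ c^l(i_2,i_2')=c^l(i_2,i_2')\circ c^l(i_1,i_1')$ for distinct $i_1,i_1',i_2,i_2'\in I$; 5. $c^l(i_1,i_1')\circ c(i_2,i_2')=c(i_2,i_2')\circ(c^l(i_1,i_1')\otimes\mathrm{id})$ for distinct $i_1,i_1',i_2\in I$ and $i_2'\in I'$; and $c^l(i_2,i_2')\circ c(i_1,i_1')=c^l(i_1,i_1')\circ c(i_2,i_2')$ for $i_1\ne i_2$ in $I$ and $i_1'\neq i_2'$ in $I'$; 6. $c(i_1,i_1')\circ(\mathrm{id}\otimes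 c(i_2,i_2'))=c(i_2,i_2')\circ(c(i_1,i_1')\otimes\mathrm{id})$ for $i_1\in I$, $i_1'\ne i_2$ in $I'$ and $i_2'\in I''$. **Conclusion.** There is a modular operad $O\colon\mathrm{MGr^{st}}\to\mathcal C$ such that * $O(\tau)=C(g(v),F_\tau)$ for every $\tau$ with a single vertex $v$; * $O$ sends graftings in the strict sense to identities; * $O(h)=c_{(h^F)^{-1}}$ for every isomorphism $h$ between graphs with a single vertex (in particular for automorphisms of corollas); * if $h\colon\tau\to\sigma$ contracts a single loop $\{f,f'\}$ of a graph $\tau$ with a single vertex and does nothing else, then $O(h)=c^l(f,f')$; * if $\tau$ is obtained from the disjoint union of two graphs $\tau_1,\tau_2$ with a single vertex each by grafting tails, and $h\colon\tau\to\sigma$ contracts a single edge $\{f_1,f_2\}$ of $\tau$ with $f_1\in F_{\tau_1}$, $f_2\in F_{\tau_2}$ and does nothing else, then $O(h)=c(f_1,f_2)$, where $O(\tau)=O(\tau_1\sqcup\tau_2)$ is identified with $O(\tau_1)\otimes O(\tau_2)$ by the monoidal structure of $O$. In the last two items $F_\sigma$ is identified with the set of flags that are not contracted through $h^F$. -/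

import Mathlib

open CategoryTheory MonoidalCategory

universe u v w

/-! ### Modular graphs -/

/-- A (finite) modular graph: flags, vertices, the boundary map, the involution `inv` on the flags
(its fixed points are the tails, its two-element orbits the edges), and a genus labeling.
Tails, multiple edges, loops and several (or no) connected components are allowed. -/
structure ModularGraph where
  V : Type u
  F : Type u
  finite_V : Finite V
  finite_F : Finite F
  bdry : F → V
  inv : F → F
  inv_inv : ∀ f, inv (inv f) = f
  genus : V → ℕ

namespace ModularGraph

attribute [instance] finite_V finite_F

noncomputable instance (τ : ModularGraph.{u}) : Fintype τ.V := Fintype.ofFinite _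
noncomputable instance (τ : ModularGraph.{u}) : Fintype τ.F := Fintype.ofFinite _

open scoped Classical in
/-- A morphism `h : τ → σ` of modular graphs: an injective map `flagMap = h^F : F_σ → F_τ`, a
surjective map `vertexMap = h_V : V_τ → V_σ`, and a fixed-point free involution `j_h` of the set
`F_τ ∖ h^F(F_σ)` of contracted flags. Here `j_h` is extended by the identity to `pair : F_τ → F_τ`,
so that the contracted flags are exactly the flags moved by `pair`. -/
@[ext]
structure Hom (τ σ : ModularGraph.{u}) where
  flagMap : σ.F → τ.F
  vertexMap : τ.V → σ.V
  pair : τ.F → τ.F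
  flagMap_injective : Function.Injective flagMap
  vertexMap_surjective : Function.Surjective vertexMap
  pair_pair : ∀ f, pair (pair f) = f
  pair_eq_self_iff : ∀ f, pair f = f ↔ f ∈ Set.range flagMap
  /-- an edge of `τ` one of whose flags is contracted is contracted as an edge -/
  pair_eq_inv : ∀ f, pair f ≠ f → τ.inv f ≠ f → pair f = τ.inv f
  /-- an edge of `τ` that is not contracted corresponds to an edge of `σ` -/
  inv_flagMap : ∀ f, τ.inv (flagMap f) ≠ flagMap f → τ.inv (flagMap f) = flagMap (σ.inv f)
  /-- `h_V` is compatible with the boundary maps on the flags that are not contracted -/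
  vertexMap_bdry : ∀ f, vertexMap (τ.bdry (flagMap f)) = σ.bdry f
  /-- the two ends of a contracted (actual or virtual) edge have the same image -/
  vertexMap_pair : ∀ f, vertexMap (τ.bdry (pair f)) = vertexMap (τ.bdry f)
  /-- two vertices with the same image are joined by a path of contracted edges -/
  connected : ∀ a b, vertexMap a = vertexMap b →
    Relation.ReflTransGen (fun x y => ∃ f, pair f ≠ f ∧ τ.bdry f = x ∧ τ.bdry (pair f) = y) a b
  /-- The genus of `v` is the sum of the genera of its preimages plus the number of independent
  loops of the connected graph formed by the preimages of `v` and the contracted edges between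
  them, that is, `g(v) - 1 = ∑ (g(w) - 1) + #{contracted edges over v}`. This is twice that
  equation: each contracted edge over `v` consists of two contracted flags. -/
  genus_eq : ∀ v, 2 * (σ.genus v : ℤ) - 2 =
    ∑ w with vertexMap w = v, (2 * (τ.genus w : ℤ) - 2) +
      (Finset.univ.filter fun f => pair f ≠ f ∧ vertexMap (τ.bdry f) = v).card

/-- A morphism that is bijective on flags and on vertices, and compatible with the rest. -/
def Hom.ofEquiv {τ σ : ModularGraph.{u}} (eV : τ.V ≃ σ.V) (eF : σ.F ≃ τ.F)
    (hb : ∀ f, eV (τ.bdry (eF f)) = σ.bdry f)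
    (hi : ∀ f, τ.inv (eF f) ≠ eF f → τ.inv (eF f) = eF (σ.inv f))
    (hg : ∀ x, σ.genus (eV x) = τ.genus x) : Hom τ σ where
  flagMap := eF
  vertexMap := eV
  pair := id
  flagMap_injective := eF.injective
  vertexMap_surjective := eV.surjective
  pair_pair _ := rfl
  pair_eq_self_iff f := by simp
  pair_eq_inv f h := absurd rfl h
  inv_flagMap := hi
  vertexMap_bdry := hb
  vertexMap_pair _ := rfl
  connected a b h := by rw [eV.injective h]
  genus_eq v := by
    classical
    obtain ⟨x, rfl⟩ := eV.surjective v
    rw [Finset.sum_filter]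
    simp [hg]

/-- Composition: `(g ∘ h)^F = h^F ∘ g^F`, `(g ∘ h)_V = g_V ∘ h_V`, and `j_{gh}` is `j_h` on the flags
contracted by `h` and is induced by `j_g` on the other contracted flags. -/
noncomputable def Hom.comp {τ σ ρ : ModularGraph.{u}} (h : Hom τ σ) (g : Hom σ ρ) : Hom τ ρ := by
  classical
  have ext_apply : ∀ f, Function.extend h.flagMap (h.flagMap ∘ g.pair) h.pair (h.flagMap f) =
      h.flagMap (g.pair f) := fun f => h.flagMap_injective.extend_apply _ _ f
  have ext_apply' : ∀ f, (f ∉ Set.range h.flagMap) →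
      Function.extend h.flagMap (h.flagMap ∘ g.pair) h.pair f = h.pair f := fun f hf =>
    Function.extend_apply' _ _ f (by simpa using hf)
  have pair_not : ∀ f, (f ∉ Set.range h.flagMap) → h.pair f ∉ Set.range h.flagMap := by
    intro f hf hf'
    rw [← h.pair_eq_self_iff, h.pair_pair] at hf'
    exact hf ((h.pair_eq_self_iff f).1 hf'.symm)
  exact
  { flagMap := h.flagMap ∘ g.flagMap
    vertexMap := g.vertexMap ∘ h.vertexMap
    pair := Function.extend h.flagMap (h.flagMap ∘ g.pair) h.pair
    flagMap_injective := h.flagMap_injective.comp g.flagMap_injective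
    vertexMap_surjective := g.vertexMap_surjective.comp h.vertexMap_surjective
    pair_pair := by
      intro f
      by_cases hf : f ∈ Set.range h.flagMap
      · obtain ⟨f, rfl⟩ := hf
        rw [ext_apply, ext_apply, g.pair_pair]
      · rw [ext_apply' f hf, ext_apply' _ (pair_not f hf), h.pair_pair]
    pair_eq_self_iff := by
      intro f
      by_cases hf : f ∈ Set.range h.flagMap
      · obtain ⟨f, rfl⟩ := hf
        rw [ext_apply, h.flagMap_injective.eq_iff, g.pair_eq_self_iff]
        simp [h.flagMap_injective.eq_iff]
      · rw [ext_apply' f hf, h.pair_eq_self_iff]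
        refine ⟨fun h' => absurd h' hf, ?_⟩
        rintro ⟨a, rfl⟩
        exact ⟨_, rfl⟩
    pair_eq_inv := by
      intro f hf hi
      by_cases hr : f ∈ Set.range h.flagMap
      · obtain ⟨f, rfl⟩ := hr
        rw [ext_apply] at hf ⊢
        have h1 := h.inv_flagMap f hi
        rw [h1] at hi ⊢
        rw [g.pair_eq_inv f (fun h' => hf (by rw [h'])) (fun h' => hi (by rw [h']))]
      · rw [ext_apply' f hr] at hf ⊢
        exact h.pair_eq_inv f hf hi
    inv_flagMap := by
      intro f hi
      have h1 := h.inv_flagMap _ hi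
      simp only [Function.comp_apply] at hi h1 ⊢
      rw [h1] at hi ⊢
      rw [g.inv_flagMap f (fun h' => hi (by rw [h']))]
    vertexMap_bdry := by
      intro f
      simp [h.vertexMap_bdry, g.vertexMap_bdry]
    vertexMap_pair := by
      intro f
      by_cases hf : f ∈ Set.range h.flagMap
      · obtain ⟨f, rfl⟩ := hf
        simp [ext_apply, h.vertexMap_bdry, g.vertexMap_pair]
      · simp [ext_apply' f hf, h.vertexMap_pair]
    connected := by
      have key : ∀ a b, h.vertexMap a = h.vertexMap b →
          Relation.ReflTransGen (fun x y => ∃ f,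
            Function.extend h.flagMap (h.flagMap ∘ g.pair) h.pair f ≠ f ∧ τ.bdry f = x ∧
            τ.bdry (Function.extend h.flagMap (h.flagMap ∘ g.pair) h.pair f) = y) a b := by
        intro a b hab
        refine Relation.ReflTransGen.mono ?_ _ _ (h.connected a b hab)
        rintro x y ⟨f, hf, rfl, rfl⟩
        have : f ∉ Set.range h.flagMap := fun h' => hf ((h.pair_eq_self_iff f).2 h')
        exact ⟨f, by rwa [ext_apply' f this], rfl, by rw [ext_apply' f this]⟩
      intro a b hab
      have := g.connected _ _ hab
      generalize hc : h.vertexMap b = c at this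
      clear hab
      induction this generalizing b with
      | refl => exact key a b hc.symm
      | @tail c d _ hcd ih =>
        obtain ⟨f, hf, rfl, rfl⟩ := hcd
        refine ((ih (τ.bdry (h.flagMap f)) (h.vertexMap_bdry f)).tail
          ⟨h.flagMap f, ?_, rfl, rfl⟩).trans (key _ _ ?_)
        · rw [ext_apply]
          exact fun h' => hf (h.flagMap_injective h')
        · rw [ext_apply, h.vertexMap_bdry, hc]
    genus_eq := by
      intro v
      rw [g.genus_eq v, Finset.sum_congr rfl (fun w _ => h.genus_eq w), Finset.sum_add_distrib,
        add_assoc]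
      congr 1
      · rw [← Finset.sum_fiberwise_of_maps_to (s := Finset.univ.filter
          fun w => (g.vertexMap ∘ h.vertexMap) w = v)
          (t := Finset.univ.filter fun w => g.vertexMap w = v) (g := h.vertexMap) (by simp)]
        refine Finset.sum_congr rfl fun w hw => Finset.sum_congr ?_ fun _ _ => rfl
        ext x
        simp only [Finset.mem_filter, Finset.mem_univ, true_and, Function.comp_apply] at hw ⊢
        constructor
        · rintro rfl
          exact ⟨hw, rfl⟩
        · exact fun h' => h'.2
      · have hsplit : (Finset.univ.filter fun f =>
            Function.extend h.flagMap (h.flagMap ∘ g.pair) h.pair f ≠ f ∧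
              (g.vertexMap ∘ h.vertexMap) (τ.bdry f) = v) =
            (Finset.univ.filter fun f => h.pair f ≠ f ∧ g.vertexMap (h.vertexMap (τ.bdry f)) = v) ∪
            (Finset.univ.filter fun f => g.pair f ≠ f ∧ g.vertexMap (σ.bdry f) = v).image
              h.flagMap := by
          ext f
          by_cases hf : f ∈ Set.range h.flagMap
          · have h0 := (h.pair_eq_self_iff f).2 hf
            obtain ⟨f, rfl⟩ := hf
            simp [ext_apply, h.flagMap_injective.eq_iff, h0, h.vertexMap_bdry]
          · have : ∀ a, h.flagMap a ≠ f := fun a ha => hf ⟨a, ha⟩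
            simp [this]
        rw [hsplit, Finset.card_union_of_disjoint, Finset.card_image_of_injective _
          h.flagMap_injective, Finset.card_eq_sum_card_fiberwise (f := fun f =>
            h.vertexMap (τ.bdry f)) (t := Finset.univ.filter fun w => g.vertexMap w = v)]
        · push_cast
          congr 1
          refine Finset.sum_congr rfl fun w hw => ?_
          congr 2
          ext f
          simp only [Finset.mem_filter, Finset.mem_univ, true_and] at hw ⊢
          constructor
          · rintro ⟨h1, rfl⟩
            exact ⟨⟨h1, hw⟩, rfl⟩
          · exact fun h' => ⟨h'.1.1, h'.2⟩
        · intro f hf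
          simpa using (by simpa using hf : _ ∧ _).2
        · rw [Finset.disjoint_left]
          intro f hf hf'
          simp only [Finset.mem_filter, Finset.mem_univ, true_and, Finset.mem_image] at hf hf'
          obtain ⟨a, _, rfl⟩ := hf'
          exact hf.1 ((h.pair_eq_self_iff _).2 ⟨a, rfl⟩) }

/-- The category `MGr` of modular graphs. -/
noncomputable instance : Category ModularGraph.{u} where
  Hom := Hom
  id τ := Hom.ofEquiv (Equiv.refl _) (Equiv.refl _) (fun _ => rfl) (fun _ _ => rfl) (fun _ => rfl)
  comp := Hom.comp
  id_comp h := by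
    refine Hom.ext rfl rfl ?_
    funext f
    exact Function.injective_id.extend_apply _ _ f
  comp_id h := by
    refine Hom.ext rfl rfl ?_
    funext f
    by_cases hf : f ∈ Set.range h.flagMap
    · have h0 := (h.pair_eq_self_iff f).2 hf
      obtain ⟨f, rfl⟩ := hf
      exact (h.flagMap_injective.extend_apply _ _ f).trans h0.symm
    · exact Function.extend_apply' _ _ f (by simpa using hf)
  assoc {τ σ ρ κ} h g k := by
    refine Hom.ext rfl rfl ?_
    funext f
    change Function.extend (h.flagMap ∘ g.flagMap) ((h.flagMap ∘ g.flagMap) ∘ k.pair)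
        (Function.extend h.flagMap (h.flagMap ∘ g.pair) h.pair) f =
      Function.extend h.flagMap (h.flagMap ∘ Function.extend g.flagMap (g.flagMap ∘ k.pair) g.pair)
        h.pair f
    have hhg := h.flagMap_injective.comp g.flagMap_injective
    by_cases hf : ∃ a, h.flagMap a = f
    · obtain ⟨f, rfl⟩ := hf
      rw [h.flagMap_injective.extend_apply]
      by_cases hf : ∃ a, g.flagMap a = f
      · obtain ⟨f, rfl⟩ := hf
        have := hhg.extend_apply ((h.flagMap ∘ g.flagMap) ∘ k.pair)
          (Function.extend h.flagMap (h.flagMap ∘ g.pair) h.pair) f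
        simp only [Function.comp_apply] at this ⊢
        rw [this, g.flagMap_injective.extend_apply]
        rfl
      · rw [Function.extend_apply', h.flagMap_injective.extend_apply]
        · simp [Function.extend_apply' _ _ f hf]
        · rintro ⟨a, ha⟩
          exact hf ⟨a, h.flagMap_injective ha⟩
    · rw [Function.extend_apply', Function.extend_apply' _ _ f hf, Function.extend_apply' _ _ f hf]
      rintro ⟨a, ha⟩
      exact hf ⟨_, ha⟩

@[ext]
theorem hom_ext {τ σ : ModularGraph.{u}} {h k : τ ⟶ σ} (hF : ∀ f, h.flagMap f = k.flagMap f)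
    (hV : ∀ x, h.vertexMap x = k.vertexMap x) (hp : ∀ f, h.pair f = k.pair f) : h = k :=
  Hom.ext (funext hF) (funext hV) (funext hp)

@[simp] theorem id_flagMap (τ : ModularGraph.{u}) (f : τ.F) : Hom.flagMap (𝟙 τ) f = f := rfl
@[simp] theorem id_vertexMap (τ : ModularGraph.{u}) (x : τ.V) : Hom.vertexMap (𝟙 τ) x = x := rfl
@[simp] theorem id_pair (τ : ModularGraph.{u}) (f : τ.F) : Hom.pair (𝟙 τ) f = f := rfl
@[simp] theorem comp_flagMap {τ σ ρ : ModularGraph.{u}} (h : τ ⟶ σ) (g : σ ⟶ ρ) (f : ρ.F) :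
    (h ≫ g).flagMap f = h.flagMap (g.flagMap f) := rfl
@[simp] theorem comp_vertexMap {τ σ ρ : ModularGraph.{u}} (h : τ ⟶ σ) (g : σ ⟶ ρ) (x : τ.V) :
    (h ≫ g).vertexMap x = g.vertexMap (h.vertexMap x) := rfl
theorem comp_pair_flagMap {τ σ ρ : ModularGraph.{u}} (h : τ ⟶ σ) (g : σ ⟶ ρ) (f : σ.F) :
    (h ≫ g).pair (h.flagMap f) = h.flagMap (g.pair f) :=
  h.flagMap_injective.extend_apply _ _ f
theorem comp_pair_of_notMem {τ σ ρ : ModularGraph.{u}} (h : τ ⟶ σ) (g : σ ⟶ ρ) (f : τ.F)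
    (hf : f ∉ Set.range h.flagMap) : (h ≫ g).pair f = h.pair f :=
  Function.extend_apply' _ _ f (by simpa using hf)

/-- An isomorphism of modular graphs from bijections of vertices and flags. -/
noncomputable def isoOfEquiv {τ σ : ModularGraph.{u}} (eV : τ.V ≃ σ.V) (eF : σ.F ≃ τ.F)
    (hb : ∀ f, eV (τ.bdry (eF f)) = σ.bdry f)
    (hi : ∀ f, τ.inv (eF f) = eF (σ.inv f))
    (hg : ∀ x, σ.genus (eV x) = τ.genus x) : τ ≅ σ where
  hom := Hom.ofEquiv eV eF hb (fun f _ => hi f) hg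
  inv := Hom.ofEquiv eV.symm eF.symm
    (fun f => by rw [Equiv.symm_apply_eq, ← hb]; simp)
    (fun f _ => by rw [Equiv.eq_symm_apply, ← hi]; simp)
    (fun x => by rw [← hg]; simp)
  hom_inv_id := by
    refine hom_ext (fun f => eF.apply_symm_apply f) (fun x => eV.symm_apply_apply x) fun f => ?_
    obtain ⟨f, rfl⟩ := eF.surjective f
    exact comp_pair_flagMap (Hom.ofEquiv eV eF hb (fun f _ => hi f) hg) _ f
  inv_hom_id := by
    refine hom_ext (fun f => eF.symm_apply_apply f) (fun x => eV.apply_symm_apply x) fun f => ?_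
    obtain ⟨f, rfl⟩ := eF.symm.surjective f
    exact comp_pair_flagMap (Hom.ofEquiv (σ := τ) eV.symm eF.symm _ _ _) _ f

theorem comp_pair_of_right {τ σ ρ : ModularGraph.{u}} (h : τ ⟶ σ) (g : σ ⟶ ρ)
    (hg : ∀ f, g.pair f = f) (f : τ.F) : (h ≫ g).pair f = h.pair f := by
  by_cases hf : f ∈ Set.range h.flagMap
  · rw [(h.pair_eq_self_iff f).2 hf]
    obtain ⟨f, rfl⟩ := hf
    rw [comp_pair_flagMap, hg]
  · exact comp_pair_of_notMem h g f hf

theorem isoOfEquiv_comp_pair {τ σ ρ : ModularGraph.{u}} (eV : τ.V ≃ σ.V) (eF : σ.F ≃ τ.F) (hb hi hg)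
    (k : σ ⟶ ρ) (f : τ.F) :
    ((isoOfEquiv eV eF hb hi hg).hom ≫ k).pair f = eF (k.pair (eF.symm f)) := by
  obtain ⟨f, rfl⟩ := eF.surjective f
  rw [eF.symm_apply_apply]
  exact comp_pair_flagMap (isoOfEquiv eV eF hb hi hg).hom k f

theorem comp_isoOfEquiv_pair {τ σ ρ : ModularGraph.{u}} (eV : τ.V ≃ σ.V) (eF : σ.F ≃ τ.F) (hb hi hg)
    (k : ρ ⟶ τ) (f : ρ.F) :
    (k ≫ (isoOfEquiv eV eF hb hi hg).hom).pair f = k.pair f :=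
  comp_pair_of_right _ _ (fun _ => rfl) f

/-! ### Disjoint union -/

/-- The disjoint union of two modular graphs. -/
def disjointUnion (τ σ : ModularGraph.{u}) : ModularGraph.{u} where
  V := τ.V ⊕ σ.V
  F := τ.F ⊕ σ.F
  finite_V := inferInstance
  finite_F := inferInstance
  bdry := Sum.map τ.bdry σ.bdry
  inv := Sum.map τ.inv σ.inv
  inv_inv := by rintro (f | f) <;> simp [inv_inv]
  genus := Sum.elim τ.genus σ.genus

/-- The empty graph. -/
def empty : ModularGraph.{u} where
  V := PEmpty
  F := PEmpty
  finite_V := inferInstance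
  finite_F := inferInstance
  bdry := id
  inv := id
  inv_inv _ := rfl
  genus := PEmpty.elim

theorem sum_V_disjointUnion {M : Type*} [AddCommMonoid M] (τ σ : ModularGraph.{u})
    (φ : (τ.disjointUnion σ).V → M) :
    ∑ x, φ x = ∑ a : τ.V, φ (Sum.inl a) + ∑ b : σ.V, φ (Sum.inr b) := by
  have key : ∀ ψ : τ.V ⊕ σ.V → M, ∑ x, ψ x = ∑ a, ψ (Sum.inl a) + ∑ b, ψ (Sum.inr b) :=
    fun ψ => Fintype.sum_sum_type ψ
  refine Eq.trans ?_ (key φ)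
  exact Finset.sum_congr (Finset.ext fun _ => ⟨fun _ => @Finset.mem_univ _ (_) _,
    fun _ => @Finset.mem_univ _ (_) _⟩) fun _ _ => rfl

theorem sum_F_disjointUnion {M : Type*} [AddCommMonoid M] (τ σ : ModularGraph.{u})
    (φ : (τ.disjointUnion σ).F → M) :
    ∑ x, φ x = ∑ a : τ.F, φ (Sum.inl a) + ∑ b : σ.F, φ (Sum.inr b) := by
  have key : ∀ ψ : τ.F ⊕ σ.F → M, ∑ x, ψ x = ∑ a, ψ (Sum.inl a) + ∑ b, ψ (Sum.inr b) :=
    fun ψ => Fintype.sum_sum_type ψ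
  refine Eq.trans ?_ (key φ)
  exact Finset.sum_congr (Finset.ext fun _ => ⟨fun _ => @Finset.mem_univ _ (_) _,
    fun _ => @Finset.mem_univ _ (_) _⟩) fun _ _ => rfl

/-- The disjoint union of two morphisms. -/
def Hom.disjointUnion {τ τ' σ σ' : ModularGraph.{u}} (h : Hom τ σ) (k : Hom τ' σ') :
    Hom (τ.disjointUnion τ') (σ.disjointUnion σ') where
  flagMap := Sum.map h.flagMap k.flagMap
  vertexMap := Sum.map h.vertexMap k.vertexMap
  pair := Sum.map h.pair k.pair
  flagMap_injective := h.flagMap_injective.sumMap k.flagMap_injective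
  vertexMap_surjective := h.vertexMap_surjective.sumMap k.vertexMap_surjective
  pair_pair := by rintro (f | f) <;> simp [Hom.pair_pair] <;> rfl
  pair_eq_self_iff := by
    rintro (f | f)
    · change Sum.map h.pair k.pair (Sum.inl f) = Sum.inl f ↔ _
      rw [Sum.map_inl, Sum.inl_injective.eq_iff, h.pair_eq_self_iff]
      constructor
      · rintro ⟨a, rfl⟩
        exact ⟨Sum.inl a, rfl⟩
      · rintro ⟨a | a, ha⟩
        all_goals simp at ha
        exact ⟨a, Sum.inl_injective ha⟩
    · change Sum.map h.pair k.pair (Sum.inr f) = Sum.inr f ↔ _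
      rw [Sum.map_inr, Sum.inr_injective.eq_iff, k.pair_eq_self_iff]
      constructor
      · rintro ⟨a, rfl⟩
        exact ⟨Sum.inr a, rfl⟩
      · rintro ⟨a | a, ha⟩
        all_goals simp at ha
        exact ⟨a, Sum.inr_injective ha⟩
  pair_eq_inv := by
    rintro (f | f)
    · simpa [ModularGraph.disjointUnion] using h.pair_eq_inv f
    · simpa [ModularGraph.disjointUnion] using k.pair_eq_inv f
  inv_flagMap := by
    rintro (f | f)
    · simpa [ModularGraph.disjointUnion] using h.inv_flagMap f
    · simpa [ModularGraph.disjointUnion] using k.inv_flagMap f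
  vertexMap_bdry := by
    rintro (f | f)
    · simpa [ModularGraph.disjointUnion] using h.vertexMap_bdry f
    · simpa [ModularGraph.disjointUnion] using k.vertexMap_bdry f
  vertexMap_pair := by
    rintro (f | f)
    · simpa [ModularGraph.disjointUnion] using h.vertexMap_pair f
    · simpa [ModularGraph.disjointUnion] using k.vertexMap_pair f
  connected := by
    rintro (a | a) (b | b) hab
    · refine Relation.ReflTransGen.lift (p := fun x y => ∃ f, Sum.map h.pair k.pair f ≠ f ∧
        (τ.disjointUnion τ').bdry f = x ∧ (τ.disjointUnion τ').bdry (Sum.map h.pair k.pair f) = y)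
        Sum.inl ?_ _ _ (h.connected a b (Sum.inl_injective hab))
      rintro x y ⟨f, hf, rfl, rfl⟩
      exact ⟨Sum.inl f, by simpa using hf, rfl, rfl⟩
    · simp at hab
    · simp at hab
    · refine Relation.ReflTransGen.lift (p := fun x y => ∃ f, Sum.map h.pair k.pair f ≠ f ∧
        (τ.disjointUnion τ').bdry f = x ∧ (τ.disjointUnion τ').bdry (Sum.map h.pair k.pair f) = y)
        Sum.inr ?_ _ _ (k.connected a b (Sum.inr_injective hab))
      rintro x y ⟨f, hf, rfl, rfl⟩
      exact ⟨Sum.inr f, by simpa using hf, rfl, rfl⟩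
  genus_eq := by
    classical
    rintro (x | x)
    · have := h.genus_eq x
      simp only [Finset.card_filter, Finset.sum_filter] at this ⊢
      erw [sum_V_disjointUnion, sum_F_disjointUnion]
      simpa [ModularGraph.disjointUnion] using this
    · have := k.genus_eq x
      simp only [Finset.card_filter, Finset.sum_filter] at this ⊢
      erw [sum_V_disjointUnion, sum_F_disjointUnion]
      simpa [ModularGraph.disjointUnion] using this

/-- The monoidal structure given by disjoint union. -/
noncomputable instance : MonoidalCategoryStruct ModularGraph.{u} where
  tensorObj := disjointUnion
  tensorHom h k := Hom.disjointUnion h k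
  whiskerLeft τ _ _ h := Hom.disjointUnion (𝟙 τ) h
  whiskerRight h τ := Hom.disjointUnion h (𝟙 τ)
  tensorUnit := empty
  associator τ σ ρ := isoOfEquiv (Equiv.sumAssoc _ _ _) (Equiv.sumAssoc _ _ _).symm
    (by rintro (f | f | f) <;> rfl) (by rintro (f | f | f) <;> rfl)
    (by rintro ((x | x) | x) <;> rfl)
  leftUnitor τ := isoOfEquiv (Equiv.emptySum PEmpty _) (Equiv.emptySum PEmpty _).symm
    (fun _ => rfl) (fun _ => rfl) (by rintro (x | x); exacts [x.elim, rfl])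
  rightUnitor τ := isoOfEquiv (Equiv.sumEmpty _ PEmpty) (Equiv.sumEmpty _ PEmpty).symm
    (fun _ => rfl) (fun _ => rfl) (by rintro (x | x); exacts [rfl, x.elim])

theorem tensor_comp_pair {τ σ ρ τ' σ' ρ' : ModularGraph.{u}} (h : τ ⟶ σ) (k : τ' ⟶ σ')
    (h' : σ ⟶ ρ) (k' : σ' ⟶ ρ') (f : τ.F ⊕ τ'.F) :
    ((h ⊗ₘ k) ≫ (h' ⊗ₘ k')).pair f = Sum.map (h ≫ h').pair (k ≫ k').pair f := by
  by_cases hf : f ∈ Set.range (h ⊗ₘ k).flagMap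
  · obtain ⟨f | f, rfl⟩ := hf
    · refine (comp_pair_flagMap _ _ _).trans ?_
      exact congrArg Sum.inl (comp_pair_flagMap h h' f).symm
    · refine (comp_pair_flagMap _ _ _).trans ?_
      exact congrArg Sum.inr (comp_pair_flagMap k k' f).symm
  · refine (comp_pair_of_notMem _ _ _ hf).trans ?_
    rcases f with f | f
    · refine congrArg Sum.inl (comp_pair_of_notMem h h' f ?_).symm
      rintro ⟨a, rfl⟩
      exact hf ⟨Sum.inl a, rfl⟩
    · refine congrArg Sum.inr (comp_pair_of_notMem k k' f ?_).symm
      rintro ⟨a, rfl⟩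
      exact hf ⟨Sum.inr a, rfl⟩

noncomputable instance : MonoidalCategory ModularGraph.{u} :=
  MonoidalCategory.ofTensorHom
    (id_tensorHom_id := fun τ σ => by
      refine hom_ext ?_ ?_ ?_ <;> rintro (x | x) <;> rfl)
    (id_tensorHom := fun _ _ _ _ => rfl)
    (tensorHom_id := fun _ _ => rfl)
    (tensorHom_comp_tensorHom := fun h k h' k' => by
      refine hom_ext ?_ ?_ ?_
      · rintro (x | x) <;> rfl
      · rintro (x | x) <;> rfl
      · exact tensor_comp_pair h k h' k')
    (associator_naturality := fun h k l => by
      refine hom_ext ?_ ?_ ?_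
      · rintro (x | x | x) <;> rfl
      · rintro ((x | x) | x) <;> rfl
      · intro x
        refine (comp_isoOfEquiv_pair ..).trans (Eq.trans ?_ (isoOfEquiv_comp_pair ..).symm)
        rcases x with ((x | x) | x) <;> rfl)
    (leftUnitor_naturality := fun h => by
      refine hom_ext ?_ ?_ ?_
      · intro x; rfl
      · rintro (x | x); exacts [x.elim, rfl]
      · intro x
        refine (comp_isoOfEquiv_pair ..).trans (Eq.trans ?_ (isoOfEquiv_comp_pair ..).symm)
        rcases x with (x | x); exacts [x.elim, rfl])
    (rightUnitor_naturality := fun h => by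
      refine hom_ext ?_ ?_ ?_
      · intro x; rfl
      · rintro (x | x); exacts [rfl, x.elim]
      · intro x
        refine (comp_isoOfEquiv_pair ..).trans (Eq.trans ?_ (isoOfEquiv_comp_pair ..).symm)
        rcases x with (x | x); exacts [rfl, x.elim])
    (pentagon := fun τ σ ρ κ => by
      refine hom_ext ?_ ?_ ?_
      · rintro (x | x | x | x) <;> rfl
      · rintro (((x | x) | x) | x) <;> rfl
      · intro x
        refine Eq.trans ?_ (comp_isoOfEquiv_pair ..).symm
        rw [← Category.assoc]
        refine (comp_pair_of_right _ _ ?_ _).trans ?_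
        · rintro (x | (x | x) | x) <;> rfl
        · refine (comp_isoOfEquiv_pair ..).trans ?_
          rcases x with (((x | x) | x) | x) <;> rfl)
    (triangle := fun τ σ => by
      refine hom_ext ?_ ?_ ?_
      · rintro (x | x) <;> rfl
      · rintro ((x | x) | x)
        exacts [rfl, x.elim, rfl]
      · intro x
        refine (comp_pair_of_right _ _ ?_ _).trans ?_
        · rintro (x | x | x)
          exacts [rfl, x.elim, rfl]
        · rcases x with ((x | x) | x)
          exacts [rfl, x.elim, rfl])

noncomputable instance : SymmetricCategory ModularGraph.{u} where
  braiding τ σ := isoOfEquiv (Equiv.sumComm _ _) (Equiv.sumComm _ _)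
    (by rintro (f | f) <;> rfl) (by rintro (f | f) <;> rfl) (by rintro (f | f) <;> rfl)
  braiding_naturality_right τ _ _ h := by
    refine hom_ext ?_ ?_ ?_
    · rintro (x | x) <;> rfl
    · rintro (x | x) <;> rfl
    · intro x
      refine (comp_isoOfEquiv_pair ..).trans (Eq.trans ?_ (isoOfEquiv_comp_pair ..).symm)
      rcases x with (x | x) <;> rfl
  braiding_naturality_left h τ := by
    refine hom_ext ?_ ?_ ?_
    · rintro (x | x) <;> rfl
    · rintro (x | x) <;> rfl
    · intro x
      refine (comp_isoOfEquiv_pair ..).trans (Eq.trans ?_ (isoOfEquiv_comp_pair ..).symm)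
      rcases x with (x | x) <;> rfl
  hexagon_forward τ σ ρ := by
    refine hom_ext ?_ ?_ ?_
    · rintro (x | x | x) <;> rfl
    · rintro ((x | x) | x) <;> rfl
    · intro x
      rw [← Category.assoc, ← Category.assoc]
      refine (comp_isoOfEquiv_pair ..).trans (Eq.trans ?_ (comp_pair_of_right _ _ ?_ _).symm)
      · refine (comp_isoOfEquiv_pair ..).trans (Eq.trans ?_ (comp_isoOfEquiv_pair ..).symm)
        rcases x with ((x | x) | x) <;> rfl
      · rintro (x | x | x) <;> rfl
  hexagon_reverse τ σ ρ := by
    refine hom_ext ?_ ?_ ?_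
    · rintro ((x | x) | x) <;> rfl
    · rintro (x | x | x) <;> rfl
    · intro x
      rw [← Category.assoc, ← Category.assoc]
      refine (comp_pair_of_right _ _ (fun _ => rfl) _).trans
        (Eq.trans ?_ (comp_pair_of_right _ _ ?_ _).symm)
      · refine (comp_isoOfEquiv_pair ..).trans
          (Eq.trans ?_ (comp_pair_of_right _ _ (fun _ => rfl) _).symm)
        rcases x with (x | x | x) <;> rfl
      · rintro ((x | x) | x) <;> rfl
  symmetry τ σ := by
    refine hom_ext ?_ ?_ ?_
    · rintro (x | x) <;> rfl
    · rintro (x | x) <;> rfl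
    · intro x
      exact comp_isoOfEquiv_pair ..

/-- `τ` is stable if `2 g(v) - 2 + #F(v) > 0` for every vertex `v`. -/
def isStable : ObjectProperty ModularGraph.{u} := fun τ =>
  ∀ v, (2 * (τ.genus v : ℤ) - 2) + Nat.card {f // τ.bdry f = v} > 0

instance : (isStable.{u}).IsMonoidal where
  prop_unit := fun v => v.elim
  prop_tensor := by
    rintro τ σ hτ hσ (v | v)
    · refine (hτ v).trans_eq ?_
      congr 2
      refine Nat.card_congr (Equiv.ofBijective (fun f => ⟨Sum.inl f.1, congrArg Sum.inl f.2⟩)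
        ⟨?_, ?_⟩)
      · intro f f' h
        exact Subtype.ext (Sum.inl_injective (congrArg Subtype.val h))
      · rintro ⟨f | f, h⟩
        · exact ⟨⟨f, Sum.inl_injective h⟩, rfl⟩
        · cases h
    · refine (hσ v).trans_eq ?_
      congr 2
      refine Nat.card_congr (Equiv.ofBijective (fun f => ⟨Sum.inr f.1, congrArg Sum.inr f.2⟩)
        ⟨?_, ?_⟩)
      · intro f f' h
        exact Subtype.ext (Sum.inr_injective (congrArg Subtype.val h))
      · rintro ⟨f | f, h⟩
        · cases h
        · exact ⟨⟨f, Sum.inr_injective h⟩, rfl⟩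

end ModularGraph

/-- The full subcategory `MGr^st` of stable modular graphs, symmetric monoidal under disjoint
union. -/
abbrev StableModularGraph := (ModularGraph.isStable.{u}).FullSubcategory

namespace StableModularGraph

/-! ### Graftings and contractions -/

/-- A grafting in the wide sense: no flags are contracted and no vertices are identified. -/
def IsGrafting {τ σ : StableModularGraph.{u}} (h : τ ⟶ σ) : Prop :=
  Function.Bijective h.hom.flagMap ∧ Function.Bijective h.hom.vertexMap

/-- The graph obtained from `τ` by grafting tails: the involution is replaced by an involution `j`
which has all the edges of `τ`, and which may join some tails of `τ` to new edges. -/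
def graft (τ : StableModularGraph.{u}) (j : τ.obj.F → τ.obj.F) (hj : ∀ f, j (j f) = f)
    (_hτ : ∀ f, τ.obj.inv f ≠ f → j f = τ.obj.inv f) : StableModularGraph.{u} where
  obj :=
    { V := τ.obj.V
      F := τ.obj.F
      finite_V := τ.obj.finite_V
      finite_F := τ.obj.finite_F
      bdry := τ.obj.bdry
      inv := j
      inv_inv := hj
      genus := τ.obj.genus }
  property := τ.property

/-- The grafting of tails as a morphism; it is the identity on vertices and on flags. -/
noncomputable def graftHom (τ : StableModularGraph.{u}) (j : τ.obj.F → τ.obj.F) (hj : ∀ f, j (j f) = f)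
    (hτ : ∀ f, τ.obj.inv f ≠ f → j f = τ.obj.inv f) : τ ⟶ τ.graft j hj hτ :=
  ObjectProperty.homMk (ModularGraph.Hom.ofEquiv (τ := τ.obj) (σ := (τ.graft j hj hτ).obj)
    (Equiv.refl _) (Equiv.refl _) (fun _ => rfl) (fun f hf => (hτ f hf).symm) (fun _ => rfl))

/-- `h : τ ⟶ σ` is the contraction of the single edge of `τ` formed by the flags `f` and `f'`:
these two flags form an edge, they are the only flags contracted by `h`, and `h` does not graft
any tails. -/
structure IsContraction {τ σ : StableModularGraph.{u}} (h : τ ⟶ σ) (f f' : τ.obj.F) : Prop where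
  ne : f ≠ f'
  inv_eq : τ.obj.inv f = f'
  mem_range : ∀ x, (x ≠ f ∧ x ≠ f') ↔ x ∈ Set.range h.hom.flagMap
  inv_flagMap : ∀ x, τ.obj.inv (h.hom.flagMap x) = h.hom.flagMap (σ.obj.inv x)

/-- The bijection from the flags that are not contracted to the flags of the target which is
inverse to `h^F`. -/
noncomputable def IsContraction.flagEquiv {τ σ : StableModularGraph.{u}} {h : τ ⟶ σ}
    {f f' : τ.obj.F} (hc : IsContraction h f f') : {x : τ.obj.F // x ≠ f ∧ x ≠ f'} ≃ σ.obj.F :=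
  (Equiv.subtypeEquivRight hc.mem_range).trans
    (Equiv.ofInjective h.hom.flagMap h.hom.flagMap_injective).symm

/-- The bijection `(h^F)⁻¹ : F_τ → F_σ` induced by an isomorphism `h : τ → σ`. -/
def flagEquivOfIso {τ σ : StableModularGraph.{u}} (h : τ ≅ σ) : τ.obj.F ≃ σ.obj.F where
  toFun := h.inv.hom.flagMap
  invFun := h.hom.hom.flagMap
  left_inv f := congrArg (fun k => ModularGraph.Hom.flagMap k f) (ObjectProperty.isoHom_inv_id_hom h)
  right_inv f := congrArg (fun k => ModularGraph.Hom.flagMap k f) (ObjectProperty.isoInv_hom_id_hom h)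

end StableModularGraph

/-! ### The gluing data -/

/-- A genus `g` and a finite set `I` of labels with `2 g - 2 + #I > 0`. -/
structure StablePair where
  g : ℕ
  I : Type u
  finite_I : Finite I
  stable : (2 * (g : ℤ) - 2) + Nat.card I > 0

namespace StablePair

attribute [instance] finite_I

theorem card_compl_pair {α : Type u} [Finite α] (a b : α) (h : a ≠ b) :
    Nat.card {x // x ≠ a ∧ x ≠ b} + 2 = Nat.card α := by
  classical
  have := Fintype.ofFinite α
  rw [Nat.card_eq_fintype_card, Nat.card_eq_fintype_card, Fintype.card_subtype,
    ← Finset.card_univ, ← Finset.card_pair h,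
    ← Finset.card_sdiff_add_card_eq_card (Finset.subset_univ {a, b})]
  congr 2
  ext x
  simp

/-- The pair `(g + 1, I ∖ {i, i'})`. -/
def loop (X : StablePair.{u}) (i i' : X.I) (h : i ≠ i') : StablePair.{u} where
  g := X.g + 1
  I := {x : X.I // x ≠ i ∧ x ≠ i'}
  finite_I := inferInstance
  stable := by
    have := X.stable
    have := card_compl_pair i i' h
    push_cast
    omega

/-- The pair `(g + g', (I ⊔ I') ∖ {i, i'})`. -/
def edge (X Y : StablePair.{u}) (i : X.I) (i' : Y.I) : StablePair.{u} where
  g := X.g + Y.g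
  I := {x : X.I ⊕ Y.I // x ≠ Sum.inl i ∧ x ≠ Sum.inr i'}
  finite_I := inferInstance
  stable := by
    have := X.stable
    have := Y.stable
    have := card_compl_pair (Sum.inl i : X.I ⊕ Y.I) (Sum.inr i') (by simp)
    have : Nat.card (X.I ⊕ Y.I) = _ := Nat.card_sum
    push_cast
    omega

/-- A label in `I ∖ {i, i'}`. -/
def loopMk {X : StablePair.{u}} {i i' : X.I} (h : i ≠ i') (x : X.I) (hx : x ≠ i) (hx' : x ≠ i') :
    (X.loop i i' h).I := ⟨x, hx, hx'⟩

/-- A label in `(I ⊔ I') ∖ {i, i'}` coming from `I`. -/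
def edgeInl {X Y : StablePair.{u}} {i : X.I} (i' : Y.I) (x : X.I) (hx : x ≠ i) :
    (X.edge Y i i').I := ⟨Sum.inl x, by simpa using hx⟩

/-- A label in `(I ⊔ I') ∖ {i, i'}` coming from `I'`. -/
def edgeInr {X Y : StablePair.{u}} (i : X.I) {i' : Y.I} (y : Y.I) (hy : y ≠ i') :
    (X.edge Y i i').I := ⟨Sum.inr y, by simpa using hy⟩

theorem loopMk_ne {X : StablePair.{u}} {i i' : X.I} (h : i ≠ i') {x y : X.I} (hxy : x ≠ y)
    (hx : x ≠ i) (hx' : x ≠ i') (hy : y ≠ i) (hy' : y ≠ i') :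
    loopMk h x hx hx' ≠ loopMk h y hy hy' :=
  fun e => hxy (congrArg Subtype.val e)

theorem edgeInl_ne {X Y : StablePair.{u}} {i : X.I} (i' : Y.I) {x y : X.I} (hxy : x ≠ y)
    (hx : x ≠ i) (hy : y ≠ i) : edgeInl i' x hx ≠ edgeInl i' y hy :=
  fun e => hxy (Sum.inl_injective (congrArg Subtype.val e))

theorem edgeInl_ne_edgeInr {X Y : StablePair.{u}} {i : X.I} {i' : Y.I} (x : X.I) (y : Y.I)
    (hx : x ≠ i) (hy : y ≠ i') : edgeInl i' x hx ≠ edgeInr i y hy :=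
  fun e => Sum.inl_ne_inr (congrArg Subtype.val e)

/-! The following bijections identify sets of remaining labels. Apart from `restrictLoop` and
`restrictEdge`, each of them sends a label to itself: the two sets would be equal if disjoint unions
and complements of subsets were formed on the nose. -/

/-- `I ∖ {i, i'} ≃ J ∖ {s i, s i'}`, the restriction of a bijection `s : I ≃ J`. -/
def restrictLoop {X Y : StablePair.{u}} (s : X.I ≃ Y.I) (i i' : X.I) (h : i ≠ i') :
    (X.loop i i' h).I ≃ (Y.loop (s i) (s i') (s.injective.ne h)).I :=
  s.subtypeEquiv fun x => by simp

/-- `(I ⊔ I') ∖ {i, i'} ≃ (J ⊔ J') ∖ {s i, s' i'}`, the restriction of `s ⊔ s'`. -/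
def restrictEdge {X Y X' Y' : StablePair.{u}} (s : X.I ≃ Y.I) (s' : X'.I ≃ Y'.I) (i : X.I)
    (i' : X'.I) : (X.edge X' i i').I ≃ (Y.edge Y' (s i) (s' i')).I :=
  (Equiv.sumCongr s s').subtypeEquiv fun x => by rcases x with x | x <;> simp

/-- `I ∖ {i, i'} ≃ I ∖ {i', i}`. -/
def loopSwap (X : StablePair.{u}) (i i' : X.I) (h : i ≠ i') :
    (X.loop i i' h).I ≃ (X.loop i' i h.symm).I :=
  Equiv.subtypeEquivRight fun _ => and_comm

/-- `(I ⊔ I') ∖ {i, i'} ≃ (I' ⊔ I) ∖ {i', i}`. -/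
def edgeSwap (X Y : StablePair.{u}) (i : X.I) (i' : Y.I) :
    (X.edge Y i i').I ≃ (Y.edge X i' i).I :=
  (Equiv.sumComm X.I Y.I).subtypeEquiv fun x => by cases x <;> simp

/-- `I ∖ {i₁, j₁} ∖ {i₂, j₂} ≃ I ∖ {i₂, j₂} ∖ {i₁, j₁}`. -/
def loopLoop (X : StablePair.{u}) {i₁ j₁ i₂ j₂ : X.I} (h₁ : i₁ ≠ j₁) (h₂ : i₂ ≠ j₂)
    (hii : i₁ ≠ i₂) (hij : i₁ ≠ j₂) (hji : j₁ ≠ i₂) (hjj : j₁ ≠ j₂) :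
    ((X.loop i₁ j₁ h₁).loop (loopMk h₁ i₂ hii.symm hji.symm) (loopMk h₁ j₂ hij.symm hjj.symm)
        (loopMk_ne h₁ h₂ _ _ _ _)).I ≃
      ((X.loop i₂ j₂ h₂).loop (loopMk h₂ i₁ hii hij) (loopMk h₂ j₁ hji hjj)
        (loopMk_ne h₂ h₁ _ _ _ _)).I where
  toFun x := ⟨⟨x.1.1, fun h => x.2.1 (Subtype.ext h), fun h => x.2.2 (Subtype.ext h)⟩,
    fun h => x.1.2.1 (congrArg Subtype.val h), fun h => x.1.2.2 (congrArg Subtype.val h)⟩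
  invFun x := ⟨⟨x.1.1, fun h => x.2.1 (Subtype.ext h), fun h => x.2.2 (Subtype.ext h)⟩,
    fun h => x.1.2.1 (congrArg Subtype.val h), fun h => x.1.2.2 (congrArg Subtype.val h)⟩
  left_inv _ := rfl
  right_inv _ := rfl

/-- `(I ⊔ I') ∖ {i₂, j₂} ∖ {i₁, j₁} ≃ (I ∖ {i₁, j₁} ⊔ I') ∖ {i₂, j₂}` for `i₁, j₁, i₂ ∈ I` and
`j₂ ∈ I'`. -/
def loopEdge (X Y : StablePair.{u}) {i₁ j₁ i₂ : X.I} (j₂ : Y.I) (h₁ : i₁ ≠ j₁)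
    (hi : i₁ ≠ i₂) (hj : j₁ ≠ i₂) :
    ((X.edge Y i₂ j₂).loop (edgeInl j₂ i₁ hi) (edgeInl j₂ j₁ hj) (edgeInl_ne j₂ h₁ hi hj)).I ≃
      ((X.loop i₁ j₁ h₁).edge Y (loopMk h₁ i₂ hi.symm hj.symm) j₂).I where
  toFun
    | ⟨⟨Sum.inl x, h⟩, h'⟩ => ⟨Sum.inl ⟨x, by
        refine ⟨fun e => h'.1 ?_, fun e => h'.2 ?_⟩ <;> subst e <;> rfl⟩,
        fun e => h.1 (congrArg (fun y => Sum.inl y.1) (Sum.inl_injective e)), Sum.inl_ne_inr⟩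
    | ⟨⟨Sum.inr x, h⟩, _⟩ => ⟨Sum.inr x, Sum.inr_ne_inl, fun e => h.2 (by
        rw [Sum.inr_injective e])⟩
  invFun
    | ⟨Sum.inl ⟨x, h'⟩, h⟩ => ⟨⟨Sum.inl x, by
        refine ⟨fun e => h.1 ?_, Sum.inl_ne_inr⟩
        cases Sum.inl_injective e
        rfl⟩,
        fun e => h'.1 (Sum.inl_injective (congrArg Subtype.val e)),
        fun e => h'.2 (Sum.inl_injective (congrArg Subtype.val e))⟩
    | ⟨Sum.inr x, h⟩ => ⟨⟨Sum.inr x, Sum.inr_ne_inl, fun e => h.2 (by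
        rw [Sum.inr_injective e])⟩,
        fun e => Sum.inr_ne_inl (congrArg Subtype.val e),
        fun e => Sum.inr_ne_inl (congrArg Subtype.val e)⟩
  left_inv := by rintro ⟨⟨x | x, h⟩, h'⟩ <;> rfl
  right_inv := by rintro ⟨x | x, h⟩ <;> rfl

/-- `(I ⊔ I') ∖ {i₁, j₁} ∖ {i₂, j₂} ≃ (I ⊔ I') ∖ {i₂, j₂} ∖ {i₁, j₁}` for `i₁, i₂ ∈ I` and
`j₁, j₂ ∈ I'`. -/
def edgeLoop (X Y : StablePair.{u}) {i₁ i₂ : X.I} {j₁ j₂ : Y.I} (hi : i₁ ≠ i₂) (hj : j₁ ≠ j₂) :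
    ((X.edge Y i₁ j₁).loop (edgeInl j₁ i₂ hi.symm) (edgeInr i₁ j₂ hj.symm)
        (edgeInl_ne_edgeInr _ _ _ _)).I ≃
      ((X.edge Y i₂ j₂).loop (edgeInl j₂ i₁ hi) (edgeInr i₂ j₁ hj)
        (edgeInl_ne_edgeInr _ _ _ _)).I where
  toFun x := ⟨⟨x.1.1, fun h => x.2.1 (Subtype.ext h), fun h => x.2.2 (Subtype.ext h)⟩,
    fun h => x.1.2.1 (congrArg Subtype.val h), fun h => x.1.2.2 (congrArg Subtype.val h)⟩
  invFun x := ⟨⟨x.1.1, fun h => x.2.1 (Subtype.ext h), fun h => x.2.2 (Subtype.ext h)⟩,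
    fun h => x.1.2.1 (congrArg Subtype.val h), fun h => x.1.2.2 (congrArg Subtype.val h)⟩
  left_inv _ := rfl
  right_inv _ := rfl

/-- `(I ⊔ (I' ⊔ I'') ∖ {i₂, j₂}) ∖ {i₁, j₁} ≃ ((I ⊔ I') ∖ {i₁, j₁} ⊔ I'') ∖ {i₂, j₂}` for `i₁ ∈ I`,
`j₁, i₂ ∈ I'` and `j₂ ∈ I''`. -/
def edgeEdge (X Y Z : StablePair.{u}) (i₁ : X.I) {j₁ i₂ : Y.I} (j₂ : Z.I) (h : j₁ ≠ i₂) :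
    (X.edge (Y.edge Z i₂ j₂) i₁ (edgeInl j₂ j₁ h)).I ≃
      ((X.edge Y i₁ j₁).edge Z (edgeInr i₁ i₂ h.symm) j₂).I where
  toFun
    | ⟨Sum.inl x, hx⟩ => ⟨Sum.inl ⟨Sum.inl x, by simpa using hx⟩,
        fun e => Sum.inl_ne_inr (congrArg Subtype.val (Sum.inl_injective e)), Sum.inl_ne_inr⟩
    | ⟨Sum.inr ⟨Sum.inl x, hx⟩, hx'⟩ => ⟨Sum.inl ⟨Sum.inr x, Sum.inr_ne_inl, fun e => hx'.2 (by
        cases Sum.inr_injective e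
        rfl)⟩,
        fun e => hx.1 (congrArg Sum.inl
          (Sum.inr_injective (congrArg Subtype.val (Sum.inl_injective e)))), Sum.inl_ne_inr⟩
    | ⟨Sum.inr ⟨Sum.inr x, hx⟩, _⟩ => ⟨Sum.inr x, Sum.inr_ne_inl, by simpa using hx⟩
  invFun
    | ⟨Sum.inl ⟨Sum.inl x, hx⟩, _⟩ => ⟨Sum.inl x, by simpa using hx, Sum.inl_ne_inr⟩
    | ⟨Sum.inl ⟨Sum.inr x, hx⟩, hx'⟩ => ⟨Sum.inr ⟨Sum.inl x, fun e => hx'.1 (by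
        cases Sum.inl_injective e
        rfl), Sum.inl_ne_inr⟩, Sum.inr_ne_inl,
        fun e => hx.2 (congrArg Sum.inr
          (Sum.inl_injective (congrArg Subtype.val (Sum.inr_injective e))))⟩
    | ⟨Sum.inr x, hx⟩ => ⟨Sum.inr ⟨Sum.inr x, by simpa using hx⟩, Sum.inr_ne_inl,
        fun e => Sum.inr_ne_inl (congrArg Subtype.val (Sum.inr_injective e))⟩
  left_inv := by rintro ⟨x | ⟨x | x, h⟩, h'⟩ <;> rfl
  right_inv := by rintro ⟨⟨x | x, h⟩ | x, h'⟩ <;> rfl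

end StablePair

section GluingData

variable (C : Type w) [Category.{v} C] [MonoidalCategory C]

/-- Objects `C(g, I)`, relabeling isomorphisms `c_s : C(g, I) ≅ C(g, J)`, and gluing maps
`c^l(i, i') : C(g, I) ⟶ C(g + 1, I ∖ {i, i'})` and
`c(i, i') : C(g, I) ⊗ C(g', I') ⟶ C(g + g', (I ⊔ I') ∖ {i, i'})`. -/
structure GluingData where
  obj : StablePair.{u} → C
  /-- for pairs of the same genus, and a bijection of the sets of labels -/
  relabel {X Y : StablePair.{u}} (hg : X.g = Y.g) (s : X.I ≃ Y.I) : obj X ≅ obj Y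
  loop (X : StablePair.{u}) (i i' : X.I) (h : i ≠ i') : obj X ⟶ obj (X.loop i i' h)
  edge (X Y : StablePair.{u}) (i : X.I) (i' : Y.I) : obj X ⊗ obj Y ⟶ obj (X.edge Y i i')

variable {C}
variable [SymmetricCategory C]

open StablePair in
/-- The compatibility conditions on gluing data. Sets of labels such as `I ∖ {i₁, j₁} ∖ {i₂, j₂}`
and `I ∖ {i₂, j₂} ∖ {i₁, j₁}`, which agree up to the canonical bijection that sends each label to
itself, are identified through the relabeling isomorphism along this bijection. -/
structure GluingData.IsCompatible (D : GluingData.{u} C) : Prop where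
  /-- `c^l(i, i') = c^l(i', i)` -/
  loop_symm : ∀ (X : StablePair.{u}) (i i' : X.I) (h : i ≠ i'),
    D.loop X i i' h ≫ (D.relabel (by rfl) (X.loopSwap i i' h)).hom = D.loop X i' i h.symm
  /-- `c(i, i') = c(i', i)` up to exchanging the two factors -/
  edge_symm : ∀ (X Y : StablePair.{u}) (i : X.I) (i' : Y.I),
    D.edge X Y i i' ≫ (D.relabel (Nat.add_comm _ _) (X.edgeSwap Y i i')).hom =
      (β_ (D.obj X) (D.obj Y)).hom ≫ D.edge Y X i' i
  /-- `c_{s' ∘ s} = c_{s'} ∘ c_s` -/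
  relabel_trans : ∀ {X Y Z : StablePair.{u}} (hXY : X.g = Y.g) (hYZ : Y.g = Z.g)
    (s : X.I ≃ Y.I) (s' : Y.I ≃ Z.I),
    (D.relabel (hXY.trans hYZ) (s.trans s')).hom =
      (D.relabel hXY s).hom ≫ (D.relabel hYZ s').hom
  /-- relabelings commute with loop gluings -/
  relabel_loop : ∀ {X Y : StablePair.{u}} (hg : X.g = Y.g) (s : X.I ≃ Y.I) (i i' : X.I)
    (h : i ≠ i'),
    D.loop X i i' h ≫ (D.relabel (congrArg (· + 1) hg) (restrictLoop s i i' h)).hom =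
      (D.relabel hg s).hom ≫ D.loop Y (s i) (s i') (s.injective.ne h)
  /-- relabelings commute with edge gluings -/
  relabel_edge : ∀ {X Y X' Y' : StablePair.{u}} (hg : X.g = Y.g) (s : X.I ≃ Y.I)
    (hg' : X'.g = Y'.g) (s' : X'.I ≃ Y'.I) (i : X.I) (i' : X'.I),
    ((D.relabel hg s).hom ⊗ₘ (D.relabel hg' s').hom) ≫ D.edge Y Y' (s i) (s' i') =
      D.edge X X' i i' ≫
        (D.relabel (congrArg₂ (· + ·) hg hg') (restrictEdge s s' i i')).hom
  /-- two loop gluings commute, for distinct `i₁, j₁, i₂, j₂ ∈ I`: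
  `c^l(i₂, j₂) ∘ c^l(i₁, j₁) = c^l(i₁, j₁) ∘ c^l(i₂, j₂)` -/
  loop_loop : ∀ (X : StablePair.{u}) (i₁ j₁ i₂ j₂ : X.I) (h₁ : i₁ ≠ j₁) (h₂ : i₂ ≠ j₂)
    (hii : i₁ ≠ i₂) (hij : i₁ ≠ j₂) (hji : j₁ ≠ i₂) (hjj : j₁ ≠ j₂),
    D.loop X i₁ j₁ h₁ ≫
        D.loop (X.loop i₁ j₁ h₁) (loopMk h₁ i₂ hii.symm hji.symm)
          (loopMk h₁ j₂ hij.symm hjj.symm) (loopMk_ne h₁ h₂ _ _ _ _) ≫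
        (D.relabel (by rfl) (X.loopLoop h₁ h₂ hii hij hji hjj)).hom =
      D.loop X i₂ j₂ h₂ ≫
        D.loop (X.loop i₂ j₂ h₂) (loopMk h₂ i₁ hii hij) (loopMk h₂ j₁ hji hjj)
          (loopMk_ne h₂ h₁ _ _ _ _)
  /-- a loop gluing commutes with an edge gluing, for distinct `i₁, j₁, i₂ ∈ I` and `j₂ ∈ I'`:
  `c^l(i₁, j₁) ∘ c(i₂, j₂) = c(i₂, j₂) ∘ (c^l(i₁, j₁) ⊗ id)` -/
  loop_edge : ∀ (X Y : StablePair.{u}) (i₁ j₁ i₂ : X.I) (j₂ : Y.I) (h₁ : i₁ ≠ j₁)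
    (hi : i₁ ≠ i₂) (hj : j₁ ≠ i₂),
    D.edge X Y i₂ j₂ ≫
        D.loop (X.edge Y i₂ j₂) (edgeInl j₂ i₁ hi) (edgeInl j₂ j₁ hj) (edgeInl_ne j₂ h₁ hi hj) ≫
        (D.relabel (Nat.add_right_comm _ _ _) (X.loopEdge Y j₂ h₁ hi hj)).hom =
      (D.loop X i₁ j₁ h₁ ⊗ₘ 𝟙 (D.obj Y)) ≫
        D.edge (X.loop i₁ j₁ h₁) Y (loopMk h₁ i₂ hi.symm hj.symm) j₂
  /-- gluing along two pairs in `I × I'`, for distinct `i₁, i₂ ∈ I` and distinct `j₁, j₂ ∈ I'`: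
  `c^l(i₂, j₂) ∘ c(i₁, j₁) = c^l(i₁, j₁) ∘ c(i₂, j₂)` -/
  edge_loop : ∀ (X Y : StablePair.{u}) (i₁ i₂ : X.I) (j₁ j₂ : Y.I) (hi : i₁ ≠ i₂) (hj : j₁ ≠ j₂),
    D.edge X Y i₁ j₁ ≫
        D.loop (X.edge Y i₁ j₁) (edgeInl j₁ i₂ hi.symm) (edgeInr i₁ j₂ hj.symm)
          (edgeInl_ne_edgeInr _ _ _ _) ≫
        (D.relabel (by rfl) (X.edgeLoop Y hi hj)).hom =
      D.edge X Y i₂ j₂ ≫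
        D.loop (X.edge Y i₂ j₂) (edgeInl j₂ i₁ hi) (edgeInr i₂ j₁ hj) (edgeInl_ne_edgeInr _ _ _ _)
  /-- two edge gluings commute, for `(i₁, j₁) ∈ I × I'` and `(i₂, j₂) ∈ I' × I''` with `j₁ ≠ i₂`:
  `c(i₁, j₁) ∘ (id ⊗ c(i₂, j₂)) = c(i₂, j₂) ∘ (c(i₁, j₁) ⊗ id)` -/
  edge_edge : ∀ (X Y Z : StablePair.{u}) (i₁ : X.I) (j₁ i₂ : Y.I) (j₂ : Z.I) (h : j₁ ≠ i₂),
    (𝟙 (D.obj X) ⊗ₘ D.edge Y Z i₂ j₂) ≫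
        D.edge X (Y.edge Z i₂ j₂) i₁ (edgeInl j₂ j₁ h) ≫
        (D.relabel (Nat.add_assoc _ _ _).symm (X.edgeEdge Y Z i₁ j₂ h)).hom =
      (α_ (D.obj X) (D.obj Y) (D.obj Z)).inv ≫ (D.edge X Y i₁ j₁ ⊗ₘ 𝟙 (D.obj Z)) ≫
        D.edge (X.edge Y i₁ j₁) Z (edgeInr i₁ i₂ h.symm) j₂

end GluingData

namespace StableModularGraph

/-- The genus and the set of flags of a graph with a single vertex. -/
def stablePair (τ : StableModularGraph.{u}) [Unique τ.obj.V] : StablePair.{u} where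
  g := τ.obj.genus default
  I := τ.obj.F
  finite_I := inferInstance
  stable := by
    refine (τ.property default).trans_eq ?_
    congr 2
    exact Nat.card_congr (Equiv.subtypeUnivEquiv fun _ => Subsingleton.elim _ _)

theorem genus_of_iso {τ σ : StableModularGraph.{u}} [Unique τ.obj.V] [Unique σ.obj.V] (h : τ ≅ σ) :
    τ.stablePair.g = σ.stablePair.g := by
  have h1 := h.hom.hom.genus_eq default
  have h2 : ∀ f, h.hom.hom.pair f = f := fun f =>
    (h.hom.hom.pair_eq_self_iff f).2 ⟨_, (flagEquivOfIso h).left_inv f⟩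
  rw [Finset.sum_filter, Fintype.sum_unique] at h1
  simp [h2, Unique.eq_default] at h1
  exact h1.symm

theorem IsContraction.card_pair_ne {τ σ : StableModularGraph.{u}} [Unique σ.obj.V] {h : τ ⟶ σ}
    {f f' : τ.obj.F} (hc : IsContraction h f f') (v : σ.obj.V) [DecidablePred fun x =>
      h.hom.pair x ≠ x ∧ h.hom.vertexMap (τ.obj.bdry x) = v] :
    (Finset.univ.filter fun x =>
      h.hom.pair x ≠ x ∧ h.hom.vertexMap (τ.obj.bdry x) = v).card = 2 := by
  classical
  rw [← Finset.card_pair hc.ne]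
  congr 1
  ext x
  simp only [Finset.mem_filter, Finset.mem_univ, true_and, Finset.mem_insert,
    Finset.mem_singleton, Subsingleton.elim _ v, and_true, ne_eq, h.hom.pair_eq_self_iff,
    ← hc.mem_range]
  tauto

theorem IsContraction.genus_loop {τ σ : StableModularGraph.{u}} [Unique τ.obj.V]
    [Unique σ.obj.V] {h : τ ⟶ σ} {f f' : τ.obj.F} (hc : IsContraction h f f') :
    (τ.stablePair.loop f f' hc.ne).g = σ.stablePair.g := by
  have h1 := h.hom.genus_eq default
  rw [hc.card_pair_ne, Finset.sum_filter, Fintype.sum_unique,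
    if_pos (Subsingleton.elim _ _)] at h1
  change τ.obj.genus default + 1 = σ.obj.genus default
  push_cast at h1
  omega

theorem IsContraction.genus_edge {τ₁ τ₂ σ : StableModularGraph.{u}} [Unique τ₁.obj.V]
    [Unique τ₂.obj.V] [Unique σ.obj.V] {j : (τ₁ ⊗ τ₂).obj.F → (τ₁ ⊗ τ₂).obj.F}
    {hj : ∀ f, j (j f) = f} {hτ : ∀ f, (τ₁ ⊗ τ₂).obj.inv f ≠ f → j f = (τ₁ ⊗ τ₂).obj.inv f}
    {h : (τ₁ ⊗ τ₂).graft j hj hτ ⟶ σ} {f₁ : τ₁.obj.F} {f₂ : τ₂.obj.F}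
    (hc : IsContraction h (Sum.inl f₁) (Sum.inr f₂)) :
    (τ₁.stablePair.edge τ₂.stablePair f₁ f₂).g = σ.stablePair.g := by
  have h1 := h.hom.genus_eq default
  have h2 : ∀ x, h.hom.vertexMap x = default := fun x => Subsingleton.elim _ _
  rw [hc.card_pair_ne, Finset.sum_filter] at h1
  simp only [h2, if_true] at h1
  replace h1 := h1.trans (congrArg (· + _) (ModularGraph.sum_V_disjointUnion τ₁.obj τ₂.obj
    fun w => (2 * ((τ₁.obj.disjointUnion τ₂.obj).genus w : ℤ) - 2)))
  rw [Fintype.sum_unique, Fintype.sum_unique] at h1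
  change τ₁.obj.genus default + τ₂.obj.genus default = σ.obj.genus default
  change 2 * (σ.obj.genus default : ℤ) - 2 = 2 * (τ₁.obj.genus default : ℤ) - 2 +
    (2 * (τ₂.obj.genus default : ℤ) - 2) + ((2 : ℕ) : ℤ) at h1
  push_cast at h1
  omega

end StableModularGraph

/-- A modular operad in a symmetric monoidal category `C`: a (strong) symmetric monoidal functor
`MGr^st ⥤ C` that sends graftings to isomorphisms. -/
structure ModularOperad (C : Type w) [Category.{v} C] [MonoidalCategory C]
    [SymmetricCategory C] where
  functor : StableModularGraph.{u} ⥤ C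
  braided : functor.Braided
  isIso_map : ∀ {τ σ : StableModularGraph.{u}} (h : τ ⟶ σ), StableModularGraph.IsGrafting h →
    IsIso (functor.map h)

attribute [instance] ModularOperad.braided

/-! ### Tensor products of lists of objects -/

/-! The operad sends `τ` to the tensor product of the objects `C(g(v), F(v))` over its vertices,
where `F(v)` is the set of flags at `v`. A morphism `h : τ ⟶ σ` acts by gluing its contracted edges
one after another; this merges each fibre of `h_V` into one vertex whose labels are the images under
`h^F` of the flags of a vertex of `σ`, and a relabeling along `h^F` concludes. Three things have to
be made precise.

Unordered tensor products. Factors are indexed by lists without duplicates. Between two orderings of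
such a list there is exactly one morphism that permutes the factors (`IsPermHom.unique`, resting on
the Yang–Baxter identity), called `permHom`. This is the form of symmetric monoidal coherence used
throughout, and it also replaces casts along equalities of lists.

Independence of the order. All gluings take place inside the fixed flag set of the source: a `Block`
is a genus, a subset of the flags and the set of vertices merged so far. The canonical bijections in
the hypotheses then fix every underlying flag, and the conditions become plain identities between
`loopMap` and `edgeMap`. Given two disjoint pairs of flags, each pair lies in one block or joins
two. According to how these blocks coincide, the two gluings commute by `loop_loop`, `loop_edge`,
`edge_loop`, `edge_edge` or the interchange law (`GluingsCommute.of_mem`). Adjacent transpositions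
generate all permutations, so the result of gluing a list of pairs does not depend on its order
(`Runs.of_perm`, `Runs.unique`).

The correct result. The number `2g - 2 + n` is additive under gluing. Connectedness of the fibres
determines which vertices end up together, the flags that survive are those in the image of `h^F`,
and the genus condition on `h` is the resulting count (`eq_push_vertexBlock`).

Functoriality follows since the contracted edges of `h ≫ k` are those of `h` together with the
images of those of `k` (`edges_comp`), and since gluing commutes with relabeling (`Runs.push`).
Disjoint union concatenates lists of blocks and of contracted edges, which gives the symmetric
monoidal structure. If nothing is contracted, only a relabeling remains, so graftings become
isomorphisms. Blocks do not involve the involution of the graph, so graftings in the strict sense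
become identities. Finally the functor is replaced by an isomorphic copy whose value on a graph with
one vertex is `C(g, F)` itself (`strictObj`). -/

namespace CategoryTheory.SymmetricCategory

variable {C : Type w} [Category.{v} C] [MonoidalCategory C] [SymmetricCategory C]

/-- The exchange of the first two factors of a right-nested triple tensor product. -/
def exchange (a b r : C) : a ⊗ b ⊗ r ⟶ b ⊗ a ⊗ r :=
  (α_ a b r).inv ≫ (β_ a b).hom ▷ r ≫ (α_ b a r).hom

@[simp]
theorem exchange_exchange (a b r : C) : exchange a b r ≫ exchange b a r = 𝟙 _ := by
  simp [exchange, ← comp_whiskerRight_assoc]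

@[simp]
theorem exchange_exchange_assoc (a b r : C) {Z : C} (k : a ⊗ b ⊗ r ⟶ Z) :
    exchange a b r ≫ exchange b a r ≫ k = k := by
  rw [← Category.assoc, exchange_exchange, Category.id_comp]

instance (a b r : C) : IsIso (exchange a b r) :=
  ⟨exchange _ _ _, exchange_exchange _ _ _, exchange_exchange _ _ _⟩

theorem exchange_naturality_middle (a : C) {b b' : C} (f : b ⟶ b') (r : C) :
    a ◁ f ▷ r ≫ exchange a b' r = exchange a b r ≫ f ▷ (a ⊗ r) := by
  simp only [exchange, Category.assoc]
  rw [associator_inv_naturality_middle_assoc, ← comp_whiskerRight_assoc,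
    BraidedCategory.braiding_naturality_right]
  simp

theorem exchange_naturality_middle_assoc (a : C) {b b' : C} (f : b ⟶ b') (r : C) {Z : C}
    (k : b' ⊗ a ⊗ r ⟶ Z) :
    a ◁ f ▷ r ≫ exchange a b' r ≫ k = exchange a b r ≫ f ▷ (a ⊗ r) ≫ k := by
  rw [← Category.assoc, exchange_naturality_middle, Category.assoc]

theorem exchange_naturality_right (a b : C) {r r' : C} (f : r ⟶ r') :
    a ◁ b ◁ f ≫ exchange a b r' = exchange a b r ≫ b ◁ a ◁ f := by
  simp only [exchange, Category.assoc]
  rw [associator_inv_naturality_right_assoc, whisker_exchange_assoc]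
  simp

theorem exchange_naturality_right_assoc (a b : C) {r r' : C} (f : r ⟶ r') {Z : C}
    (k : b ⊗ a ⊗ r' ⟶ Z) :
    a ◁ b ◁ f ≫ exchange a b r' ≫ k = exchange a b r ≫ b ◁ a ◁ f ≫ k := by
  rw [← Category.assoc, exchange_naturality_right, Category.assoc]

theorem exchange_naturality {a a' b b' r r' : C} (f : a ⟶ a') (g : b ⟶ b') (h : r ⟶ r') :
    (f ⊗ₘ g ⊗ₘ h) ≫ exchange a' b' r' = exchange a b r ≫ (g ⊗ₘ f ⊗ₘ h) := by
  simp only [exchange, Category.assoc]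
  rw [associator_inv_naturality_assoc, ← associator_naturality, tensorHom_comp_whiskerRight_assoc,
    BraidedCategory.braiding_naturality, whiskerRight_comp_tensorHom_assoc]

theorem exchange_whiskerRight (a b r s : C) :
    exchange a b r ▷ s ≫ (α_ b (a ⊗ r) s).hom ≫ b ◁ (α_ a r s).hom =
      (α_ a (b ⊗ r) s).hom ≫ a ◁ (α_ b r s).hom ≫ exchange a b (r ⊗ s) := by
  simp only [exchange]
  monoidal

/-- The hexagon identity: passing `b ⊗ c` means passing `b` and then `c`. It serves to move an idle
block past two blocks that are about to be glued. -/
theorem exchange_tensor (a b c r : C) :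
    a ◁ (α_ b c r).inv ≫ exchange a (b ⊗ c) r = exchange a b (c ⊗ r) ≫ b ◁ exchange a c r ≫
      (α_ b c (a ⊗ r)).inv := by
  simp only [exchange, BraidedCategory.braiding_tensor_right_hom]
  monoidal

/-- The Yang–Baxter identity of the braiding, with the spectator `r` added. This is the only
coherence needed to reorder extractions of factors. -/
theorem exchange_yangBaxter (a b c r : C) :
    a ◁ exchange b c r ≫ exchange a c (b ⊗ r) ≫ c ◁ exchange a b r =
      exchange a b (c ⊗ r) ≫ b ◁ exchange a c r ≫ exchange b c (a ⊗ r) := by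
  calc
    _ = 𝟙 _ ⊗≫ (𝟙 ((a ⊗ b) ⊗ c) ⊗≫ (a ◁ (β_ b c).hom ⊗≫ (β_ a c).hom ▷ b ⊗≫ c ◁ (β_ a b).hom) ⊗≫
          𝟙 ((c ⊗ b) ⊗ a)) ▷ r ⊗≫ 𝟙 _ := by simp only [exchange]; monoidal
    _ = _ := by rw [← BraidedCategory.yang_baxter']; simp only [exchange]; monoidal

/-! ### Tensor products of lists -/

variable {B : Type*} (X : B → C)

/-- The right-nested tensor product of a list of objects. -/
abbrev tensorList : List B → C
  | [] => 𝟙_ C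
  | b :: l => X b ⊗ tensorList l

/-- `IsExtract X a l m e` says that `m` is `l` with one occurrence of `a` left out, and that `e`
moves the corresponding factor to the front. -/
inductive IsExtract (a : B) :
    ∀ l m : List B, (tensorList X l ⟶ X a ⊗ tensorList X m) → Prop
  | head (l : List B) : IsExtract a (a :: l) l (𝟙 _)
  | tail (b : B) {l m : List B} {e : tensorList X l ⟶ X a ⊗ tensorList X m} :
      IsExtract a l m e →
      IsExtract a (b :: l) (b :: m) (X b ◁ e ≫ exchange (X b) (X a) (tensorList X m))

/-- `IsPermHom X l l' φ` says that `φ` permutes the factors along a permutation of lists. -/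
inductive IsPermHom : ∀ l l' : List B, (tensorList X l ⟶ tensorList X l') → Prop
  | nil : IsPermHom [] [] (𝟙 _)
  | cons (a : B) {l l' m : List B} {e : tensorList X l' ⟶ X a ⊗ tensorList X m}
      {φ : tensorList X l ⟶ tensorList X m} {ψ : tensorList X (a :: l) ⟶ tensorList X l'} :
      IsExtract X a l' m e → IsPermHom l m φ → ψ ≫ e = X a ◁ φ → IsPermHom (a :: l) l' ψ

variable {X}

/-! ### Extraction of one factor -/

namespace IsExtract

theorem isIso {a : B} {l m e} (h : IsExtract X a l m e) : IsIso e := by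
  induction h with
  | head l => infer_instance
  | tail b _ ih => infer_instance

theorem perm {a : B} {l m e} (h : IsExtract X a l m e) : l.Perm (a :: m) := by
  induction h with
  | head l => rfl
  | tail b _ ih => exact (ih.cons b).trans (List.Perm.swap _ _ _)

/-- If `a` is the head of a list without duplicates, it does not occur in the tail, so there is no
choice of which occurrence to leave out. -/
theorem eq_list {a : B} {l m e m' e'} (h : IsExtract X a l m e) (h' : IsExtract X a l m' e')
    (hl : l.Nodup) : m = m' := by
  induction h generalizing m' with
  | head l =>
    cases h' with
    | head => rfl
    | tail _ h' => exact absurd (h'.perm.mem_iff.2 List.mem_cons_self) (List.nodup_cons.1 hl).1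
  | tail b h ih =>
    cases h' with
    | head => exact absurd (h.perm.mem_iff.2 List.mem_cons_self) (List.nodup_cons.1 hl).1
    | tail _ h' => rw [ih h' hl.of_cons]

theorem eq_hom {a : B} {l m e e'} (h : IsExtract X a l m e) (h' : IsExtract X a l m e')
    (hl : l.Nodup) : e = e' := by
  induction h with
  | head l =>
    cases h' with
    | head => rfl
    | tail _ h' => exact absurd (h'.perm.mem_iff.2 List.mem_cons_self) (List.nodup_cons.1 hl).1
  | tail b h ih =>
    cases h' with
    | head => exact absurd (h.perm.mem_iff.2 List.mem_cons_self) (List.nodup_cons.1 hl).1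
    | tail _ h' => rw [ih h' hl.of_cons]

/-- Two successive extractions can be done in the other order. -/
theorem comm {a b : B} {l n n' e₁ e₂} (h₁ : IsExtract X b l n e₁) (h₂ : IsExtract X a n n' e₂) :
    ∃ k e₃ e₄, IsExtract X a l k e₃ ∧ IsExtract X b k n' e₄ ∧
      e₁ ≫ X b ◁ e₂ ≫ exchange (X b) (X a) _ = e₃ ≫ X a ◁ e₄ := by
  induction h₁ generalizing n' with
  | head l =>
    exact ⟨b :: n', _, _, .tail b h₂, .head n', by simp⟩
  | @tail c l₀ n₀ e₀ h₁ ih =>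
    cases h₂ with
    | head =>
      -- Here `a` is the first factor of the original list: `b` is moved past it by one exchange,
      -- which the exchange on the left side undoes.
      refine ⟨l₀, _, _, .head _, h₁, ?_⟩
      simp only [whiskerLeft_id, Category.id_comp, Category.assoc]
      exact (whisker_eq _ (exchange_exchange _ _ _)).trans (Category.comp_id _)
    | @tail _ _ m e' h₂ =>
      obtain ⟨k, e₃, e₄, h₃, h₄, he⟩ := ih h₂
      refine ⟨c :: k, _, _, h₃.tail c, h₄.tail c, ?_⟩
      have he' := congrArg (fun f => X c ◁ f) he
      simp only [MonoidalCategory.whiskerLeft_comp] at he'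
      simp only [MonoidalCategory.whiskerLeft_comp, Category.assoc]
      simp only [← exchange_naturality_right_assoc, tensorList]
      -- Both `a` and `b` lie behind `c`; the three exchanges of `c`, `b`, `a` are reordered and the
      -- induction hypothesis applies under `c`.
      rw [← exchange_yangBaxter, reassoc_of% he']

end IsExtract

/-! ### Permutations of factors -/

namespace IsPermHom

theorem perm {l l' : List B} {φ} (h : IsPermHom X l l' φ) : l.Perm l' := by
  induction h with
  | nil => rfl
  | cons a h _ _ ih => exact (ih.cons a).trans h.perm.symm

theorem of_cons {l l' : List B} {φ} (h : IsPermHom X l l' φ) (a : B) :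
    IsPermHom X (a :: l) (a :: l') (X a ◁ φ) :=
  .cons a (.head l') h (Category.comp_id _)

theorem refl (l : List B) : IsPermHom X l l (𝟙 _) := by
  induction l with
  | nil => exact .nil
  | cons a l ih => simpa using! ih.of_cons a

theorem swap (a b : B) (l : List B) :
    IsPermHom X (a :: b :: l) (b :: a :: l) (exchange (X a) (X b) (tensorList X l)) :=
  .cons a (.tail b (.head l)) (refl (b :: l)) (by
    rw [MonoidalCategory.whiskerLeft_id, Category.id_comp, exchange_exchange,
      MonoidalCategory.whiskerLeft_id])

/-- Taking out `a` before or after a permutation differs by a permutation of the other factors. When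
`a` is not the first factor `b` treated by `ψ`, the extractions of `b` and `a` from `l'` have to be
interchanged, which is `IsExtract.comm`. Closure under composition follows. -/
theorem extract {a : B} {l l' m ψ e} (h : IsPermHom X l l' ψ) (he : IsExtract X a l m e) :
    ∃ m' e' ψ', IsExtract X a l' m' e' ∧ IsPermHom X m m' ψ' ∧ ψ ≫ e' = e ≫ X a ◁ ψ' := by
  induction h generalizing m with
  | nil => cases he
  | @cons b l₀ l' n e₁ ψ₁ ψ h₁ hψ₁ hψ ih =>
    cases he with
    | head => exact ⟨n, e₁, ψ₁, h₁, hψ₁, by rw [hψ, Category.id_comp]⟩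
    | @tail _ _ m₀ e₀ he =>
      obtain ⟨n', e₂, ψ₂, h₂, hψ₂, hc⟩ := ih he
      obtain ⟨k, e₃, e₄, h₃, h₄, hk⟩ := h₁.comm h₂
      have := h₄.isIso
      refine ⟨k, e₃, X b ◁ ψ₂ ≫ inv e₄, h₃, .cons b h₄ hψ₂ (by simp), ?_⟩
      rw [← cancel_mono (X a ◁ e₄)]
      have hc' := congrArg (fun f => X b ◁ f) hc
      simp only [MonoidalCategory.whiskerLeft_comp] at hc'
      simp only [Category.assoc, ← MonoidalCategory.whiskerLeft_comp, IsIso.inv_hom_id,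
        Category.comp_id]
      rw [← hk, reassoc_of% hψ, reassoc_of% hc', exchange_naturality_right]

theorem trans {l l' l'' : List B} {φ ψ} (h : IsPermHom X l l' φ) (h' : IsPermHom X l' l'' ψ) :
    IsPermHom X l l'' (φ ≫ ψ) := by
  induction h generalizing l'' with
  | nil => simpa using h'
  | cons a he hφ hc ih =>
    obtain ⟨m', e', ψ', he', hψ', hc'⟩ := h'.extract he
    refine .cons a he' (ih hψ') ?_
    rw [Category.assoc, hc', reassoc_of% hc, MonoidalCategory.whiskerLeft_comp]

theorem exists_of_perm {l l' : List B} (h : l.Perm l') : ∃ φ, IsPermHom X l l' φ := by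
  induction h with
  | nil => exact ⟨_, .nil⟩
  | cons a _ ih => exact ih.imp' _ fun _ h => h.of_cons a
  | swap a b l => exact ⟨_, swap b a l⟩
  | trans _ _ ih ih' =>
    obtain ⟨φ, h⟩ := ih
    obtain ⟨ψ, h'⟩ := ih'
    exact ⟨_, h.trans h'⟩

/-- Both morphisms place the same first factor, and its extraction from `l'` is unique and
invertible, so it can be cancelled. Without `Nodup` this fails: the exchange of two equal factors
need not be the identity. -/
theorem unique {l l' : List B} {φ φ'} (h : IsPermHom X l l' φ) (h' : IsPermHom X l l' φ')
    (hl : l'.Nodup) : φ = φ' := by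
  induction h with
  | nil => cases h'; rfl
  | cons a he hφ hc ih =>
    cases h' with
    | cons _ he' hφ' hc' =>
      rename_i e _ _ _ _ _
      obtain rfl := he.eq_list he' hl
      obtain rfl := he.eq_hom he' hl
      have := he.isIso
      rw [← cancel_mono e, hc, hc', ih hφ' (List.nodup_cons.1 (he.perm.nodup_iff.1 hl)).2]

end IsPermHom

variable (X) in
/-- The permutation of factors along a permutation of lists (which is unique if the list has no
duplicates). -/
noncomputable def permHom {l l' : List B} (p : l.Perm l') : tensorList X l ⟶ tensorList X l' :=
  (IsPermHom.exists_of_perm p).choose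

theorem permHom_spec {l l' : List B} (p : l.Perm l') : IsPermHom X l l' (permHom X p) :=
  (IsPermHom.exists_of_perm p).choose_spec

theorem IsPermHom.eq_permHom {l l' : List B} {φ} (h : IsPermHom X l l' φ) (hl : l'.Nodup) :
    φ = permHom X h.perm :=
  h.unique (permHom_spec _) hl

theorem permHom_refl {l : List B} (hl : l.Nodup) (p : l.Perm l) : permHom X p = 𝟙 _ :=
  ((IsPermHom.refl l).eq_permHom hl).symm

theorem permHom_trans {l l' l'' : List B} (p : l.Perm l') (q : l'.Perm l'') (hl : l''.Nodup) :
    permHom X p ≫ permHom X q = permHom X (p.trans q) :=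
  ((permHom_spec p).trans (permHom_spec q)).eq_permHom hl

theorem permHom_trans_assoc {l l' l'' : List B} (p : l.Perm l') (q : l'.Perm l'')
    (hl : l''.Nodup) {Z : C} (k : tensorList X l'' ⟶ Z) :
    permHom X p ≫ permHom X q ≫ k = permHom X (p.trans q) ≫ k := by
  rw [← Category.assoc, permHom_trans p q hl]

theorem permHom_cons (a : B) {l l' : List B} (p : l.Perm l') (q : (a :: l).Perm (a :: l'))
    (hl : (a :: l').Nodup) : permHom X q = X a ◁ permHom X p :=
  (((permHom_spec p).of_cons a).eq_permHom hl).symm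

/-- For heads that are equal only propositionally, such as a block pushed along a composite or in
two stages. -/
theorem permHom_cons_of_eq {a a' : B} (h : a = a') {l l' : List B} (p : l.Perm l')
    (q : (a :: l).Perm (a' :: l')) (hl : (a' :: l').Nodup) :
    permHom X q = eqToHom (congrArg X h) ⊗ₘ permHom X p := by
  subst h
  rw [permHom_cons (X := X) a p q hl, eqToHom_refl, id_tensorHom]

theorem permHom_swap (a b : B) {l : List B} (q : (a :: b :: l).Perm (b :: a :: l))
    (hl : (b :: a :: l).Nodup) : permHom X q = exchange (X a) (X b) (tensorList X l) :=
  ((IsPermHom.swap a b l).eq_permHom hl).symm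

/-- As an isomorphism. -/
@[simps]
noncomputable def permIso {l l' : List B} (p : l.Perm l') (hl : l.Nodup) :
    tensorList X l ≅ tensorList X l' where
  hom := permHom X p
  inv := permHom X p.symm
  hom_inv_id := by rw [permHom_trans _ _ hl, permHom_refl hl]
  inv_hom_id := by
    have hl' := p.nodup_iff.1 hl
    rw [permHom_trans _ _ hl', permHom_refl hl']

/-! ### Concatenation -/

variable (X) in
/-- The tensor product of a concatenation. -/
def appendIso : ∀ l m : List B, tensorList X l ⊗ tensorList X m ≅ tensorList X (l ++ m)
  | [], m => λ_ (tensorList X m)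
  | b :: l, m => α_ (X b) (tensorList X l) (tensorList X m) ≪≫ whiskerLeftIso (X b) (appendIso l m)

omit [SymmetricCategory C] in
theorem appendIso_cons_hom (b : B) (l m : List B) : (appendIso X (b :: l) m).hom =
    (α_ (X b) (tensorList X l) (tensorList X m)).hom ≫ X b ◁ (appendIso X l m).hom := rfl

theorem permHom_append_left (l : List B) {m m' : List B} (p : m.Perm m')
    (q : (l ++ m).Perm (l ++ m')) (hl : (l ++ m').Nodup) :
    (appendIso X l m).hom ≫ permHom X q =
      tensorList X l ◁ permHom X p ≫ (appendIso X l m').hom := by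
  induction l with
  | nil => exact (leftUnitor_naturality _).symm
  | cons b l ih =>
    have hl' : (b :: (l ++ m')).Nodup := hl
    have q' : (l ++ m).Perm (l ++ m') := p.append_left l
    rw [appendIso_cons_hom, appendIso_cons_hom, Category.assoc]
    have := ih q' hl'.of_cons
    rw [permHom_cons (X := X) b q' q hl', ← MonoidalCategory.whiskerLeft_comp, this]
    simp [tensorList]

theorem permHom_append_right {l l' : List B} (m : List B) (p : l.Perm l')
    (q : (l ++ m).Perm (l' ++ m)) (hl : (l' ++ m).Nodup) :
    (appendIso X l m).hom ≫ permHom X q =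
      permHom X p ▷ tensorList X m ≫ (appendIso X l' m).hom := by
  induction p with
  | nil => rw [permHom_refl hl, permHom_refl .nil]; simp
  | @cons b l l' p ih =>
    have hl' : (b :: (l' ++ m)).Nodup := hl
    have q' : (l ++ m).Perm (l' ++ m) := p.append_right m
    rw [appendIso_cons_hom, appendIso_cons_hom, Category.assoc]
    have := ih q' hl'.of_cons
    rw [permHom_cons (X := X) b q' q hl', permHom_cons (X := X) b p _ (hl.of_append_left),
      ← MonoidalCategory.whiskerLeft_comp, this]
    simp
  | swap b a l =>
    have hl' : (b :: a :: (l ++ m)).Nodup := hl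
    have h2 : permHom X q = exchange (X a) (X b) (tensorList X (l ++ m)) :=
      permHom_swap (X := X) a b q hl'
    rw [h2, permHom_swap _ _ _ hl.of_append_left]
    simp only [appendIso_cons_hom, MonoidalCategory.whiskerLeft_comp, Category.assoc]
    rw [exchange_naturality_right, reassoc_of%
      (exchange_whiskerRight (X a) (X b) (tensorList X l) (tensorList X m))]
  | trans p p' ih ih' =>
    have hl' := ((p'.append_right m).nodup_iff).2 hl
    rw [← permHom_trans p p' hl.of_append_left, comp_whiskerRight, Category.assoc,
      ← ih' (p'.append_right m) hl, ← reassoc_of% (ih (p.append_right m) hl'),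
      permHom_trans _ _ hl]

omit [SymmetricCategory C] in
theorem appendIso_nil_hom (m : List B) :
    (appendIso X [] m).hom = (λ_ (tensorList X m)).hom := rfl

/-- The lists `l ++ []` and `l` are not definitionally equal; the permutation takes the place of a
cast. -/
theorem appendIso_nil_right (l : List B) (p : (l ++ []).Perm l) (hl : l.Nodup) :
    (appendIso X l []).hom ≫ permHom X p = (ρ_ (tensorList X l)).hom := by
  induction l with
  | nil =>
    rw [permHom_refl hl, appendIso_nil_hom, unitors_equal]
    exact Category.comp_id _
  | cons b l ih =>
    have q : (l ++ []).Perm l := by rw [List.append_nil]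
    have h2 := congrArg (fun f => X b ◁ f) (ih q hl.of_cons)
    simp only [MonoidalCategory.whiskerLeft_comp] at h2
    rw [permHom_cons (X := X) b q p hl, appendIso_cons_hom, Category.assoc, h2]
    simp [tensorList]

/-- Moving a factor past the first of two concatenated lists. -/
theorem exchange_appendIso (b : B) (l m : List B) (p : (b :: (l ++ m)).Perm (l ++ b :: m))
    (hl : (l ++ b :: m).Nodup) :
    X b ◁ (appendIso X l m).hom ≫ permHom X p =
      exchange (X b) (tensorList X l) (tensorList X m) ≫ (appendIso X l (b :: m)).hom := by
  induction l with
  | nil =>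
    rw [permHom_refl hl]
    simp only [appendIso_nil_hom, exchange]
    simp
  | cons a l ih =>
    have hl' : (a :: (l ++ b :: m)).Nodup := hl
    have q : (b :: (l ++ m)).Perm (l ++ b :: m) := List.perm_middle.symm
    have q2 := (List.Perm.swap a b (l ++ m))
    have h1 : permHom X p = permHom X q2 ≫ X a ◁ permHom X q := by
      rw [← permHom_cons (X := X) a q (q.cons a) hl']
      exact (permHom_trans (X := X) q2 (q.cons a) hl').symm
    have hq2 := ((q.cons a).nodup_iff).2 hl'
    rw [h1, permHom_swap _ _ _ hq2]
    have h2 := congrArg (fun f => X a ◁ f) (ih q hl'.of_cons)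
    simp only [MonoidalCategory.whiskerLeft_comp] at h2
    simp only [appendIso_cons_hom, MonoidalCategory.whiskerLeft_comp, Category.assoc,
      tensorList]
    rw [exchange_naturality_right_assoc, h2]
    simp only [exchange, BraidedCategory.braiding_tensor_right_hom]
    monoidal

/-- By the hexagon identity, the braiding of `X b ⊗ tensorList X l` with `tensorList X m` first
moves `l` and then `b` past `m`; the second move is `exchange_appendIso`. -/
theorem permHom_append_comm (l m : List B) (p : (l ++ m).Perm (m ++ l)) (hl : (m ++ l).Nodup) :
    (appendIso X l m).hom ≫ permHom X p =
      (β_ (tensorList X l) (tensorList X m)).hom ≫ (appendIso X m l).hom := by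
  induction l with
  | nil =>
    have q : (m ++ []).Perm m := by rw [List.append_nil]
    have hl' : m.Nodup := hl.of_append_left
    have h2 : permHom X p ≫ permHom X q = 𝟙 _ :=
      (permHom_trans _ _ hl').trans (permHom_refl hl' _)
    have : IsIso (permHom X q) := (permIso (X := X) q hl).isIso_hom
    -- After the identification of `m ++ []` with `m`, the permutation `p` becomes the identity and
    -- both sides are composites of unitors.
    rw [← cancel_mono (permHom X q), Category.assoc, Category.assoc, h2,
      appendIso_nil_right m q hl']
    simp [appendIso_nil_hom, braiding_tensorUnit_left]
  | cons b l ih =>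
    have hm : (b :: (m ++ l)).Nodup := List.perm_middle.nodup_iff.1 hl
    have q : (b :: (m ++ l)).Perm (m ++ b :: l) := List.perm_middle.symm
    have q' : (l ++ m).Perm (m ++ l) := List.perm_append_comm
    have h1 : permHom X p = X b ◁ permHom X q' ≫ permHom X q := by
      rw [← permHom_cons (X := X) b q' (q'.cons b) hm]
      exact (permHom_trans (X := X) (q'.cons b) q hl).symm
    have h2 := congrArg (fun f => X b ◁ f) (ih q' hm.of_cons)
    simp only [MonoidalCategory.whiskerLeft_comp] at h2
    rw [h1, appendIso_cons_hom, Category.assoc, reassoc_of% h2, exchange_appendIso _ _ _ _ hl]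
    simp only [exchange, BraidedCategory.braiding_tensor_left_hom, tensorList]
    simp

/-- Concatenation of lists is associative up to the canonical permutation. -/
theorem appendIso_assoc (l m n : List B) (p : ((l ++ m) ++ n).Perm (l ++ (m ++ n)))
    (hl : (l ++ (m ++ n)).Nodup) :
    (appendIso X l m).hom ▷ tensorList X n ≫ (appendIso X (l ++ m) n).hom ≫ permHom X p =
      (α_ _ _ _).hom ≫ tensorList X l ◁ (appendIso X m n).hom ≫ (appendIso X l (m ++ n)).hom := by
  induction l with
  | nil =>
    have h1 : permHom X p = 𝟙 _ := permHom_refl hl _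
    rw [h1]
    simp only [appendIso_nil_hom]
    simp
  | cons b l ih =>
    have q : ((l ++ m) ++ n).Perm (l ++ (m ++ n)) := by rw [List.append_assoc]
    have hl' : (b :: (l ++ (m ++ n))).Nodup := hl
    have h2 := congrArg (fun f => X b ◁ f) (ih q hl'.of_cons)
    simp only [MonoidalCategory.whiskerLeft_comp] at h2
    have h3 : (appendIso X (b :: l ++ m) n).hom = _ := appendIso_cons_hom b (l ++ m) n
    rw [h3, permHom_cons (X := X) b q p hl']
    simp only [appendIso_cons_hom, Category.assoc, comp_whiskerRight]
    rw [associator_naturality_middle_assoc, h2]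
    simp [tensorList]

end CategoryTheory.SymmetricCategory

/-! ### Vertices of a graph with their flags -/

/-! ### Blocks -/

/-- A vertex obtained by merging vertices, in a graph with flags `F` and vertices `V`: its genus,
the set of its flags, and the set of the merged vertices. -/
@[ext]
structure Block (F V : Type u) where
  g : ℕ
  S : Set F
  A : Set V
  finite_S : Finite S
  stable : (2 * (g : ℤ) - 2) + Nat.card S > 0

namespace Block

variable {F V F' V' F'' V'' : Type u}

/-- The genus and the labels of a block. -/
abbrev pair (B : Block F V) : StablePair.{u} := ⟨B.g, B.S, B.finite_S, B.stable⟩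

/-- `B'` is obtained from `B` by gluing the flags `a` and `a'`. -/
structure IsLoop (a a' : F) (B B' : Block F V) : Prop where
  ne : a ≠ a'
  left : a ∈ B.S
  right : a' ∈ B.S
  g_eq : B.g + 1 = B'.g
  mem_S : ∀ x, x ∈ B'.S ↔ x ∈ B.S ∧ x ≠ a ∧ x ≠ a'
  A_eq : B'.A = B.A

/-- `B'` is obtained from `B₁` and `B₂` by gluing the flags `a` and `a'`. -/
structure IsEdge (a a' : F) (B₁ B₂ B' : Block F V) : Prop where
  disj : Disjoint B₁.S B₂.S
  left : a ∈ B₁.S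
  right : a' ∈ B₂.S
  g_eq : B₁.g + B₂.g = B'.g
  mem_S : ∀ x, x ∈ B'.S ↔ (x ∈ B₁.S ∨ x ∈ B₂.S) ∧ x ≠ a ∧ x ≠ a'
  A_eq : B'.A = B₁.A ∪ B₂.A

namespace IsLoop

variable {a a' : F} {B B' : Block F V}

theorem symm (h : IsLoop a a' B B') : IsLoop a' a B B' :=
  ⟨h.ne.symm, h.right, h.left, h.g_eq, fun x => by rw [h.mem_S, and_comm (a := x ≠ a)], h.A_eq⟩

/-- The remaining labels. -/
noncomputable def equiv (h : IsLoop a a' B B') :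
    (B.pair.loop ⟨a, h.left⟩ ⟨a', h.right⟩ (fun e => h.ne (congrArg Subtype.val e))).I ≃
      B'.pair.I :=
  Equiv.ofBijective (fun x => ⟨x.1.1, (h.mem_S _).2 ⟨x.1.2,
    fun e => x.2.1 (Subtype.ext e), fun e => x.2.2 (Subtype.ext e)⟩⟩)
    ⟨fun x x' e => by
      replace e : x.1.1 = x'.1.1 := Subtype.mk.inj e
      exact Subtype.ext (Subtype.ext e), fun y =>
      ⟨⟨⟨y.1, ((h.mem_S _).1 y.2).1⟩, fun e => ((h.mem_S _).1 y.2).2.1 (congrArg Subtype.val e),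
        fun e => ((h.mem_S _).1 y.2).2.2 (congrArg Subtype.val e)⟩, rfl⟩⟩

end IsLoop

namespace IsEdge

variable {a a' : F} {B₁ B₂ B' : Block F V}

theorem symm (h : IsEdge a a' B₁ B₂ B') : IsEdge a' a B₂ B₁ B' :=
  ⟨h.disj.symm, h.right, h.left, (Nat.add_comm _ _).trans h.g_eq, fun x => by
    rw [h.mem_S, and_comm (a := x ≠ a), or_comm], by rw [h.A_eq, Set.union_comm]⟩

theorem ne (h : IsEdge a a' B₁ B₂ B') : a ≠ a' := fun e =>
  Set.disjoint_left.1 h.disj h.left (e ▸ h.right)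

/-- The remaining labels. -/
noncomputable def equiv (h : IsEdge a a' B₁ B₂ B') :
    (B₁.pair.edge B₂.pair ⟨a, h.left⟩ ⟨a', h.right⟩).I ≃ B'.pair.I :=
  Equiv.ofBijective (fun x => ⟨Sum.elim Subtype.val Subtype.val x.1, (h.mem_S _).2 (by
      obtain ⟨⟨x, hx⟩ | ⟨x, hx⟩, h1, h2⟩ := x
      · exact ⟨Or.inl hx, fun e => h1 (congrArg Sum.inl (Subtype.ext e)),
          fun e : x = a' => Set.disjoint_left.1 h.disj hx (e ▸ h.right)⟩
      · exact ⟨Or.inr hx, fun e : x = a => Set.disjoint_left.1 h.disj (e ▸ h.left) hx,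
          fun e => h2 (congrArg Sum.inr (Subtype.ext e))⟩)⟩)
    ⟨by
      rintro ⟨⟨x, hx⟩ | ⟨x, hx⟩, h1⟩ ⟨⟨y, hy⟩ | ⟨y, hy⟩, h2⟩ e
      · exact Subtype.ext (congrArg Sum.inl (Subtype.ext (Subtype.mk.inj e)))
      · obtain rfl : x = y := Subtype.mk.inj e
        exact absurd hy (Set.disjoint_left.1 h.disj hx)
      · obtain rfl : x = y := Subtype.mk.inj e
        exact absurd hx (Set.disjoint_left.1 h.disj hy)
      · exact Subtype.ext (congrArg Sum.inr (Subtype.ext (Subtype.mk.inj e))), by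
      rintro ⟨y, hy⟩
      obtain ⟨hy | hy, h1, h2⟩ := (h.mem_S _).1 hy
      · exact ⟨⟨Sum.inl ⟨y, hy⟩, fun e => h1 (congrArg Subtype.val (Sum.inl_injective e)),
          Sum.inl_ne_inr⟩, rfl⟩
      · exact ⟨⟨Sum.inr ⟨y, hy⟩, Sum.inr_ne_inl,
          fun e => h2 (congrArg Subtype.val (Sum.inr_injective e))⟩, rfl⟩⟩

end IsEdge

/-- `B'` is the image of `B` under an injective map of flags (the merged vertices are not
compared). -/
structure IsImage (f : F → F') (B : Block F V) (B' : Block F' V') : Prop where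
  injective : Function.Injective f
  g_eq : B.g = B'.g
  S_eq : B'.S = f '' B.S

/-- The bijection of labels. -/
noncomputable def IsImage.equiv {f : F → F'} {B : Block F V} {B' : Block F' V'}
    (h : IsImage f B B') : B.pair.I ≃ B'.pair.I :=
  Equiv.ofBijective (fun x => ⟨f x.1, by rw [h.S_eq]; exact Set.mem_image_of_mem f x.2⟩)
    ⟨fun _ _ e => Subtype.ext (h.injective (congrArg Subtype.val e)), fun y => by
      obtain ⟨x, hx, hxy⟩ : y.1 ∈ f '' B.S := by rw [← h.S_eq]; exact y.2
      exact ⟨⟨x, hx⟩, Subtype.ext hxy⟩⟩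

end Block

namespace GluingData

variable {C : Type w} [Category.{v} C] [MonoidalCategory C] [SymmetricCategory C]
variable (D : GluingData.{u} C)

omit [SymmetricCategory C] in
theorem relabel_congr {X Y : StablePair.{u}} (hg hg' : X.g = Y.g) {s s' : X.I ≃ Y.I}
    (h : ∀ x, s x = s' x) : (D.relabel hg s).hom = (D.relabel hg' s').hom := by
  rw [Equiv.ext h]

namespace IsCompatible

variable {D} (hD : D.IsCompatible)
include hD

/-- By functoriality the relabeling along the identity is idempotent, and an idempotent isomorphism
is the identity. So this need not be among the conditions. -/
theorem relabel_refl (X : StablePair.{u}) (hg : X.g = X.g) (s : X.I ≃ X.I) (hs : ∀ x, s x = x) :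
    (D.relabel hg s).hom = 𝟙 _ := by
  obtain rfl : s = Equiv.refl _ := Equiv.ext hs
  rw [← cancel_mono (D.relabel hg (Equiv.refl X.I)).hom, ← hD.relabel_trans]
  simp

end IsCompatible

/-! The compatibility conditions, with relabelings absorbed. -/

namespace IsCompatible

variable {D} (hD : D.IsCompatible)
include hD

open StablePair

theorem relabel_eq_comp {X Y Z : StablePair.{u}} {h : X.g = Z.g} {s : X.I ≃ Z.I}
    {k₁ : X.g = Y.g} {t₁ : X.I ≃ Y.I} {k₂ : Y.g = Z.g} {t₂ : Y.I ≃ Z.I}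
    (hs : ∀ x, s x = t₂ (t₁ x)) :
    (D.relabel h s).hom = (D.relabel k₁ t₁).hom ≫ (D.relabel k₂ t₂).hom := by
  rw [← hD.relabel_trans]
  exact D.relabel_congr _ _ hs

theorem relabel_comp_eq {X Y Y' Z : StablePair.{u}} {h₁ : X.g = Y.g} {s₁ : X.I ≃ Y.I}
    {h₂ : Y.g = Z.g} {s₂ : Y.I ≃ Z.I} {k₁ : X.g = Y'.g} {t₁ : X.I ≃ Y'.I}
    {k₂ : Y'.g = Z.g} {t₂ : Y'.I ≃ Z.I} (h : ∀ x, s₂ (s₁ x) = t₂ (t₁ x)) :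
    (D.relabel h₁ s₁).hom ≫ (D.relabel h₂ s₂).hom =
      (D.relabel k₁ t₁).hom ≫ (D.relabel k₂ t₂).hom := by
  rw [← hD.relabel_trans, ← hD.relabel_trans]
  exact D.relabel_congr _ _ h

theorem relabel_comp_eq' {X Y Y' Y'' Z : StablePair.{u}} {h₁ : X.g = Y.g} {s₁ : X.I ≃ Y.I}
    {h₂ : Y.g = Z.g} {s₂ : Y.I ≃ Z.I} {k₁ : X.g = Y'.g} {t₁ : X.I ≃ Y'.I}
    {k₂ : Y'.g = Y''.g} {t₂ : Y'.I ≃ Y''.I} {k₃ : Y''.g = Z.g} {t₃ : Y''.I ≃ Z.I}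
    (h : ∀ x, s₂ (s₁ x) = t₃ (t₂ (t₁ x))) :
    (D.relabel h₁ s₁).hom ≫ (D.relabel h₂ s₂).hom =
      (D.relabel k₁ t₁).hom ≫ (D.relabel k₂ t₂).hom ≫ (D.relabel k₃ t₃).hom := by
  rw [← hD.relabel_trans, ← hD.relabel_trans, ← hD.relabel_trans]
  exact D.relabel_congr _ _ h

theorem relabel_edge_left {X X' : StablePair.{u}} (Y : StablePair.{u}) (hg : X.g = X'.g)
    (s : X.I ≃ X'.I) (i : X.I) (j : Y.I) :
    (D.relabel hg s).hom ▷ D.obj Y ≫ D.edge X' Y (s i) j = D.edge X Y i j ≫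
      (D.relabel (X := X.edge Y i j) (Y := X'.edge Y (s i) j) (congrArg (· + Y.g) hg)
        (restrictEdge s (Equiv.refl _) i j)).hom := by
  have e := hD.relabel_edge hg s rfl (Equiv.refl Y.I) i j
  rw [hD.relabel_refl _ _ _ (fun _ => rfl), tensorHom_id] at e
  exact e

theorem relabel_edge_right {Y Y' : StablePair.{u}} (X : StablePair.{u}) (hg : Y.g = Y'.g)
    (s : Y.I ≃ Y'.I) (i : X.I) (j : Y.I) :
    D.obj X ◁ (D.relabel hg s).hom ≫ D.edge X Y' i (s j) = D.edge X Y i j ≫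
      (D.relabel (X := X.edge Y i j) (Y := X.edge Y' i (s j)) (congrArg (X.g + ·) hg)
        (restrictEdge (Equiv.refl _) s i j)).hom := by
  have e := hD.relabel_edge rfl (Equiv.refl X.I) hg s i j
  rw [hD.relabel_refl _ _ _ (fun _ => rfl), id_tensorHom] at e
  exact e

/-- Naturality of the gluing maps pushes the intermediate relabelings `s₁` and `s₂` to the end,
where by functoriality only the composite bijections have to agree; this is `hst`. The next three
lemmas treat the other commutation conditions in the same way. -/
theorem loop_relabel_loop_relabel {X Y₁ Y₂ Z : StablePair.{u}} {i₁ j₁ i₂ j₂ : X.I} (h₁ : i₁ ≠ j₁)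
    (h₂ : i₂ ≠ j₂) (hii : i₁ ≠ i₂) (hij : i₁ ≠ j₂) (hji : j₁ ≠ i₂) (hjj : j₁ ≠ j₂)
    (hg₁ : (X.loop i₁ j₁ h₁).g = Y₁.g) (s₁ : (X.loop i₁ j₁ h₁).I ≃ Y₁.I)
    (hg₂ : (X.loop i₂ j₂ h₂).g = Y₂.g) (s₂ : (X.loop i₂ j₂ h₂).I ≃ Y₂.I)
    (hk₁ : s₁ (loopMk h₁ i₂ hii.symm hji.symm) ≠ s₁ (loopMk h₁ j₂ hij.symm hjj.symm))
    (hk₂ : s₂ (loopMk h₂ i₁ hii hij) ≠ s₂ (loopMk h₂ j₁ hji hjj))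
    (hg₁' : (Y₁.loop _ _ hk₁).g = Z.g) (t₁ : (Y₁.loop _ _ hk₁).I ≃ Z.I)
    (hg₂' : (Y₂.loop _ _ hk₂).g = Z.g) (t₂ : (Y₂.loop _ _ hk₂).I ≃ Z.I)
    (hst : ∀ x, t₁ (restrictLoop s₁ _ _ (loopMk_ne h₁ h₂ _ _ _ _) x) =
      t₂ (restrictLoop s₂ _ _ (loopMk_ne h₂ h₁ _ _ _ _)
        (X.loopLoop h₁ h₂ hii hij hji hjj x))) :
    D.loop X i₁ j₁ h₁ ≫ (D.relabel hg₁ s₁).hom ≫ D.loop Y₁ _ _ hk₁ ≫ (D.relabel hg₁' t₁).hom =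
      D.loop X i₂ j₂ h₂ ≫ (D.relabel hg₂ s₂).hom ≫ D.loop Y₂ _ _ hk₂ ≫
        (D.relabel hg₂' t₂).hom := by
  rw [← reassoc_of% (hD.relabel_loop hg₁ s₁ _ _ (loopMk_ne h₁ h₂ _ _ _ _)),
    ← reassoc_of% (hD.relabel_loop hg₂ s₂ _ _ (loopMk_ne h₂ h₁ _ _ _ _)),
    ← reassoc_of% (hD.loop_loop X i₁ j₁ i₂ j₂ h₁ h₂ hii hij hji hjj)]
  exact whisker_eq _ (whisker_eq _ (hD.relabel_comp_eq' hst))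

theorem edge_relabel_loop_relabel {X X' Y Y₁ Z : StablePair.{u}} {i₁ j₁ i₂ : X.I} {j₂ : Y.I}
    (h₁ : i₁ ≠ j₁) (hi : i₁ ≠ i₂) (hj : j₁ ≠ i₂)
    (hg₁ : (X.edge Y i₂ j₂).g = Y₁.g) (s₁ : (X.edge Y i₂ j₂).I ≃ Y₁.I)
    (hk₁ : s₁ (edgeInl j₂ i₁ hi) ≠ s₁ (edgeInl j₂ j₁ hj))
    (hg₁' : (Y₁.loop _ _ hk₁).g = Z.g) (t₁ : (Y₁.loop _ _ hk₁).I ≃ Z.I)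
    (hg₂ : (X.loop i₁ j₁ h₁).g = X'.g) (s₂ : (X.loop i₁ j₁ h₁).I ≃ X'.I)
    (hg₂' : (X'.edge Y (s₂ (loopMk h₁ i₂ hi.symm hj.symm)) j₂).g = Z.g)
    (t₂ : (X'.edge Y (s₂ (loopMk h₁ i₂ hi.symm hj.symm)) j₂).I ≃ Z.I)
    (hst : ∀ x, t₁ (restrictLoop s₁ _ _ (edgeInl_ne j₂ h₁ hi hj) x) =
      t₂ (restrictEdge s₂ (Equiv.refl _) _ _ (X.loopEdge Y j₂ h₁ hi hj x))) :
    D.edge X Y i₂ j₂ ≫ (D.relabel hg₁ s₁).hom ≫ D.loop Y₁ _ _ hk₁ ≫ (D.relabel hg₁' t₁).hom =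
      (D.loop X i₁ j₁ h₁ ≫ (D.relabel hg₂ s₂).hom) ▷ D.obj Y ≫ D.edge X' Y _ j₂ ≫
        (D.relabel hg₂' t₂).hom := by
  have e := hD.relabel_edge_left Y hg₂ s₂ (loopMk h₁ i₂ hi.symm hj.symm) j₂
  have e' := hD.loop_edge X Y i₁ j₁ i₂ j₂ h₁ hi hj
  rw [tensorHom_id] at e'
  rw [← reassoc_of% (hD.relabel_loop hg₁ s₁ _ _ (edgeInl_ne j₂ h₁ hi hj)), comp_whiskerRight,
    Category.assoc, reassoc_of% e, ← reassoc_of% e']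
  exact whisker_eq _ (whisker_eq _ (hD.relabel_comp_eq' hst))

theorem edge_relabel_loop_relabel' {X Y Y₁ Y₂ Z : StablePair.{u}} {i₁ i₂ : X.I} {j₁ j₂ : Y.I}
    (hi : i₁ ≠ i₂) (hj : j₁ ≠ j₂)
    (hg₁ : (X.edge Y i₁ j₁).g = Y₁.g) (s₁ : (X.edge Y i₁ j₁).I ≃ Y₁.I)
    (hk₁ : s₁ (edgeInl j₁ i₂ hi.symm) ≠ s₁ (edgeInr i₁ j₂ hj.symm))
    (hg₁' : (Y₁.loop _ _ hk₁).g = Z.g) (t₁ : (Y₁.loop _ _ hk₁).I ≃ Z.I)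
    (hg₂ : (X.edge Y i₂ j₂).g = Y₂.g) (s₂ : (X.edge Y i₂ j₂).I ≃ Y₂.I)
    (hk₂ : s₂ (edgeInl j₂ i₁ hi) ≠ s₂ (edgeInr i₂ j₁ hj))
    (hg₂' : (Y₂.loop _ _ hk₂).g = Z.g) (t₂ : (Y₂.loop _ _ hk₂).I ≃ Z.I)
    (hst : ∀ x, t₁ (restrictLoop s₁ _ _ (edgeInl_ne_edgeInr _ _ _ _) x) =
      t₂ (restrictLoop s₂ _ _ (edgeInl_ne_edgeInr _ _ _ _) (X.edgeLoop Y hi hj x))) :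
    D.edge X Y i₁ j₁ ≫ (D.relabel hg₁ s₁).hom ≫ D.loop Y₁ _ _ hk₁ ≫ (D.relabel hg₁' t₁).hom =
      D.edge X Y i₂ j₂ ≫ (D.relabel hg₂ s₂).hom ≫ D.loop Y₂ _ _ hk₂ ≫
        (D.relabel hg₂' t₂).hom := by
  rw [← reassoc_of% (hD.relabel_loop hg₁ s₁ _ _ (edgeInl_ne_edgeInr _ _ _ _)),
    ← reassoc_of% (hD.relabel_loop hg₂ s₂ _ _ (edgeInl_ne_edgeInr _ _ _ _)),
    ← reassoc_of% (hD.edge_loop X Y i₁ i₂ j₁ j₂ hi hj)]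
  exact whisker_eq _ (whisker_eq _ (hD.relabel_comp_eq' hst))

theorem edge_relabel_edge_relabel {X Y Z W₁ W₂ U : StablePair.{u}} {i₁ : X.I} {j₁ i₂ : Y.I}
    {j₂ : Z.I} (h : j₁ ≠ i₂)
    (hg₁ : (Y.edge Z i₂ j₂).g = W₁.g) (s₁ : (Y.edge Z i₂ j₂).I ≃ W₁.I)
    (hg₁' : (X.edge W₁ i₁ (s₁ (edgeInl j₂ j₁ h))).g = U.g)
    (t₁ : (X.edge W₁ i₁ (s₁ (edgeInl j₂ j₁ h))).I ≃ U.I)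
    (hg₂ : (X.edge Y i₁ j₁).g = W₂.g) (s₂ : (X.edge Y i₁ j₁).I ≃ W₂.I)
    (hg₂' : (W₂.edge Z (s₂ (edgeInr i₁ i₂ h.symm)) j₂).g = U.g)
    (t₂ : (W₂.edge Z (s₂ (edgeInr i₁ i₂ h.symm)) j₂).I ≃ U.I)
    (hst : ∀ x, t₁ (restrictEdge (Equiv.refl _) s₁ _ _ x) =
      t₂ (restrictEdge s₂ (Equiv.refl _) _ _ (X.edgeEdge Y Z i₁ j₂ h x))) :
    D.obj X ◁ (D.edge Y Z i₂ j₂ ≫ (D.relabel hg₁ s₁).hom) ≫ D.edge X W₁ i₁ _ ≫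
        (D.relabel hg₁' t₁).hom =
      (α_ _ _ _).inv ≫ (D.edge X Y i₁ j₁ ≫ (D.relabel hg₂ s₂).hom) ▷ D.obj Z ≫ D.edge W₂ Z _ j₂ ≫
        (D.relabel hg₂' t₂).hom := by
  have e₁ := hD.relabel_edge_right X hg₁ s₁ i₁ (edgeInl j₂ j₁ h)
  have e₂ := hD.relabel_edge_left Z hg₂ s₂ (edgeInr i₁ i₂ h.symm) j₂
  have e := hD.edge_edge X Y Z i₁ j₁ i₂ j₂ h
  rw [tensorHom_id, id_tensorHom] at e
  simp only [comp_whiskerRight, MonoidalCategory.whiskerLeft_comp, Category.assoc]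
  rw [reassoc_of% e₁, reassoc_of% e₂, ← reassoc_of% e]
  exact whisker_eq _ (whisker_eq _ (hD.relabel_comp_eq' hst))

theorem loop_relabel_relabel {X Y Z W : StablePair.{u}} {i j : X.I} (h : i ≠ j)
    (hg₁ : (X.loop i j h).g = Y.g) (s₁ : (X.loop i j h).I ≃ Y.I) (hg₁' : Y.g = W.g) (t₁ : Y.I ≃ W.I)
    (hg₂ : X.g = Z.g) (s₂ : X.I ≃ Z.I) (hk : s₂ i ≠ s₂ j)
    (hg₂' : (Z.loop _ _ hk).g = W.g) (t₂ : (Z.loop _ _ hk).I ≃ W.I)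
    (hst : ∀ x, t₁ (s₁ x) = t₂ (restrictLoop s₂ i j h x)) :
    (D.loop X i j h ≫ (D.relabel hg₁ s₁).hom) ≫ (D.relabel hg₁' t₁).hom =
      (D.relabel hg₂ s₂).hom ≫ D.loop Z _ _ hk ≫ (D.relabel hg₂' t₂).hom := by
  rw [← reassoc_of% (hD.relabel_loop hg₂ s₂ _ _ h), Category.assoc]
  exact whisker_eq _ (hD.relabel_comp_eq hst)

theorem edge_relabel_relabel {X Y X' Y' Z W : StablePair.{u}} {i : X.I} {j : Y.I}
    (hg₁ : (X.edge Y i j).g = Z.g) (s₁ : (X.edge Y i j).I ≃ Z.I) (hg₁' : Z.g = W.g) (t₁ : Z.I ≃ W.I)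
    (hg₂ : X.g = X'.g) (s₂ : X.I ≃ X'.I) (hg₂' : Y.g = Y'.g) (s₂' : Y.I ≃ Y'.I)
    (hg₃ : (X'.edge Y' (s₂ i) (s₂' j)).g = W.g) (t₂ : (X'.edge Y' (s₂ i) (s₂' j)).I ≃ W.I)
    (hst : ∀ x, t₁ (s₁ x) = t₂ (restrictEdge s₂ s₂' i j x)) :
    (D.edge X Y i j ≫ (D.relabel hg₁ s₁).hom) ≫ (D.relabel hg₁' t₁).hom =
      ((D.relabel hg₂ s₂).hom ⊗ₘ (D.relabel hg₂' s₂').hom) ≫ D.edge X' Y' _ _ ≫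
        (D.relabel hg₃ t₂).hom := by
  rw [reassoc_of% (hD.relabel_edge hg₂ s₂ hg₂' s₂' i j), Category.assoc]
  exact whisker_eq _ (hD.relabel_comp_eq hst)

end IsCompatible

/-! ### Gluing maps and relabelings of blocks -/

variable {F V F' V' F'' V'' : Type u}

/-- The object of a block. -/
abbrev blockObj (B : Block F V) : C := D.obj B.pair

/-- The gluing map of a block with itself. -/
noncomputable def loopMap {a a' : F} {B B' : Block F V} (h : Block.IsLoop a a' B B') :
    D.blockObj B ⟶ D.blockObj B' :=
  D.loop B.pair ⟨a, h.left⟩ ⟨a', h.right⟩ (fun e => h.ne (congrArg Subtype.val e)) ≫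
    (D.relabel h.g_eq h.equiv).hom

/-- The gluing map of two blocks. -/
noncomputable def edgeMap {a a' : F} {B₁ B₂ B' : Block F V} (h : Block.IsEdge a a' B₁ B₂ B') :
    D.blockObj B₁ ⊗ D.blockObj B₂ ⟶ D.blockObj B' :=
  D.edge B₁.pair B₂.pair ⟨a, h.left⟩ ⟨a', h.right⟩ ≫ (D.relabel h.g_eq h.equiv).hom

/-- The isomorphism of a block with its image under an injective map. -/
noncomputable def imageIso {f : F → F'} {B : Block F V} {B' : Block F' V'}
    (h : Block.IsImage f B B') : D.blockObj B ≅ D.blockObj B' :=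
  D.relabel h.g_eq h.equiv

/-! ### The compatibility conditions for blocks -/

namespace IsCompatible

variable {D} (hD : D.IsCompatible)
include hD

theorem loopMap_symm {a a' : F} {B B' : Block F V} (h : Block.IsLoop a a' B B') :
    D.loopMap h = D.loopMap h.symm := by
  have e := hD.loop_symm B.pair ⟨a, h.left⟩ ⟨a', h.right⟩ (fun e => h.ne (congrArg Subtype.val e))
  refine Eq.trans ?_ (eq_whisker e _)
  rw [Category.assoc]
  exact whisker_eq _ (hD.relabel_eq_comp fun _ => rfl)

theorem edgeMap_symm {a a' : F} {B₁ B₂ B' : Block F V} (h : Block.IsEdge a a' B₁ B₂ B') :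
    D.edgeMap h = (β_ _ _).hom ≫ D.edgeMap h.symm := by
  have e := hD.edge_symm B₁.pair B₂.pair ⟨a, h.left⟩ ⟨a', h.right⟩
  refine Eq.trans ?_ ((eq_whisker e _).trans (Category.assoc _ _ _))
  rw [Category.assoc]
  refine whisker_eq _ (hD.relabel_eq_comp ?_)
  rintro ⟨x | x, hx⟩ <;> rfl

/-- Every bijection involved fixes the underlying flags in `F`, so the comparison of relabelings in
`loop_relabel_loop_relabel` holds by `rfl`. The same mechanism proves the three lemmas that follow.
-/
theorem loopMap_loopMap {a a' b b' : F} {B B₁ B₂ B' : Block F V}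
    (h₁ : Block.IsLoop a a' B B₁) (h₂ : Block.IsLoop b b' B₁ B')
    (k₁ : Block.IsLoop b b' B B₂) (k₂ : Block.IsLoop a a' B₂ B') :
    D.loopMap h₁ ≫ D.loopMap h₂ = D.loopMap k₁ ≫ D.loopMap k₂ := by
  -- The flags `a` and `a'` survive the gluing of `b` and `b'`, hence are distinct from both.
  have ha := ((k₁.mem_S _).1 k₂.left).2
  have ha' := ((k₁.mem_S _).1 k₂.right).2
  rw [loopMap, loopMap, loopMap, loopMap, Category.assoc, Category.assoc]
  exact hD.loop_relabel_loop_relabel (X := B.pair) (Y₁ := B₁.pair) (Y₂ := B₂.pair)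
    (Z := B'.pair) (i₁ := ⟨a, h₁.left⟩) (j₁ := ⟨a', h₁.right⟩)
    (i₂ := ⟨b, k₁.left⟩) (j₂ := ⟨b', k₁.right⟩) _ _
    (fun e => ha.1 (congrArg Subtype.val e)) (fun e => ha.2 (congrArg Subtype.val e))
    (fun e => ha'.1 (congrArg Subtype.val e)) (fun e => ha'.2 (congrArg Subtype.val e))
    h₁.g_eq h₁.equiv k₁.g_eq k₁.equiv _ _ h₂.g_eq h₂.equiv k₂.g_eq k₂.equiv fun _ => rfl

theorem edgeMap_loopMap {a a' b b' : F} {X X' Y W Z : Block F V}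
    (h₁ : Block.IsEdge b b' X Y W) (h₂ : Block.IsLoop a a' W Z)
    (k₁ : Block.IsLoop a a' X X') (k₂ : Block.IsEdge b b' X' Y Z) :
    D.edgeMap h₁ ≫ D.loopMap h₂ = D.loopMap k₁ ▷ _ ≫ D.edgeMap k₂ := by
  have ha := ((h₁.mem_S _).1 h₂.left).2
  have ha' := ((h₁.mem_S _).1 h₂.right).2
  rw [loopMap, loopMap, edgeMap, edgeMap, Category.assoc]
  refine hD.edge_relabel_loop_relabel (X := X.pair) (Y := Y.pair) (X' := X'.pair) (Y₁ := W.pair)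
    (Z := Z.pair) (i₁ := ⟨a, k₁.left⟩)
    (j₁ := ⟨a', k₁.right⟩) (i₂ := ⟨b, h₁.left⟩) (j₂ := ⟨b', h₁.right⟩) _
    (fun e => ha.1 (congrArg Subtype.val e)) (fun e => ha'.1 (congrArg Subtype.val e))
    h₁.g_eq h₁.equiv _ h₂.g_eq h₂.equiv k₁.g_eq k₁.equiv k₂.g_eq k₂.equiv ?_
  rintro ⟨⟨x | x, hx⟩, hx'⟩ <;> rfl

theorem edgeMap_loopMap' {a a' b b' : F} {X Y W₁ W₂ Z : Block F V}
    (h₁ : Block.IsEdge a a' X Y W₁) (h₂ : Block.IsLoop b b' W₁ Z)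
    (k₁ : Block.IsEdge b b' X Y W₂) (k₂ : Block.IsLoop a a' W₂ Z) :
    D.edgeMap h₁ ≫ D.loopMap h₂ = D.edgeMap k₁ ≫ D.loopMap k₂ := by
  have ha := ((k₁.mem_S _).1 k₂.left).2
  have ha' := ((k₁.mem_S _).1 k₂.right).2
  rw [loopMap, loopMap, edgeMap, edgeMap, Category.assoc, Category.assoc]
  refine hD.edge_relabel_loop_relabel' (X := X.pair) (Y := Y.pair) (Y₁ := W₁.pair)
    (Y₂ := W₂.pair) (Z := Z.pair) (i₁ := ⟨a, h₁.left⟩)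
    (j₁ := ⟨a', h₁.right⟩) (i₂ := ⟨b, k₁.left⟩) (j₂ := ⟨b', k₁.right⟩)
    (fun e => ha.1 (congrArg Subtype.val e)) (fun e => ha'.2 (congrArg Subtype.val e))
    h₁.g_eq h₁.equiv _ h₂.g_eq h₂.equiv k₁.g_eq k₁.equiv _ k₂.g_eq k₂.equiv ?_
  rintro ⟨⟨x | x, hx⟩, hx'⟩ <;> rfl

theorem edgeMap_edgeMap {a a' b b' : F} {X Y Z W₁ W₂ U : Block F V}
    (h₁ : Block.IsEdge b b' Y Z W₁) (h₂ : Block.IsEdge a a' X W₁ U)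
    (k₁ : Block.IsEdge a a' X Y W₂) (k₂ : Block.IsEdge b b' W₂ Z U) :
    _ ◁ D.edgeMap h₁ ≫ D.edgeMap h₂ =
      (α_ _ _ _).inv ≫ D.edgeMap k₁ ▷ _ ≫ D.edgeMap k₂ := by
  have ha' := ((h₁.mem_S _).1 h₂.right).2
  rw [edgeMap, edgeMap, edgeMap, edgeMap]
  refine hD.edge_relabel_edge_relabel (X := X.pair) (Y := Y.pair) (Z := Z.pair) (W₁ := W₁.pair)
    (W₂ := W₂.pair) (U := U.pair)
    (i₁ := ⟨a, k₁.left⟩) (j₁ := ⟨a', k₁.right⟩) (i₂ := ⟨b, h₁.left⟩) (j₂ := ⟨b', h₁.right⟩)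
    (fun e => ha'.1 (congrArg Subtype.val e))
    h₁.g_eq h₁.equiv h₂.g_eq h₂.equiv k₁.g_eq k₁.equiv k₂.g_eq k₂.equiv ?_
  rintro ⟨x | ⟨x | x, hx⟩, hx'⟩ <;> rfl

theorem loopMap_imageIso {f : F → F'} {a a' : F} {b b' : F'} {B B₁ : Block F V}
    {B' B₁' : Block F' V'} (hb : b = f a) (hb' : b' = f a') (h : Block.IsLoop a a' B B₁)
    (h' : Block.IsLoop b b' B' B₁') (k : Block.IsImage f B B') (k₁ : Block.IsImage f B₁ B₁') :
    D.loopMap h ≫ (D.imageIso k₁).hom = (D.imageIso k).hom ≫ D.loopMap h' := by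
  subst hb hb'
  exact hD.loop_relabel_relabel (X := B.pair) (Y := B₁.pair) (Z := B'.pair) (W := B₁'.pair)
    (i := ⟨a, h.left⟩) (j := ⟨a', h.right⟩) _ h.g_eq h.equiv k₁.g_eq k₁.equiv k.g_eq k.equiv _
    h'.g_eq h'.equiv fun _ => rfl

theorem edgeMap_imageIso {f : F → F'} {a a' : F} {b b' : F'} {X Y Z : Block F V}
    {X' Y' Z' : Block F' V'} (hb : b = f a) (hb' : b' = f a') (h : Block.IsEdge a a' X Y Z)
    (h' : Block.IsEdge b b' X' Y' Z') (k : Block.IsImage f X X') (k' : Block.IsImage f Y Y')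
    (k₁ : Block.IsImage f Z Z') :
    D.edgeMap h ≫ (D.imageIso k₁).hom =
      ((D.imageIso k).hom ⊗ₘ (D.imageIso k').hom) ≫ D.edgeMap h' := by
  subst hb hb'
  refine hD.edge_relabel_relabel (X := X.pair) (Y := Y.pair) (X' := X'.pair) (Y' := Y'.pair)
    (Z := Z.pair) (W := Z'.pair) (i := ⟨a, h.left⟩) (j := ⟨a', h.right⟩) h.g_eq h.equiv
    k₁.g_eq k₁.equiv k.g_eq k.equiv k'.g_eq k'.equiv h'.g_eq h'.equiv ?_
  rintro ⟨x | x, hx⟩ <;> rfl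

theorem imageIso_trans {f : F → F'} {f' : F' → F''} {f'' : F → F''} {B : Block F V}
    {B' : Block F' V'} {B'' : Block F'' V''} (h : Block.IsImage f B B')
    (h' : Block.IsImage f' B' B'') (h'' : Block.IsImage f'' B B'') (hf : ∀ x, f'' x = f' (f x)) :
    (D.imageIso h).hom ≫ (D.imageIso h').hom = (D.imageIso h'').hom := by
  refine (hD.relabel_trans h.g_eq h'.g_eq h.equiv h'.equiv).symm.trans (D.relabel_congr _ _ ?_)
  exact fun x => Subtype.ext (hf x.1).symm

end IsCompatible
end GluingData

/-! ### Gluing in a list of blocks -/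

section

open SymmetricCategory

variable {F V : Type u}

/-! ### Existence and uniqueness of glued blocks -/

namespace Block

theorem IsLoop.eq {a a' : F} {B B₁ B₂ : Block F V} (h₁ : IsLoop a a' B B₁)
    (h₂ : IsLoop a a' B B₂) : B₁ = B₂ :=
  Block.ext (h₁.g_eq.symm.trans h₂.g_eq) (Set.ext fun x => (h₁.mem_S x).trans (h₂.mem_S x).symm)
    (h₁.A_eq.trans h₂.A_eq.symm)

theorem IsEdge.eq {a a' : F} {X Y B₁ B₂ : Block F V} (h₁ : IsEdge a a' X Y B₁)
    (h₂ : IsEdge a a' X Y B₂) : B₁ = B₂ :=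
  Block.ext (h₁.g_eq.symm.trans h₂.g_eq) (Set.ext fun x => (h₁.mem_S x).trans (h₂.mem_S x).symm)
    (h₁.A_eq.trans h₂.A_eq.symm)

theorem ncard_sdiff_pair {S : Set F} (hS : S.Finite) {a a' : F} (h : a ≠ a') (ha : a ∈ S)
    (ha' : a' ∈ S) : (S \ {a, a'}).ncard + 2 = S.ncard := by
  rw [← Set.ncard_pair h]
  exact Set.ncard_sdiff_add_ncard_of_subset (by
    rintro x (rfl | rfl) <;> assumption) hS

/-- Stability persists because `2(g + 1) - 2 + (n - 2) = 2g - 2 + n`. -/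
theorem IsLoop.exists_of_mem {a a' : F} {B : Block F V} (h : a ≠ a') (ha : a ∈ B.S)
    (ha' : a' ∈ B.S) :
    ∃ B', IsLoop a a' B B' := by
  have hS : B.S.Finite := B.finite_S
  have h1 := B.stable
  have h2 := ncard_sdiff_pair hS h ha ha'
  refine ⟨⟨B.g + 1, B.S \ {a, a'}, B.A, hS.subset Set.sdiff_subset, ?_⟩, h, ha, ha', rfl,
    fun x => by simp [not_or], rfl⟩
  rw [Nat.card_coe_set_eq] at h1 ⊢
  push_cast
  omega

/-- Stability persists because `2(g + g') - 2 + (n + n' - 2)` is the sum of two positive numbers,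
`2g - 2 + n` and `2g' - 2 + n'`. -/
theorem IsEdge.exists_of_mem {a a' : F} {B₁ B₂ : Block F V} (h : Disjoint B₁.S B₂.S) (ha : a ∈ B₁.S)
    (ha' : a' ∈ B₂.S) : ∃ B', IsEdge a a' B₁ B₂ B' := by
  have hS₁ : B₁.S.Finite := B₁.finite_S
  have hS₂ : B₂.S.Finite := B₂.finite_S
  have hne : a ≠ a' := fun e => Set.disjoint_left.1 h ha (e ▸ ha')
  have h1 := B₁.stable
  have h1' := B₂.stable
  have h2 := ncard_sdiff_pair (hS₁.union hS₂) hne (Or.inl ha) (Or.inr ha')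
  have h3 := Set.ncard_union_eq h hS₁ hS₂
  refine ⟨⟨B₁.g + B₂.g, (B₁.S ∪ B₂.S) \ {a, a'}, B₁.A ∪ B₂.A,
    (hS₁.union hS₂).subset Set.sdiff_subset, ?_⟩, h, ha, ha', rfl,
    fun x => by simp [not_or], rfl⟩
  rw [Nat.card_coe_set_eq] at h1 h1' ⊢
  push_cast
  omega

end Block

/-- Blocks with disjoint sets of flags and disjoint nonempty sets of vertices. -/
structure IsStage (l : List (Block F V)) : Prop where
  pairwise : l.Pairwise fun B B' => Disjoint B.S B'.S ∧ Disjoint B.A B'.A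
  nonempty : ∀ B ∈ l, B.A.Nonempty

namespace IsStage

variable {l l' : List (Block F V)} {B B' : Block F V}

theorem cons_iff : IsStage (B :: l) ↔
    (∀ B' ∈ l, Disjoint B.S B'.S ∧ Disjoint B.A B'.A) ∧ B.A.Nonempty ∧ IsStage l := by
  constructor
  · rintro ⟨h1, h2⟩
    rw [List.pairwise_cons] at h1
    exact ⟨h1.1, h2 B List.mem_cons_self, h1.2, fun B' h => h2 B' (List.mem_cons_of_mem _ h)⟩
  · rintro ⟨h1, h2, h3, h4⟩
    refine ⟨List.pairwise_cons.2 ⟨h1, h3⟩, fun B' h => ?_⟩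
    rcases List.mem_cons.1 h with rfl | h
    exacts [h2, h4 B' h]

theorem of_cons (h : IsStage (B :: l)) : IsStage l := (cons_iff.1 h).2.2

/-- This is what the sets of merged vertices are for: they are nonempty and disjoint. Disjoint sets
of flags would not suffice, since a block of genus at least two may have no flags. -/
theorem nodup (h : IsStage l) : l.Nodup := by
  induction l with
  | nil => exact List.nodup_nil
  | cons B l ih =>
    obtain ⟨h1, h2, h3⟩ := cons_iff.1 h
    exact List.nodup_cons.2 ⟨fun hB => h2.ne_empty (disjoint_self.1 (h1 B hB).2), ih h3⟩

theorem perm (h : IsStage l) (p : l.Perm l') : IsStage l' :=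
  ⟨(p.pairwise_iff fun h => ⟨h.1.symm, h.2.symm⟩).1 h.pairwise,
    fun B hB => h.nonempty B (p.mem_iff.2 hB)⟩

theorem disjoint (h : IsStage l) (hB : B ∈ l) (hB' : B' ∈ l) (hne : B ≠ B') :
    Disjoint B.S B'.S ∧ Disjoint B.A B'.A :=
  haveI : Std.Symm fun B B' : Block F V => Disjoint B.S B'.S ∧ Disjoint B.A B'.A :=
    ⟨fun _ _ h => ⟨h.1.symm, h.2.symm⟩⟩
  h.pairwise.forall hB hB' hne

theorem eq_of_mem_S (h : IsStage l) (hB : B ∈ l) (hB' : B' ∈ l) {a : F} (ha : a ∈ B.S)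
    (ha' : a ∈ B'.S) : B = B' := by
  by_contra hne
  exact Set.disjoint_left.1 (h.disjoint hB hB' hne).1 ha ha'

theorem eq_of_mem_A (h : IsStage l) (hB : B ∈ l) (hB' : B' ∈ l) {a : V} (ha : a ∈ B.A)
    (ha' : a ∈ B'.A) : B = B' := by
  by_contra hne
  exact Set.disjoint_left.1 (h.disjoint hB hB' hne).2 ha ha'

theorem loop {a a' : F} (h : IsStage (B :: l)) (hl : Block.IsLoop a a' B B') :
    IsStage (B' :: l) := by
  obtain ⟨h1, h2, h3⟩ := cons_iff.1 h
  refine cons_iff.2 ⟨fun X hX => ⟨(h1 X hX).1.mono_left fun x hx => ((hl.mem_S x).1 hx).1, ?_⟩,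
    ?_, h3⟩ <;> rw [hl.A_eq]
  exacts [(h1 X hX).2, h2]

theorem edge {a a' : F} {B₁ B₂ : Block F V} (h : IsStage (B₁ :: B₂ :: l))
    (hl : Block.IsEdge a a' B₁ B₂ B') : IsStage (B' :: l) := by
  obtain ⟨h1, h2, h3⟩ := cons_iff.1 h
  obtain ⟨h1', h2', h3'⟩ := cons_iff.1 h3
  refine cons_iff.2 ⟨fun X hX => ⟨?_, ?_⟩, ?_, h3'⟩
  · refine (Disjoint.sup_left (h1 X (List.mem_cons_of_mem _ hX)).1 (h1' X hX).1).mono_left ?_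
    exact fun x hx => ((hl.mem_S x).1 hx).1
  · rw [hl.A_eq]
    exact Disjoint.sup_left (h1 X (List.mem_cons_of_mem _ hX)).2 (h1' X hX).2
  · rw [hl.A_eq]
    exact h2.mono Set.subset_union_left

end IsStage

namespace GluingData

variable {C : Type w} [Category.{v} C] [MonoidalCategory C] [SymmetricCategory C]
variable (D : GluingData.{u} C)

/-- The tensor product of a list of blocks. -/
abbrev stageObj (l : List (Block F V)) : C := tensorList D.blockObj l

/-- `D.Contracts a a' l l' φ` says that the blocks `l'` are obtained, up to a permutation, from `l`
by gluing the flags `a` and `a'`, and that `φ` is the corresponding morphism. -/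
inductive Contracts (a a' : F) :
    ∀ l l' : List (Block F V), (D.stageObj l ⟶ D.stageObj l') → Prop
  | loop {l l' r : List (Block F V)} {B B' : Block F V} (h : Block.IsLoop a a' B B')
      (p : l.Perm (B :: r)) (q : (B' :: r).Perm l') :
      Contracts a a' l l'
        (permHom D.blockObj p ≫ D.loopMap h ▷ D.stageObj r ≫ permHom D.blockObj q)
  | edge {l l' r : List (Block F V)} {B₁ B₂ B' : Block F V} (h : Block.IsEdge a a' B₁ B₂ B')
      (p : l.Perm (B₁ :: B₂ :: r)) (q : (B' :: r).Perm l') :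
      Contracts a a' l l' (permHom D.blockObj p ≫
        (α_ (D.blockObj B₁) (D.blockObj B₂) (D.stageObj r)).inv ≫
          D.edgeMap h ▷ D.stageObj r ≫ permHom D.blockObj q)

variable {D}

/-! ### Gluing one pair of flags -/

namespace Contracts

variable {a a' b b' : F} {l l' m m' : List (Block F V)}
  {φ : D.stageObj l ⟶ D.stageObj l'}

theorem isStage (h : D.Contracts a a' l l' φ) (hl : IsStage l) : IsStage l' := by
  cases h with
  | loop h p q => exact ((hl.perm p).loop h).perm q
  | edge h p q => exact ((hl.perm p).edge h).perm q

theorem head_loop {B B' : Block F V} (h : Block.IsLoop a a' B B') (hl : IsStage (B :: l)) :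
    D.Contracts a a' (B :: l) (B' :: l) (D.loopMap h ▷ D.stageObj l) := by
  have := loop (D := D) h (List.Perm.refl (B :: l)) (List.Perm.refl (B' :: l))
  rwa [permHom_refl hl.nodup, permHom_refl (hl.loop h).nodup, Category.id_comp,
    Category.comp_id] at this

theorem head_edge {B₁ B₂ B' : Block F V} (h : Block.IsEdge a a' B₁ B₂ B')
    (hl : IsStage (B₁ :: B₂ :: l)) :
    D.Contracts a a' (B₁ :: B₂ :: l) (B' :: l)
      ((α_ (D.blockObj B₁) (D.blockObj B₂) (D.stageObj l)).inv ≫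
        D.edgeMap h ▷ D.stageObj l) := by
  have := edge (D := D) h (List.Perm.refl (B₁ :: B₂ :: l)) (List.Perm.refl (B' :: l))
  rwa [permHom_refl hl.nodup, permHom_refl (hl.edge h).nodup, Category.id_comp,
    Category.comp_id] at this

theorem perm_left (h : D.Contracts a a' l l' φ) (hl : IsStage l) (p : m.Perm l) :
    D.Contracts a a' m l' (permHom D.blockObj p ≫ φ) := by
  cases h with
  | loop h q q' =>
    rw [permHom_trans_assoc _ _ (hl.perm q).nodup]
    exact .loop h _ q'
  | edge h q q' =>
    rw [permHom_trans_assoc _ _ (hl.perm q).nodup]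
    exact .edge h _ q'

theorem perm_right (h : D.Contracts a a' l l' φ) (hl : IsStage l) (p : l'.Perm m) :
    D.Contracts a a' l m (φ ≫ permHom D.blockObj p) := by
  have hm := ((h.isStage hl).perm p).nodup
  cases h with
  | loop h q q' =>
    simp only [Category.assoc]
    rw [permHom_trans _ _ hm]
    exact .loop h q _
  | edge h q q' =>
    simp only [Category.assoc]
    rw [permHom_trans _ _ hm]
    exact .edge h q _

/-- The flags `a` and `a'` lie in unique blocks of `l`. Whether these coincide decides between loop
and edge, and they determine the glued block, so only the arrangement of the blocks is left open. -/
theorem unique {ψ : D.stageObj l ⟶ D.stageObj m} (h : D.Contracts a a' l l' φ)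
    (h' : D.Contracts a a' l m ψ) (hl : IsStage l) :
    ∃ p : l'.Perm m, ψ = φ ≫ permHom D.blockObj p := by
  have hm := (h'.isStage hl).nodup
  cases h with
  | @loop r B B' h p q =>
    cases h' with
    | @loop r₁ B₁ B₁' h' p' q' =>
      have hB := p.mem_iff.2 List.mem_cons_self
      have hB₁ := p'.mem_iff.2 List.mem_cons_self
      obtain rfl := hl.eq_of_mem_S hB hB₁ h.left h'.left
      obtain rfl := h.eq h'
      -- The blocks that are not glued may be listed in another order; this permutation slides past
      -- the gluing map by the interchange law.
      have pr : r.Perm r₁ := (p.symm.trans p').cons_inv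
      refine ⟨(q.symm.trans (pr.cons B')).trans q', ?_⟩
      have e1 : permHom D.blockObj p' = permHom D.blockObj p ≫ _ ◁ permHom D.blockObj pr := by
        rw [← permHom_cons (X := D.blockObj) B pr (pr.cons B) (hl.perm p').nodup]
        exact (permHom_trans _ _ (hl.perm p').nodup).symm
      have e2 : permHom D.blockObj q ≫
          permHom D.blockObj ((q.symm.trans (pr.cons B')).trans q') =
            _ ◁ permHom D.blockObj pr ≫ permHom D.blockObj q' := by
        rw [← permHom_cons (X := D.blockObj) B' pr (pr.cons B') (q'.nodup_iff.2 hm),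
          permHom_trans _ _ hm]
        exact (permHom_trans _ _ hm).symm
      simp only [Category.assoc]
      rw [e2, e1, Category.assoc, whisker_exchange_assoc]
    | @edge r₁ B₁ B₂ B₁' h' p' q' =>
      exfalso
      have hB := p.mem_iff.2 List.mem_cons_self
      have hB₁ := p'.mem_iff.2 List.mem_cons_self
      obtain rfl := hl.eq_of_mem_S hB hB₁ h.left h'.left
      exact Set.disjoint_left.1 h'.disj h.right h'.right
  | @edge r B₁ B₂ B' h p q =>
    cases h' with
    | @loop r₁ B B₁' h' p' q' =>
      exfalso
      have hB := p.mem_iff.2 List.mem_cons_self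
      have hB₁ := p'.mem_iff.2 List.mem_cons_self
      obtain rfl := hl.eq_of_mem_S hB hB₁ h.left h'.left
      exact Set.disjoint_left.1 h.disj h'.right h.right
    | @edge r₁ X Y B₁' h' p' q' =>
      have hB₁ := p.mem_iff.2 List.mem_cons_self
      have hB₂ := p.mem_iff.2 (List.mem_cons_of_mem _ List.mem_cons_self)
      have hX := p'.mem_iff.2 List.mem_cons_self
      have hY := p'.mem_iff.2 (List.mem_cons_of_mem _ List.mem_cons_self)
      obtain rfl := hl.eq_of_mem_S hB₁ hX h.left h'.left
      obtain rfl := hl.eq_of_mem_S hB₂ hY h.right h'.right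
      obtain rfl := h.eq h'
      have pr : r.Perm r₁ := (p.symm.trans p').cons_inv.cons_inv
      refine ⟨(q.symm.trans (pr.cons B')).trans q', ?_⟩
      have hn := (hl.perm p').nodup
      have e1 : permHom D.blockObj p' =
          permHom D.blockObj p ≫ _ ◁ _ ◁ permHom D.blockObj pr := by
        rw [← permHom_cons (X := D.blockObj) B₂ pr (pr.cons B₂) hn.of_cons,
          ← permHom_cons (X := D.blockObj) B₁ (pr.cons B₂) ((pr.cons B₂).cons B₁) hn]
        exact (permHom_trans _ _ hn).symm
      have e2 : permHom D.blockObj q ≫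
          permHom D.blockObj ((q.symm.trans (pr.cons B')).trans q') =
            _ ◁ permHom D.blockObj pr ≫ permHom D.blockObj q' := by
        rw [← permHom_cons (X := D.blockObj) B' pr (pr.cons B') (q'.nodup_iff.2 hm),
          permHom_trans _ _ hm]
        exact (permHom_trans _ _ hm).symm
      simp only [Category.assoc]
      rw [e2, e1, Category.assoc, ← whisker_exchange_assoc, associator_inv_naturality_right_assoc]

theorem exists_of_mem (hl : IsStage l) (hne : a ≠ a') {B B' : Block F V} (hB : B ∈ l) (ha : a ∈ B.S)
    (hB' : B' ∈ l) (ha' : a' ∈ B'.S) :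
    ∃ (l' : List (Block F V)) (φ : D.stageObj l ⟶ D.stageObj l'), D.Contracts a a' l l' φ := by
  classical
  have p := List.perm_cons_erase hB
  by_cases h : B = B'
  · subst h
    obtain ⟨B₁, h₁⟩ := Block.IsLoop.exists_of_mem hne ha ha'
    exact ⟨_, _, .loop h₁ p (.refl _)⟩
  · obtain ⟨B₁, h₁⟩ := Block.IsEdge.exists_of_mem (hl.disjoint hB hB' h).1 ha ha'
    have p' := List.perm_cons_erase ((List.mem_erase_of_ne (Ne.symm h)).2 hB')
    exact ⟨_, _, .edge h₁ (p.trans (p'.cons B)) (.refl _)⟩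

theorem isStage_cons (h : D.Contracts a a' l l' φ) {X : Block F V} (hl : IsStage (X :: l)) :
    IsStage (X :: l') := by
  cases h with
  | loop h p q =>
    exact (((hl.perm ((p.cons X).trans (.swap _ _ _))).loop h).perm (.swap _ _ _)).perm (q.cons X)
  | edge h p q =>
    exact (((hl.perm (((p.cons X).trans (.swap _ _ _)).trans ((List.Perm.swap _ _ _).cons _))).edge
      h).perm (.swap _ _ _)).perm (q.cons X)

/-- The idle block `X` is moved behind the blocks to be glued and brought to the front again
afterwards; by naturality the exchanges cancel. -/
theorem cons (h : D.Contracts a a' l l' φ) (X : Block F V) (hl : IsStage (X :: l)) :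
    D.Contracts a a' (X :: l) (X :: l') (D.blockObj X ◁ φ) := by
  have hl' := h.isStage_cons hl
  cases h with
  | @loop r B B' h p q =>
    have q1 : (X :: l).Perm (B :: X :: r) := (p.cons X).trans (.swap _ _ _)
    have q2 : (B' :: X :: r).Perm (X :: l') := (List.Perm.swap _ _ _).trans (q.cons X)
    have n1 := (hl.perm q1).nodup
    have n1' := (hl.perm (p.cons X)).nodup
    have n2 := (hl'.perm (q.cons X).symm).nodup
    have e1 : permHom D.blockObj q1 = _ ◁ permHom D.blockObj p ≫ exchange _ _ _ := by
      rw [← permHom_cons (X := D.blockObj) X p (p.cons X) n1',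
        ← permHom_swap (X := D.blockObj) X B (.swap _ _ _) n1]
      exact (permHom_trans _ _ n1).symm
    have e2 : permHom D.blockObj q2 = exchange _ _ _ ≫ _ ◁ permHom D.blockObj q := by
      rw [← permHom_cons (X := D.blockObj) X q (q.cons X) hl'.nodup,
        ← permHom_swap (X := D.blockObj) B' X (.swap _ _ _) n2]
      exact (permHom_trans _ _ hl'.nodup).symm
    have := loop (D := D) h q1 q2
    rw [e1, e2] at this
    convert this using 1
    simp only [MonoidalCategory.whiskerLeft_comp, Category.assoc]
    rw [← exchange_naturality_middle_assoc, exchange_exchange_assoc]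
  | @edge r B₁ B₂ B' h p q =>
    have s1 : (X :: B₁ :: B₂ :: r).Perm (B₁ :: X :: B₂ :: r) := .swap _ _ _
    have s2 : (X :: B₂ :: r).Perm (B₂ :: X :: r) := .swap _ _ _
    have q1 : (X :: l).Perm (B₁ :: B₂ :: X :: r) := ((p.cons X).trans s1).trans (s2.cons B₁)
    have q2 : (B' :: X :: r).Perm (X :: l') := (List.Perm.swap _ _ _).trans (q.cons X)
    have n1 := (hl.perm q1).nodup
    have n1' := (hl.perm (p.cons X)).nodup
    have n1'' := (hl.perm ((p.cons X).trans s1)).nodup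
    have n2 := (hl'.perm (q.cons X).symm).nodup
    have e1 : permHom D.blockObj q1 = _ ◁ permHom D.blockObj p ≫ exchange _ _ _ ≫
        _ ◁ exchange _ _ _ := by
      rw [← permHom_cons (X := D.blockObj) X p (p.cons X) n1',
        ← permHom_swap (X := D.blockObj) X B₁ s1 n1'',
        ← permHom_swap (X := D.blockObj) X B₂ s2 n1.of_cons,
        ← permHom_cons (X := D.blockObj) B₁ s2 (s2.cons B₁) n1]
      have := permHom_trans (X := D.blockObj) (p.cons X) s1 n1''
      rw [reassoc_of% this]
      exact (permHom_trans _ _ n1).symm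
    have e2 : permHom D.blockObj q2 = exchange _ _ _ ≫ _ ◁ permHom D.blockObj q := by
      rw [← permHom_cons (X := D.blockObj) X q (q.cons X) hl'.nodup,
        ← permHom_swap (X := D.blockObj) B' X (.swap _ _ _) n2]
      exact (permHom_trans _ _ hl'.nodup).symm
    have := edge (D := D) h q1 q2
    rw [e1, e2] at this
    convert this using 1
    simp only [MonoidalCategory.whiskerLeft_comp, Category.assoc]
    -- Two exchanges, past `B₁` and past `B₂`, combine to one past `B₁ ⊗ B₂`, which is natural with
    -- respect to `edgeMap`.
    rw [← reassoc_of%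
      (exchange_tensor (D.blockObj X) (D.blockObj B₁) (D.blockObj B₂) (D.stageObj r)),
      ← exchange_naturality_middle_assoc, exchange_exchange_assoc]

end Contracts

end GluingData

end

/-! ### Two gluings commute -/

section

open SymmetricCategory

variable {F V : Type u}

namespace GluingData

variable {C : Type w} [Category.{v} C] [MonoidalCategory C] [SymmetricCategory C]
variable {D : GluingData.{u} C}

/-- The symmetry conditions `loop_symm` and `edge_symm`; for an edge the braiding is absorbed by
listing the two blocks in the opposite order. It is what allows gluing along unordered pairs. -/
theorem Contracts.flip (hD : D.IsCompatible) {a a' : F} {l l' : List (Block F V)}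
    {φ : D.stageObj l ⟶ D.stageObj l'} (h : D.Contracts a a' l l' φ) (hl : IsStage l) :
    D.Contracts a' a l l' φ := by
  cases h with
  | @loop r B B' h p q =>
    rw [hD.loopMap_symm h]
    exact .loop h.symm p q
  | @edge r B₁ B₂ B' h p q =>
    have p' := p.trans (.swap B₂ B₁ r)
    have n := (hl.perm p').nodup
    have := edge (D := D) h.symm p' q
    have e : permHom D.blockObj p' = permHom D.blockObj p ≫ exchange _ _ _ := by
      rw [← permHom_swap (X := D.blockObj) B₁ B₂ (.swap _ _ _) n]
      exact (permHom_trans _ _ n).symm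
    rw [e] at this
    convert this using 1
    rw [hD.edgeMap_symm h, comp_whiskerRight]
    simp [exchange]

variable (D) in
/-- The gluings of `{a, a'}` and of `{b, b'}` commute on the blocks `l`. -/
def GluingsCommute (a a' b b' : F) (l : List (Block F V)) : Prop :=
  ∃ (l₁ l₂ l₃ : List (Block F V)) (φ₁ : D.stageObj l ⟶ D.stageObj l₁)
    (ψ₁ : D.stageObj l₁ ⟶ D.stageObj l₃) (φ₂ : D.stageObj l ⟶ D.stageObj l₂)
    (ψ₂ : D.stageObj l₂ ⟶ D.stageObj l₃),
    D.Contracts a a' l l₁ φ₁ ∧ D.Contracts b b' l₁ l₃ ψ₁ ∧ D.Contracts b b' l l₂ φ₂ ∧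
      D.Contracts a a' l₂ l₃ ψ₂ ∧ φ₁ ≫ ψ₁ = φ₂ ≫ ψ₂

namespace GluingsCommute

variable {a a' b b' : F} {l m : List (Block F V)}

theorem symm (h : D.GluingsCommute a a' b b' l) : D.GluingsCommute b b' a a' l := by
  obtain ⟨l₁, l₂, l₃, φ₁, ψ₁, φ₂, ψ₂, h₁, h₂, h₃, h₄, e⟩ := h
  exact ⟨l₂, l₁, l₃, φ₂, ψ₂, φ₁, ψ₁, h₃, h₄, h₁, h₂, e.symm⟩

theorem flip (hD : D.IsCompatible) (h : D.GluingsCommute a a' b b' l) (hl : IsStage l) :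
    D.GluingsCommute a' a b b' l := by
  obtain ⟨l₁, l₂, l₃, φ₁, ψ₁, φ₂, ψ₂, h₁, h₂, h₃, h₄, e⟩ := h
  exact ⟨l₁, l₂, l₃, φ₁, ψ₁, φ₂, ψ₂, h₁.flip hD hl, h₂, h₃, h₄.flip hD (h₃.isStage hl), e⟩

theorem flip' (hD : D.IsCompatible) (h : D.GluingsCommute a a' b b' l) (hl : IsStage l) :
    D.GluingsCommute a a' b' b l :=
  (h.symm.flip hD hl).symm

theorem perm (h : D.GluingsCommute a a' b b' l) (hl : IsStage l) (p : m.Perm l) :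
    D.GluingsCommute a a' b b' m := by
  obtain ⟨l₁, l₂, l₃, φ₁, ψ₁, φ₂, ψ₂, h₁, h₂, h₃, h₄, e⟩ := h
  exact ⟨l₁, l₂, l₃, _, ψ₁, _, ψ₂, h₁.perm_left hl p, h₂, h₃.perm_left hl p, h₄, by
    simp only [Category.assoc, e]⟩

/-- Two loops at the same block: the condition `loop_loop`. -/
theorem of_loop_loop_same (hD : D.IsCompatible) {r : List (Block F V)} {X : Block F V}
    (hl : IsStage (X :: r)) (ha : a ∈ X.S) (ha' : a' ∈ X.S) (hb : b ∈ X.S) (hb' : b' ∈ X.S)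
    (h₁ : a ≠ a') (h₂ : b ≠ b') (h₃ : a ≠ b) (h₄ : a ≠ b') (h₅ : a' ≠ b) (h₆ : a' ≠ b') :
    D.GluingsCommute a a' b b' (X :: r) := by
  obtain ⟨Y₁, k₁⟩ := Block.IsLoop.exists_of_mem h₁ ha ha'
  obtain ⟨Y₂, k₂⟩ := Block.IsLoop.exists_of_mem h₂ hb hb'
  obtain ⟨Z, k₃⟩ := Block.IsLoop.exists_of_mem (B := Y₁) h₂
    ((k₁.mem_S _).2 ⟨hb, h₃.symm, h₅.symm⟩) ((k₁.mem_S _).2 ⟨hb', h₄.symm, h₆.symm⟩)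
  -- The block `Z` is constructed by one order of gluing, and has the genus, flags and vertices that
  -- the other order produces.
  have k₄ : Block.IsLoop a a' Y₂ Z := ⟨h₁, (k₂.mem_S _).2 ⟨ha, h₃, h₄⟩,
    (k₂.mem_S _).2 ⟨ha', h₅, h₆⟩, by rw [← k₂.g_eq, ← k₃.g_eq, ← k₁.g_eq], fun x => by
      rw [k₂.mem_S, k₃.mem_S, k₁.mem_S]; tauto, by rw [k₃.A_eq, k₁.A_eq, k₂.A_eq]⟩
  refine ⟨_, _, _, _, _, _, _, .head_loop k₁ hl, .head_loop k₃ (hl.loop k₁), .head_loop k₂ hl,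
    .head_loop k₄ (hl.loop k₂), ?_⟩
  rw [← comp_whiskerRight, ← comp_whiskerRight, hD.loopMap_loopMap k₁ k₃ k₂ k₄]

/-- A loop at one end of an edge: the condition `loop_edge`. -/
theorem of_edge_loop (hD : D.IsCompatible) {r : List (Block F V)} {X Y : Block F V}
    (hl : IsStage (X :: Y :: r)) (ha : a ∈ X.S) (ha' : a' ∈ X.S) (hb : b ∈ X.S) (hb' : b' ∈ Y.S)
    (h₁ : a ≠ a') (h₃ : a ≠ b) (h₅ : a' ≠ b) :
    D.GluingsCommute a a' b b' (X :: Y :: r) := by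
  have hd := ((IsStage.cons_iff.1 hl).1 Y List.mem_cons_self).1
  have h₄ : a ≠ b' := fun e => Set.disjoint_left.1 hd ha (e ▸ hb')
  have h₆ : a' ≠ b' := fun e => Set.disjoint_left.1 hd ha' (e ▸ hb')
  obtain ⟨X', k₁⟩ := Block.IsLoop.exists_of_mem h₁ ha ha'
  obtain ⟨W, k₂⟩ := Block.IsEdge.exists_of_mem hd hb hb'
  obtain ⟨Z, k₃⟩ := Block.IsLoop.exists_of_mem (B := W) h₁
    ((k₂.mem_S _).2 ⟨Or.inl ha, h₃, h₄⟩) ((k₂.mem_S _).2 ⟨Or.inl ha', h₅, h₆⟩)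
  have hs : ∀ x, x ∈ Y.S → x ≠ a ∧ x ≠ a' := fun x hx =>
    ⟨fun e => Set.disjoint_left.1 hd ha (e ▸ hx), fun e => Set.disjoint_left.1 hd ha' (e ▸ hx)⟩
  have k₄ : Block.IsEdge b b' X' Y Z := ⟨hd.mono_left fun x hx => ((k₁.mem_S x).1 hx).1,
    (k₁.mem_S _).2 ⟨hb, h₃.symm, h₅.symm⟩, hb', by rw [← k₁.g_eq, ← k₃.g_eq, ← k₂.g_eq]; omega,
    fun x => by rw [k₃.mem_S, k₂.mem_S, k₁.mem_S]; have := hs x; tauto,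
    by rw [k₃.A_eq, k₁.A_eq, k₂.A_eq]⟩
  refine ⟨_, _, _, _, _, _, _, .head_loop k₁ hl, .head_edge k₄ (hl.loop k₁), .head_edge k₂ hl,
    .head_loop k₃ (hl.edge k₂), ?_⟩
  rw [Category.assoc, ← comp_whiskerRight, hD.edgeMap_loopMap k₂ k₃ k₁ k₄]
  simp

/-- Two parallel edges: whichever is glued first, the other becomes a loop. This is the condition
`edge_loop`. -/
theorem of_edge_edge_same (hD : D.IsCompatible) {r : List (Block F V)} {X Y : Block F V}
    (hl : IsStage (X :: Y :: r)) (ha : a ∈ X.S) (ha' : a' ∈ Y.S) (hb : b ∈ X.S) (hb' : b' ∈ Y.S)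
    (h₃ : a ≠ b) (h₆ : a' ≠ b') :
    D.GluingsCommute a a' b b' (X :: Y :: r) := by
  have hd := ((IsStage.cons_iff.1 hl).1 Y List.mem_cons_self).1
  have hs : ∀ {x y}, x ∈ X.S → y ∈ Y.S → x ≠ y := fun hx hy e =>
    Set.disjoint_left.1 hd hx (e ▸ hy)
  obtain ⟨W₁, k₁⟩ := Block.IsEdge.exists_of_mem hd ha ha'
  obtain ⟨W₂, k₂⟩ := Block.IsEdge.exists_of_mem hd hb hb'
  obtain ⟨Z, k₃⟩ := Block.IsLoop.exists_of_mem (B := W₁) (hs hb hb')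
    ((k₁.mem_S _).2 ⟨Or.inl hb, h₃.symm, hs hb ha'⟩)
    ((k₁.mem_S _).2 ⟨Or.inr hb', (hs ha hb').symm, h₆.symm⟩)
  have k₄ : Block.IsLoop a a' W₂ Z := ⟨hs ha ha', (k₂.mem_S _).2 ⟨Or.inl ha, h₃, hs ha hb'⟩,
    (k₂.mem_S _).2 ⟨Or.inr ha', (hs hb ha').symm, h₆⟩, by rw [← k₂.g_eq, ← k₃.g_eq, ← k₁.g_eq],
    fun x => by rw [k₃.mem_S, k₂.mem_S, k₁.mem_S]; tauto, by rw [k₃.A_eq, k₁.A_eq, k₂.A_eq]⟩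
  refine ⟨_, _, _, _, _, _, _, .head_edge k₁ hl, .head_loop k₃ (hl.edge k₁), .head_edge k₂ hl,
    .head_loop k₄ (hl.edge k₂), ?_⟩
  rw [Category.assoc, Category.assoc, ← comp_whiskerRight, ← comp_whiskerRight,
    hD.edgeMap_loopMap' k₁ k₃ k₂ k₄]

/-- A chain of two edges through `Y`: the condition `edge_edge`. -/
theorem of_edge_edge (hD : D.IsCompatible) {r : List (Block F V)} {X Y Z : Block F V}
    (hl : IsStage (X :: Y :: Z :: r)) (ha : a ∈ X.S) (ha' : a' ∈ Y.S) (hb : b ∈ Y.S)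
    (hb' : b' ∈ Z.S) (h : a' ≠ b) :
    D.GluingsCommute a a' b b' (X :: Y :: Z :: r) := by
  obtain ⟨hX, -, hl'⟩ := IsStage.cons_iff.1 hl
  obtain ⟨hY, -, -⟩ := IsStage.cons_iff.1 hl'
  have hXY := (hX Y List.mem_cons_self).1
  have hXZ := (hX Z (List.mem_cons_of_mem _ List.mem_cons_self)).1
  have hYZ := (hY Z List.mem_cons_self).1
  have sXY : ∀ {x y}, x ∈ X.S → y ∈ Y.S → x ≠ y := fun hx hy e =>
    Set.disjoint_left.1 hXY hx (e ▸ hy)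
  have sXZ : ∀ {x y}, x ∈ X.S → y ∈ Z.S → x ≠ y := fun hx hy e =>
    Set.disjoint_left.1 hXZ hx (e ▸ hy)
  have sYZ : ∀ {x y}, x ∈ Y.S → y ∈ Z.S → x ≠ y := fun hx hy e =>
    Set.disjoint_left.1 hYZ hx (e ▸ hy)
  obtain ⟨W₂, k₁⟩ := Block.IsEdge.exists_of_mem hXY ha ha'
  obtain ⟨W₁, k₂⟩ := Block.IsEdge.exists_of_mem hYZ hb hb'
  have d₂ : Disjoint W₂.S Z.S := (Disjoint.sup_left hXZ hYZ).mono_left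
    fun x hx => ((k₁.mem_S x).1 hx).1
  have d₁ : Disjoint X.S W₁.S := (Disjoint.sup_right hXY hXZ).mono_right
    fun x hx => ((k₂.mem_S x).1 hx).1
  obtain ⟨U, k₃⟩ := Block.IsEdge.exists_of_mem d₂
    ((k₁.mem_S _).2 ⟨Or.inr hb, (sXY ha hb).symm, h.symm⟩) hb'
  have k₄ : Block.IsEdge a a' X W₁ U := ⟨d₁, ha, (k₂.mem_S _).2 ⟨Or.inl ha', h, sYZ ha' hb'⟩,
    by rw [← k₂.g_eq, ← k₃.g_eq, ← k₁.g_eq, Nat.add_assoc], fun x => by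
      rw [k₃.mem_S, k₂.mem_S, k₁.mem_S]
      have h1 : x ∈ X.S → x ≠ b ∧ x ≠ b' := fun hx => ⟨sXY hx hb, sXZ hx hb'⟩
      have h2 : x ∈ Z.S → x ≠ a ∧ x ≠ a' := fun hx => ⟨(sXZ ha hx).symm, (sYZ ha' hx).symm⟩
      tauto, by rw [k₃.A_eq, k₁.A_eq, k₂.A_eq, Set.union_assoc]⟩
  -- Gluing `Y` and `Z` takes place behind the idle block `X`.
  have c₂ := (Contracts.head_edge (D := D) k₂ hl')
  refine ⟨_, _, _, _, _, _, _, .head_edge k₁ hl, .head_edge k₃ (hl.edge k₁), c₂.cons X hl,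
    .head_edge k₄ (c₂.isStage_cons hl), ?_⟩
  have e := hD.edgeMap_edgeMap k₂ k₄ k₁ k₃
  have e' := congrArg (fun f => f ▷ D.stageObj r) e
  simp only [comp_whiskerRight] at e'
  calc
    _ = 𝟙 _ ⊗≫ ((α_ (D.blockObj X) (D.blockObj Y) (D.blockObj Z)).inv ▷ D.stageObj r ≫
          D.edgeMap k₁ ▷ D.blockObj Z ▷ D.stageObj r ≫ D.edgeMap k₃ ▷ D.stageObj r) := by
        monoidal
    _ = _ := by rw [← e']; monoidal

/-- Gluings at disjoint sets of blocks commute. -/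
theorem of_cons (X : Block F V) {X' : Block F V} {r r' : List (Block F V)}
    {f : D.blockObj X ⟶ D.blockObj X'}
    (hf : ∀ s, IsStage (X :: s) → D.Contracts a a' (X :: s) (X' :: s) (f ▷ D.stageObj s))
    {φ : D.stageObj r ⟶ D.stageObj r'} (hφ : D.Contracts b b' r r' φ) (hl : IsStage (X :: r)) :
    D.GluingsCommute a a' b b' (X :: r) :=
  ⟨_, _, _, _, _, _, _, hf r hl, hφ.cons X' ((hf r hl).isStage hl), hφ.cons X hl,
    hf r' (hφ.isStage_cons hl), (whisker_exchange _ _).symm⟩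

/-- The interchange law again, now with two blocks in front that are merged to one. -/
theorem of_cons_cons {X Y X' : Block F V} {r r' : List (Block F V)}
    (h : Block.IsEdge a a' X Y X')
    {φ : D.stageObj r ⟶ D.stageObj r'} (hφ : D.Contracts b b' r r' φ)
    (hl : IsStage (X :: Y :: r)) :
    D.GluingsCommute a a' b b' (X :: Y :: r) := by
  have c := hφ.cons Y hl.of_cons
  refine ⟨_, _, _, _, _, _, _, .head_edge h hl, hφ.cons X' (hl.edge h), c.cons X hl,
    .head_edge h (c.isStage_cons hl), ?_⟩
  rw [Category.assoc, ← whisker_exchange, associator_inv_naturality_right_assoc]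

theorem of_edge_edge' (hD : D.IsCompatible) (hl : IsStage l) {X Y Z : Block F V} (hX : X ∈ l)
    (hY : Y ∈ l) (hZ : Z ∈ l) (hXY : X ≠ Y) (hXZ : X ≠ Z) (hYZ : Y ≠ Z) (ha : a ∈ X.S)
    (ha' : a' ∈ Y.S) (hb : b ∈ Y.S) (hb' : b' ∈ Z.S) (h : a' ≠ b) :
    D.GluingsCommute a a' b b' l := by
  classical
  have p₁ := List.perm_cons_erase hX
  have hY' := (List.mem_erase_of_ne hXY.symm).2 hY
  have p₂ := List.perm_cons_erase hY'
  have hZ' := (List.mem_erase_of_ne hYZ.symm).2 ((List.mem_erase_of_ne hXZ.symm).2 hZ)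
  have p₃ := List.perm_cons_erase hZ'
  have p := p₁.trans ((p₂.trans (p₃.cons Y)).cons X)
  exact (of_edge_edge hD (hl.perm p) ha ha' hb hb' h).perm (hl.perm p) p

/-- The position of the second pair relative to `X` decides: both flags in `X` give two loops,
exactly one gives a loop and an edge, and if neither is in `X` the gluings involve disjoint sets of
blocks. -/
theorem of_loop (hD : D.IsCompatible) (hl : IsStage l) {X : Block F V} (hX : X ∈ l)
    (ha : a ∈ X.S) (ha' : a' ∈ X.S) {Y Z : Block F V} (hY : Y ∈ l) (hZ : Z ∈ l) (hb : b ∈ Y.S)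
    (hb' : b' ∈ Z.S)
    (h₁ : a ≠ a') (h₂ : b ≠ b') (h₃ : a ≠ b) (h₄ : a ≠ b') (h₅ : a' ≠ b) (h₆ : a' ≠ b') :
    D.GluingsCommute a a' b b' l := by
  classical
  have p := List.perm_cons_erase hX
  have hp := hl.perm p
  by_cases hXY : X = Y
  · subst hXY
    by_cases hXZ : X = Z
    · subst hXZ
      exact (of_loop_loop_same hD hp ha ha' hb hb' h₁ h₂ h₃ h₄ h₅ h₆).perm hp p
    · have p' := p.trans ((List.perm_cons_erase ((List.mem_erase_of_ne (Ne.symm hXZ)).2 hZ)).cons X)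
      have hp' := hl.perm p'
      exact (of_edge_loop hD hp' ha ha' hb hb' h₁ h₃ h₅).perm hp' p'
  · have hY' := (List.mem_erase_of_ne (Ne.symm hXY)).2 hY
    by_cases hXZ : X = Z
    · subst hXZ
      have p' := p.trans ((List.perm_cons_erase hY').cons X)
      have hp' := hl.perm p'
      exact ((of_edge_loop hD hp' ha ha' hb' hb h₁ h₄ h₆).flip' hD hp').perm hp' p'
    · have hZ' := (List.mem_erase_of_ne (Ne.symm hXZ)).2 hZ
      obtain ⟨r', φ, hφ⟩ := Contracts.exists_of_mem (D := D) hp.of_cons h₂ hY' hb hZ' hb'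
      obtain ⟨X', k⟩ := Block.IsLoop.exists_of_mem h₁ ha ha'
      exact (of_cons X (fun s hs => .head_loop k hs) hφ hp).perm hp p

/-- The gluings of two disjoint pairs of flags commute. -/
theorem of_mem (hD : D.IsCompatible) (hl : IsStage l) {X X' Y Y' : Block F V} (hX : X ∈ l)
    (ha : a ∈ X.S) (hX' : X' ∈ l) (ha' : a' ∈ X'.S) (hY : Y ∈ l) (hb : b ∈ Y.S) (hY' : Y' ∈ l)
    (hb' : b' ∈ Y'.S)
    (h₁ : a ≠ a') (h₂ : b ≠ b') (h₃ : a ≠ b) (h₄ : a ≠ b') (h₅ : a' ≠ b) (h₆ : a' ≠ b') :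
    D.GluingsCommute a a' b b' l := by
  classical
  by_cases hXX : X = X'
  · subst hXX
    exact of_loop hD hl hX ha ha' hY hY' hb hb' h₁ h₂ h₃ h₄ h₅ h₆
  by_cases hYY : Y = Y'
  · subst hYY
    exact (of_loop hD hl hY hb hb' hX hX' ha ha' h₂ h₁ h₃.symm h₅.symm h₄.symm h₆.symm).symm
  have p := (List.perm_cons_erase hX).trans
    ((List.perm_cons_erase ((List.mem_erase_of_ne (Ne.symm hXX)).2 hX')).cons X)
  have hp := hl.perm p
  -- Now both pairs join two distinct blocks. Two common blocks give parallel edges, one common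
  -- block gives a chain through it, and no common block leaves the interchange law. The flips bring
  -- the pairs into the position required by the lemmas.
  by_cases e₁ : X = Y
  · subst e₁
    by_cases e₂ : X' = Y'
    · subst e₂
      exact (of_edge_edge_same hD hp ha ha' hb hb' h₃ h₆).perm hp p
    · exact (of_edge_edge' hD hl hX' hX hY' (Ne.symm hXX) e₂ hYY ha' ha hb hb' h₃).flip hD hl
  by_cases e₂ : X = Y'
  · subst e₂
    by_cases e₃ : X' = Y
    · subst e₃
      exact ((of_edge_edge_same hD hp ha ha' hb' hb h₄ h₅).flip' hD hp).perm hp p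
    · exact ((of_edge_edge' hD hl hX' hX hY (Ne.symm hXX) e₃ e₁ ha' ha hb' hb h₄).flip hD
        hl).flip' hD hl
  by_cases e₃ : X' = Y
  · subst e₃
    exact of_edge_edge' hD hl hX hX' hY' hXX e₂ hYY ha ha' hb hb' h₅
  by_cases e₄ : X' = Y'
  · subst e₄
    exact (of_edge_edge' hD hl hX hX' hY hXX e₁ e₃ ha ha' hb' hb h₆).flip' hD hl
  have mem : ∀ {Z}, Z ∈ l → X ≠ Z → X' ≠ Z → Z ∈ (l.erase X).erase X' := fun hZ h h' =>
    (List.mem_erase_of_ne (Ne.symm h')).2 ((List.mem_erase_of_ne (Ne.symm h)).2 hZ)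
  obtain ⟨r', φ, hφ⟩ := Contracts.exists_of_mem (D := D) hp.of_cons.of_cons h₂
    (mem hY e₁ e₃) hb (mem hY' e₂ e₄) hb'
  obtain ⟨Z, k⟩ := Block.IsEdge.exists_of_mem (hl.disjoint hX hX' hXX).1 ha ha'
  exact (of_cons_cons k hφ hp).perm hp p

end GluingsCommute

end GluingData

end

/-! ### Gluing along a list of edges -/

section

open SymmetricCategory

variable {F V : Type u}

namespace GluingData

variable {C : Type w} [Category.{v} C] [MonoidalCategory C] [SymmetricCategory C]
variable {D : GluingData.{u} C}

namespace Contracts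

variable {a a' b b' : F} {l l' m n : List (Block F V)} {φ : D.stageObj l ⟶ D.stageObj l'}

theorem ne (h : D.Contracts a a' l l' φ) : a ≠ a' := by
  cases h with
  | loop h p q => exact h.ne
  | edge h p q => exact h.ne

theorem left_mem (h : D.Contracts a a' l l' φ) : ∃ B ∈ l, a ∈ B.S := by
  cases h with
  | loop h p q => exact ⟨_, p.mem_iff.2 List.mem_cons_self, h.left⟩
  | edge h p q => exact ⟨_, p.mem_iff.2 List.mem_cons_self, h.left⟩

theorem right_mem (h : D.Contracts a a' l l' φ) : ∃ B ∈ l, a' ∈ B.S := by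
  cases h with
  | loop h p q => exact ⟨_, p.mem_iff.2 List.mem_cons_self, h.right⟩
  | edge h p q =>
    exact ⟨_, p.mem_iff.2 (List.mem_cons_of_mem _ List.mem_cons_self), h.right⟩

theorem mem_of_mem (h : D.Contracts a a' l l' φ) (hl : IsStage l) {x : F} {B : Block F V}
    (hB : B ∈ l') (hx : x ∈ B.S) : (∃ B ∈ l, x ∈ B.S) ∧ x ≠ a ∧ x ≠ a' := by
  cases h with
  | @loop r X X' h p q =>
    have hX := p.mem_iff.2 List.mem_cons_self
    rcases List.mem_cons.1 (q.mem_iff.2 hB) with rfl | hB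
    · rw [h.mem_S] at hx
      exact ⟨⟨X, hX, hx.1⟩, hx.2⟩
    · refine ⟨⟨B, p.mem_iff.2 (List.mem_cons_of_mem _ hB), hx⟩, ?_⟩
      have hd := ((IsStage.cons_iff.1 (hl.perm p)).1 B hB).1
      exact ⟨fun e => Set.disjoint_left.1 hd h.left (e ▸ hx),
        fun e => Set.disjoint_left.1 hd h.right (e ▸ hx)⟩
  | @edge r X Y X' h p q =>
    have hX := p.mem_iff.2 List.mem_cons_self
    have hY := p.mem_iff.2 (List.mem_cons_of_mem _ List.mem_cons_self)
    rcases List.mem_cons.1 (q.mem_iff.2 hB) with rfl | hB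
    · rw [h.mem_S] at hx
      exact ⟨hx.1.elim (fun hx => ⟨X, hX, hx⟩) (fun hx => ⟨Y, hY, hx⟩), hx.2⟩
    · refine ⟨⟨B, p.mem_iff.2 (List.mem_cons_of_mem _ (List.mem_cons_of_mem _ hB)), hx⟩, ?_⟩
      obtain ⟨h1, -, h2⟩ := IsStage.cons_iff.1 (hl.perm p)
      have hd := (h1 B (List.mem_cons_of_mem _ hB)).1
      have hd' := ((IsStage.cons_iff.1 h2).1 B hB).1
      exact ⟨fun e => Set.disjoint_left.1 hd h.left (e ▸ hx),
        fun e => Set.disjoint_left.1 hd' h.right (e ▸ hx)⟩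

/-- Commutation provides some commuting square starting at `l`; by uniqueness of gluings up to
permutation, one of its sides agrees with the given path, and the permutations are absorbed at the
ends. -/
theorem swap (hD : D.IsCompatible) {χ : D.stageObj l ⟶ D.stageObj m}
    {ψ : D.stageObj m ⟶ D.stageObj n} (h : D.Contracts a a' l m χ) (h' : D.Contracts b b' m n ψ)
    (hl : IsStage l) :
    ∃ (m' : List (Block F V)) (χ' : D.stageObj l ⟶ D.stageObj m')
      (ψ' : D.stageObj m' ⟶ D.stageObj n),
      D.Contracts b b' l m' χ' ∧ D.Contracts a a' m' n ψ' ∧ χ' ≫ ψ' = χ ≫ ψ := by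
  obtain ⟨X, hX, ha⟩ := h.left_mem
  obtain ⟨X', hX', ha'⟩ := h.right_mem
  obtain ⟨Y, hY, hb⟩ := h'.left_mem
  obtain ⟨Y', hY', hb'⟩ := h'.right_mem
  -- Flags present after the first gluing were present before and differ from `a` and `a'`; so the
  -- second pair can be glued first.
  obtain ⟨⟨Z, hZ, hbZ⟩, h1, h2⟩ := h.mem_of_mem hl hY hb
  obtain ⟨⟨Z', hZ', hbZ'⟩, h3, h4⟩ := h.mem_of_mem hl hY' hb'
  obtain ⟨l₁, l₂, l₃, φ₁, ψ₁, φ₂, ψ₂, k₁, k₂, k₃, k₄, e⟩ := GluingsCommute.of_mem hD hl hX ha hX'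
    ha' hZ hbZ hZ' hbZ' h.ne h'.ne h1.symm h3.symm h2.symm h4.symm
  obtain ⟨p, rfl⟩ := k₁.unique h hl
  have hm := h.isStage hl
  obtain ⟨q, hq⟩ := k₂.unique (h'.perm_left hm p) (k₁.isStage hl)
  have hm' := k₃.isStage hl
  refine ⟨l₂, φ₂, ψ₂ ≫ permHom D.blockObj q, k₃, k₄.perm_right hm' q, ?_⟩
  rw [← reassoc_of% e, Category.assoc, hq]

end Contracts

variable (D) in
/-- `D.Runs es l l' φ` says that the blocks `l'` are obtained, up to a permutation, from `l` by
successively gluing the pairs of flags in `es`, and that `φ` is the corresponding morphism. -/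
def Runs : List (Sym2 F) → ∀ l l' : List (Block F V), (D.stageObj l ⟶ D.stageObj l') → Prop
  | [], l, l', φ => ∃ p : l.Perm l', φ = permHom D.blockObj p
  | e :: es, l, l', φ => ∃ (a a' : F) (m : List (Block F V)) (χ : D.stageObj l ⟶ D.stageObj m)
      (ψ : D.stageObj m ⟶ D.stageObj l'),
      e = s(a, a') ∧ D.Contracts a a' l m χ ∧ Runs es m l' ψ ∧ φ = χ ≫ ψ

namespace Runs

variable {es es' : List (Sym2 F)} {l l' m n : List (Block F V)} {φ : D.stageObj l ⟶ D.stageObj l'}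

theorem isStage (h : D.Runs es l l' φ) (hl : IsStage l) : IsStage l' := by
  induction es generalizing l with
  | nil =>
    obtain ⟨p, -⟩ := h
    exact hl.perm p
  | cons e es ih =>
    obtain ⟨a, a', m, χ, ψ, rfl, h₁, h₂, -⟩ := h
    exact ih h₂ (h₁.isStage hl)

theorem perm_left (h : D.Runs es l l' φ) (hl : IsStage l) (p : m.Perm l) :
    D.Runs es m l' (permHom D.blockObj p ≫ φ) := by
  cases es with
  | nil =>
    obtain ⟨q, rfl⟩ := h
    exact ⟨p.trans q, permHom_trans _ _ (hl.perm q).nodup⟩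
  | cons e es =>
    obtain ⟨a, a', m, χ, ψ, rfl, h₁, h₂, rfl⟩ := h
    exact ⟨a, a', m, _, ψ, rfl, h₁.perm_left hl p, h₂, (Category.assoc _ _ _).symm⟩

theorem perm_right (h : D.Runs es l l' φ) (hl : IsStage l) (p : l'.Perm m) :
    D.Runs es l m (φ ≫ permHom D.blockObj p) := by
  induction es generalizing l with
  | nil =>
    obtain ⟨q, rfl⟩ := h
    exact ⟨q.trans p, permHom_trans _ _ (hl.perm (q.trans p)).nodup⟩
  | cons e es ih =>
    obtain ⟨a, a', m, χ, ψ, rfl, h₁, h₂, rfl⟩ := h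
    exact ⟨a, a', m, χ, _, rfl, h₁, ih h₂ (h₁.isStage hl), Category.assoc _ _ _⟩

theorem refl (hl : IsStage l) : D.Runs [] l l (𝟙 _) :=
  ⟨.refl l, (permHom_refl hl.nodup _).symm⟩

/-- Each step is unique up to a permutation, which is carried over to the rest of the run. -/
theorem unique_perm (hD : D.IsCompatible) {ψ : D.stageObj l ⟶ D.stageObj m}
    (h : D.Runs es l l' φ) (h' : D.Runs es l m ψ) (hl : IsStage l) :
    ∃ p : l'.Perm m, ψ = φ ≫ permHom D.blockObj p := by
  induction es generalizing l with
  | nil =>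
    obtain ⟨p, rfl⟩ := h
    obtain ⟨q, rfl⟩ := h'
    exact ⟨p.symm.trans q, (permHom_trans p _ (hl.perm q).nodup).symm⟩
  | cons e es ih =>
    obtain ⟨a, a', n, χ, ψ, rfl, h₁, h₂, rfl⟩ := h
    obtain ⟨b, b', n', χ', ψ', e, h₁', h₂', rfl⟩ := h'
    -- The two runs may read the unordered pair in opposite orders.
    replace h₁' : D.Contracts a a' l n' χ' := by
      rcases Sym2.eq_iff.1 e with ⟨rfl, rfl⟩ | ⟨rfl, rfl⟩
      exacts [h₁', h₁'.flip hD hl]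
    obtain ⟨p, rfl⟩ := h₁.unique h₁' hl
    obtain ⟨q, hq⟩ := ih h₂ (h₂'.perm_left (h₁'.isStage hl) p) (h₁.isStage hl)
    exact ⟨q, by rw [Category.assoc, Category.assoc, hq]⟩

/-- The permutation left over is one of a list without duplicates to itself, hence acts as the
identity. -/
theorem unique (hD : D.IsCompatible) {ψ : D.stageObj l ⟶ D.stageObj l'}
    (h : D.Runs es l l' φ) (h' : D.Runs es l l' ψ) (hl : IsStage l) : φ = ψ := by
  obtain ⟨p, rfl⟩ := h.unique_perm hD h' hl
  rw [permHom_refl (h.isStage hl).nodup, Category.comp_id]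

theorem append {ψ : D.stageObj l' ⟶ D.stageObj m} (h : D.Runs es l l' φ)
    (h' : D.Runs es' l' m ψ) (hl : IsStage l) : D.Runs (es ++ es') l m (φ ≫ ψ) := by
  induction es generalizing l with
  | nil =>
    obtain ⟨p, rfl⟩ := h
    exact h'.perm_left (hl.perm p) p
  | cons e es ih =>
    obtain ⟨a, a', n, χ, ψ, rfl, h₁, h₂, rfl⟩ := h
    exact ⟨a, a', n, χ, _, rfl, h₁, ih h₂ (h₁.isStage hl), Category.assoc _ _ _⟩

/-- The order of the gluings does not matter. -/
theorem of_perm (hD : D.IsCompatible) (h : D.Runs es l l' φ) (hl : IsStage l)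
    (p : es.Perm es') : D.Runs es' l l' φ := by
  induction p generalizing l with
  | nil => exact h
  | cons e p ih =>
    obtain ⟨a, a', n, χ, ψ, rfl, h₁, h₂, rfl⟩ := h
    exact ⟨a, a', n, χ, _, rfl, h₁, ih h₂ (h₁.isStage hl), rfl⟩
  | swap e e' es =>
    obtain ⟨a, a', n, χ, -, rfl, h₁, ⟨b, b', n', χ', ψ, rfl, h₂, h₃, rfl⟩, rfl⟩ := h
    obtain ⟨k, χ₁, ψ₁, k₁, k₂, hk⟩ := h₁.swap hD h₂ hl
    refine ⟨b, b', k, χ₁, ψ₁ ≫ ψ, rfl, k₁, ⟨a, a', n', ψ₁, ψ, rfl, k₂, h₃, rfl⟩, ?_⟩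
    rw [reassoc_of% hk]
  | trans _ _ ih ih' => exact ih' (ih h hl) hl

end Runs

/-! ### Concatenation -/

namespace Contracts

variable {a a' : F} {l l' : List (Block F V)} {φ : D.stageObj l ⟶ D.stageObj l'}

theorem isStage_append (h : D.Contracts a a' l l' φ) {n : List (Block F V)}
    (hl : IsStage (l ++ n)) : IsStage (l' ++ n) := by
  cases h with
  | @loop r B B' h p q =>
    exact IsStage.perm (IsStage.loop (l := r ++ n) (hl.perm (p.append_right n)) h)
      (q.append_right n)
  | @edge r B₁ B₂ B' h p q =>
    exact IsStage.perm (IsStage.edge (l := r ++ n) (hl.perm (p.append_right n)) h)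
      (q.append_right n)

theorem append_right (h : D.Contracts a a' l l' φ) (n : List (Block F V))
    (hl : IsStage (l ++ n)) :
    D.Contracts a a' (l ++ n) (l' ++ n) ((appendIso D.blockObj l n).inv ≫ φ ▷ D.stageObj n ≫
      (appendIso D.blockObj l' n).hom) := by
  have hl' := h.isStage_append hl
  cases h with
  | @loop r B B' h p q =>
    have hp := hl.perm (p.append_right n)
    have := loop (D := D) (r := r ++ n) h (p.append_right n) (q.append_right n)
    convert this using 1
    have e1 := permHom_append_right (X := D.blockObj) n p (p.append_right n) hp.nodup
    have e2 := permHom_append_right (X := D.blockObj) n q (q.append_right n) hl'.nodup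
    simp only [appendIso_cons_hom] at e1 e2
    rw [Iso.inv_comp_eq, reassoc_of% e1, comp_whiskerRight, comp_whiskerRight, Category.assoc,
      Category.assoc, ← e2]
    simp only [Category.assoc]
    rw [whisker_exchange_assoc, associator_naturality_left_assoc]
  | @edge r B₁ B₂ B' h p q =>
    have hp := hl.perm (p.append_right n)
    have := edge (D := D) (r := r ++ n) h (p.append_right n) (q.append_right n)
    convert this using 1
    have e1 := permHom_append_right (X := D.blockObj) n p (p.append_right n) hp.nodup
    have e2 := permHom_append_right (X := D.blockObj) n q (q.append_right n) hl'.nodup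
    simp only [appendIso_cons_hom] at e1 e2
    rw [Iso.inv_comp_eq, reassoc_of% e1, comp_whiskerRight, comp_whiskerRight, comp_whiskerRight,
      Category.assoc, Category.assoc, Category.assoc, ← e2]
    simp only [Category.assoc, MonoidalCategory.whiskerLeft_comp]
    rw [associator_inv_naturality_right_assoc, whisker_exchange_assoc,
      associator_naturality_left_assoc]
    simp

theorem append_left (h : D.Contracts a a' l l' φ) (n : List (Block F V))
    (hl : IsStage (n ++ l)) :
    IsStage (n ++ l') ∧
      D.Contracts a a' (n ++ l) (n ++ l') ((appendIso D.blockObj n l).inv ≫ D.stageObj n ◁ φ ≫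
        (appendIso D.blockObj n l').hom) := by
  induction n with
  | nil =>
    refine ⟨h.isStage hl, ?_⟩
    have e : (appendIso D.blockObj [] l).inv ≫ D.stageObj [] ◁ φ ≫
        (appendIso D.blockObj [] l').hom = φ := by
      rw [Iso.inv_comp_eq]
      exact leftUnitor_naturality φ
    exact (congrArg (D.Contracts a a' l l') e).mpr h
  | cons X n ih =>
    have ⟨h1, h2⟩ := ih hl.of_cons
    refine ⟨h2.isStage_cons hl, ?_⟩
    have e : (appendIso D.blockObj (X :: n) l).inv ≫ D.stageObj (X :: n) ◁ φ ≫
        (appendIso D.blockObj (X :: n) l').hom = D.blockObj X ◁ ((appendIso D.blockObj n l).inv ≫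
          D.stageObj n ◁ φ ≫ (appendIso D.blockObj n l').hom) := by
      rw [Iso.inv_comp_eq]
      simp only [appendIso_cons_hom, tensorList]
      simp
    exact e ▸ h2.cons X hl

end Contracts

namespace Runs

variable {es es' : List (Sym2 F)} {l l' m m' : List (Block F V)}
  {φ : D.stageObj l ⟶ D.stageObj l'} {ψ : D.stageObj m ⟶ D.stageObj m'}

theorem append_right (h : D.Runs es l l' φ) (n : List (Block F V)) (hl : IsStage (l ++ n)) :
    IsStage (l' ++ n) ∧ D.Runs es (l ++ n) (l' ++ n) ((appendIso D.blockObj l n).inv ≫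
      φ ▷ D.stageObj n ≫ (appendIso D.blockObj l' n).hom) := by
  induction es generalizing l with
  | nil =>
    obtain ⟨p, rfl⟩ := h
    refine ⟨hl.perm (p.append_right n), p.append_right n, ?_⟩
    rw [Iso.inv_comp_eq]
    exact (permHom_append_right (X := D.blockObj) n p _ (hl.perm (p.append_right n)).nodup).symm
  | cons e es ih =>
    obtain ⟨a, a', k, χ, ψ, rfl, h₁, h₂, rfl⟩ := h
    obtain ⟨h3, h4⟩ := ih h₂ (h₁.isStage_append hl)
    exact ⟨h3, a, a', _, _, _, rfl, h₁.append_right n hl, h4, by simp⟩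

theorem append_left (h : D.Runs es l l' φ) (n : List (Block F V)) (hl : IsStage (n ++ l)) :
    IsStage (n ++ l') ∧ D.Runs es (n ++ l) (n ++ l') ((appendIso D.blockObj n l).inv ≫
      D.stageObj n ◁ φ ≫ (appendIso D.blockObj n l').hom) := by
  induction es generalizing l with
  | nil =>
    obtain ⟨p, rfl⟩ := h
    refine ⟨hl.perm (p.append_left n), p.append_left n, ?_⟩
    rw [Iso.inv_comp_eq]
    exact (permHom_append_left (X := D.blockObj) n p _ (hl.perm (p.append_left n)).nodup).symm
  | cons e es ih =>
    obtain ⟨a, a', k, χ, ψ, rfl, h₁, h₂, rfl⟩ := h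
    obtain ⟨h0, h1⟩ := h₁.append_left n hl
    obtain ⟨h3, h4⟩ := ih h₂ h0
    exact ⟨h3, a, a', _, _, _, rfl, h1, h4, by simp⟩

/-- By `tensorHom_def` the tensor product is performed in two stages, with one of the two lists idle
in each. -/
theorem tensor (h : D.Runs es l l' φ) (h' : D.Runs es' m m' ψ) (hl : IsStage (l ++ m)) :
    D.Runs (es ++ es') (l ++ m) (l' ++ m') ((appendIso D.blockObj l m).inv ≫ (φ ⊗ₘ ψ) ≫
      (appendIso D.blockObj l' m').hom) := by
  obtain ⟨h1, h2⟩ := h.append_right m hl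
  obtain ⟨h3, h4⟩ := h'.append_left l' h1
  have := h2.append h4 hl
  simpa [MonoidalCategory.tensorHom_def] using this

end Runs

end GluingData

end

/-! ### Relabeling lists of blocks -/

section

open SymmetricCategory

/-- A way to transport blocks: an injective map of flags, and a map of sets of vertices. -/
@[ext]
structure BlockMap (F V F' V' : Type u) where
  f : F → F'
  A : Set V → Set V'
  injective : Function.Injective f
  union : ∀ s t, A (s ∪ t) = A s ∪ A t
  disjoint : ∀ s t, Disjoint s t → Disjoint (A s) (A t)
  nonempty : ∀ s, s.Nonempty → (A s).Nonempty

variable {F V F' V' F'' V'' : Type u}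

namespace BlockMap

/-- The image of a block. -/
def push (s : BlockMap F V F' V') (B : Block F V) : Block F' V' where
  g := B.g
  S := s.f '' B.S
  A := s.A B.A
  finite_S := by
    have := B.finite_S
    infer_instance
  stable := by
    rw [Nat.card_image_of_injective s.injective]
    exact B.stable

theorem isImage (s : BlockMap F V F' V') (B : Block F V) : Block.IsImage s.f B (s.push B) :=
  ⟨s.injective, rfl, rfl⟩

/-- The composition of two ways to transport blocks. -/
def comp (s : BlockMap F V F' V') (t : BlockMap F' V' F'' V'') : BlockMap F V F'' V'' where
  f := t.f ∘ s.f
  A := t.A ∘ s.A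
  injective := t.injective.comp s.injective
  union x y := by simp [s.union, t.union]
  disjoint x y h := t.disjoint _ _ (s.disjoint _ _ h)
  nonempty x h := t.nonempty _ (s.nonempty _ h)

/-- The sets of flags agree only by `Set.image_comp`, not definitionally. So lists pushed in one or
two stages are compared through permutations below. -/
theorem push_comp (s : BlockMap F V F' V') (t : BlockMap F' V' F'' V'') (B : Block F V) :
    (s.comp t).push B = t.push (s.push B) :=
  Block.ext rfl (Set.image_comp t.f s.f B.S) rfl

theorem map_push_comp (s : BlockMap F V F' V') (t : BlockMap F' V' F'' V'')
    (l : List (Block F V)) : l.map (s.comp t).push = (l.map s.push).map t.push := by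
  rw [List.map_map]
  exact List.map_congr_left fun B _ => s.push_comp t B

theorem isLoop (s : BlockMap F V F' V') {a a' : F} {B B' : Block F V}
    (h : Block.IsLoop a a' B B') : Block.IsLoop (s.f a) (s.f a') (s.push B) (s.push B') where
  ne := s.injective.ne h.ne
  left := Set.mem_image_of_mem _ h.left
  right := Set.mem_image_of_mem _ h.right
  g_eq := h.g_eq
  A_eq := congrArg s.A h.A_eq
  mem_S x := by
    constructor
    · rintro ⟨y, hy, rfl⟩
      obtain ⟨h1, h2, h3⟩ := (h.mem_S y).1 hy
      exact ⟨⟨y, h1, rfl⟩, s.injective.ne h2, s.injective.ne h3⟩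
    · rintro ⟨⟨y, hy, rfl⟩, h1, h2⟩
      exact ⟨y, (h.mem_S y).2 ⟨hy, fun e => h1 (e ▸ rfl), fun e => h2 (e ▸ rfl)⟩, rfl⟩

theorem isEdge (s : BlockMap F V F' V') {a a' : F} {B₁ B₂ B' : Block F V}
    (h : Block.IsEdge a a' B₁ B₂ B') :
    Block.IsEdge (s.f a) (s.f a') (s.push B₁) (s.push B₂) (s.push B') where
  disj := (Set.disjoint_image_iff s.injective).2 h.disj
  left := Set.mem_image_of_mem _ h.left
  right := Set.mem_image_of_mem _ h.right
  g_eq := h.g_eq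
  A_eq := (congrArg s.A h.A_eq).trans (s.union _ _)
  mem_S x := by
    constructor
    · rintro ⟨y, hy, rfl⟩
      obtain ⟨h1, h2, h3⟩ := (h.mem_S y).1 hy
      exact ⟨h1.imp (⟨y, ·, rfl⟩) (⟨y, ·, rfl⟩), s.injective.ne h2, s.injective.ne h3⟩
    · rintro ⟨⟨y, hy, rfl⟩ | ⟨y, hy, rfl⟩, h1, h2⟩
      · exact ⟨y, (h.mem_S y).2 ⟨Or.inl hy, fun e => h1 (e ▸ rfl), fun e => h2 (e ▸ rfl)⟩, rfl⟩
      · exact ⟨y, (h.mem_S y).2 ⟨Or.inr hy, fun e => h1 (e ▸ rfl), fun e => h2 (e ▸ rfl)⟩, rfl⟩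

theorem isStage (s : BlockMap F V F' V') {l : List (Block F V)} (h : IsStage l) :
    IsStage (l.map s.push) := by
  refine ⟨List.pairwise_map.2 (h.pairwise.imp fun hB =>
    ⟨(Set.disjoint_image_iff s.injective).2 hB.1, s.disjoint _ _ hB.2⟩), fun B hB => ?_⟩
  obtain ⟨B, hB', rfl⟩ := List.mem_map.1 hB
  exact s.nonempty _ (h.nonempty B hB')

end BlockMap

namespace GluingData

variable {C : Type w} [Category.{v} C] [MonoidalCategory C] [SymmetricCategory C]
variable (D : GluingData.{u} C)

/-- The identification of the object of a list of blocks with the object of the transported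
list. -/
noncomputable def pushIso (s : BlockMap F V F' V') :
    ∀ l : List (Block F V), D.stageObj l ≅ D.stageObj (l.map s.push)
  | [] => Iso.refl _
  | B :: l => D.imageIso (s.isImage B) ⊗ᵢ pushIso s l

variable {D}

omit [SymmetricCategory C] in
theorem pushIso_cons_hom (s : BlockMap F V F' V') (B : Block F V) (l : List (Block F V)) :
    (D.pushIso s (B :: l)).hom = (D.imageIso (s.isImage B)).hom ⊗ₘ (D.pushIso s l).hom := rfl

theorem pushIso_naturality (s : BlockMap F V F' V') {l l' : List (Block F V)} (p : l.Perm l')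
    (hl : IsStage l) (q : (l.map s.push).Perm (l'.map s.push)) :
    permHom D.blockObj p ≫ (D.pushIso s l').hom =
      (D.pushIso s l).hom ≫ permHom D.blockObj q := by
  induction p with
  | nil =>
    rw [permHom_refl .nil, permHom_refl .nil]
    exact (Category.id_comp _).trans (Category.comp_id _).symm
  | @cons B l l' p ih =>
    have hl' := hl.perm (p.cons B)
    have q' := p.map s.push
    have h1 : permHom D.blockObj q = _ ◁ permHom D.blockObj q' :=
      permHom_cons (X := D.blockObj) (s.push B) q' q (s.isStage hl').nodup
    rw [h1, permHom_cons (X := D.blockObj) B p _ hl'.nodup, pushIso_cons_hom, pushIso_cons_hom,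
      whiskerLeft_comp_tensorHom, ih hl.of_cons q']
    exact (tensorHom_comp_whiskerLeft ..).symm
  | swap B B' l =>
    have hl' := hl.perm (.swap B B' l)
    have h1 : permHom D.blockObj q = exchange _ _ _ :=
      permHom_swap (X := D.blockObj) (s.push B') (s.push B) q (s.isStage hl').nodup
    rw [h1, permHom_swap (X := D.blockObj) B' B _ hl'.nodup]
    exact (exchange_naturality _ _ _).symm
  | @trans l l' l'' p p' ih ih' =>
    have hl' := hl.perm p
    have hl'' := hl'.perm p'
    rw [← permHom_trans p p' hl''.nodup, Category.assoc, ih' hl' (p'.map s.push),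
      reassoc_of% (ih hl (p.map s.push)), permHom_trans _ _ (s.isStage hl'').nodup]

theorem pushIso_append (s : BlockMap F V F' V') (l m : List (Block F V))
    (q : (l.map s.push ++ m.map s.push).Perm ((l ++ m).map s.push)) (hl : IsStage (l ++ m)) :
    ((D.pushIso s l).hom ⊗ₘ (D.pushIso s m).hom) ≫ (appendIso D.blockObj _ _).hom ≫
        permHom D.blockObj q =
      (appendIso D.blockObj l m).hom ≫ (D.pushIso s (l ++ m)).hom := by
  induction l with
  | nil =>
    have h1 : permHom D.blockObj q = 𝟙 _ := permHom_refl (X := D.blockObj) (s.isStage hl).nodup _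
    rw [h1]
    exact (whisker_eq _ (Category.comp_id _)).trans
      ((eq_whisker (id_tensorHom _ _) _).trans (leftUnitor_naturality (D.pushIso s m).hom))
  | cons B l ih =>
    have q' : (l.map s.push ++ m.map s.push).Perm ((l ++ m).map s.push) := by
      rw [List.map_append]
    have h1 : permHom D.blockObj q = _ ◁ permHom D.blockObj q' :=
      permHom_cons (X := D.blockObj) (s.push B) q' q (s.isStage hl).nodup
    have h2 : (D.pushIso s (B :: l ++ m)).hom = _ := pushIso_cons_hom s B (l ++ m)
    have h3 := ih q' hl.of_cons
    have h4 : (appendIso D.blockObj ((B :: l).map s.push) (m.map s.push)).hom = _ :=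
      appendIso_cons_hom (s.push B) (l.map s.push) (m.map s.push)
    rw [h1, h2, h4, appendIso_cons_hom, pushIso_cons_hom, Category.assoc, Category.assoc,
      whiskerLeft_comp_tensorHom, ← h3, ← MonoidalCategory.whiskerLeft_comp]
    exact (associator_naturality_assoc _ _ _ _).trans
      (whisker_eq _ (tensorHom_comp_whiskerLeft ..))

omit [SymmetricCategory C] in
theorem imageIso_eqToHom {f : F → F'} {B : Block F V} {B₁ B₂ : Block F' V'} (h : B₁ = B₂)
    (k₁ : Block.IsImage f B B₁) (k₂ : Block.IsImage f B B₂) :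
    (D.imageIso k₁).hom ≫ eqToHom (congrArg D.blockObj h) = (D.imageIso k₂).hom := by
  subst h
  simp

/-- Block by block this is `imageIso_trans`, followed by the cast along `push_comp` that
`permHom_cons_of_eq` extracts from `q`. -/
theorem pushIso_comp (hD : D.IsCompatible) (s : BlockMap F V F' V') (t : BlockMap F' V' F'' V'')
    (l : List (Block F V)) (hl : IsStage l)
    (q : ((l.map s.push).map t.push).Perm (l.map (s.comp t).push)) :
    (D.pushIso s l).hom ≫ (D.pushIso t (l.map s.push)).hom ≫ permHom D.blockObj q =
      (D.pushIso (s.comp t) l).hom := by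
  induction l with
  | nil =>
    have h1 : permHom D.blockObj q = 𝟙 _ := permHom_refl .nil _
    rw [h1]
    exact (Category.id_comp _).trans (Category.id_comp _)
  | cons B l ih =>
    have q' := List.Perm.of_eq (s.map_push_comp t l).symm
    have h1 : permHom D.blockObj q = eqToHom _ ⊗ₘ permHom D.blockObj q' :=
      permHom_cons_of_eq (X := D.blockObj) (s.push_comp t B).symm q' q
        ((s.comp t).isStage hl).nodup
    have h2 := hD.imageIso_trans (s.isImage B) (t.isImage (s.push B))
      (f'' := (s.comp t).f) (B'' := t.push (s.push B))
      (by rw [← s.push_comp]; exact (s.comp t).isImage B) (fun _ => rfl)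
    have h3 := imageIso_eqToHom (D := D) (s.push_comp t B).symm
      (by rw [← s.push_comp]; exact (s.comp t).isImage B) ((s.comp t).isImage B)
    have h4 : (D.pushIso t ((B :: l).map s.push)).hom = _ :=
      pushIso_cons_hom t (s.push B) (l.map s.push)
    rw [h1, h4, pushIso_cons_hom, pushIso_cons_hom, ← ih hl.of_cons q', ← h3, ← h2]
    refine (whisker_eq _ (tensorHom_comp_tensorHom ..)).trans ?_
    refine (tensorHom_comp_tensorHom ..).trans ?_
    rw [Category.assoc]

end GluingData

end

/-! ### Gluing and relabeling -/

section

open SymmetricCategory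

variable {F V F' V' F'' V'' : Type u}

namespace GluingData

variable {C : Type w} [Category.{v} C] [MonoidalCategory C] [SymmetricCategory C]
variable {D : GluingData.{u} C}

theorem Contracts.push (hD : D.IsCompatible) (s : BlockMap F V F' V') {a a' : F}
    {l l' : List (Block F V)} {φ : D.stageObj l ⟶ D.stageObj l'} (h : D.Contracts a a' l l' φ)
    (hl : IsStage l) :
    D.Contracts (s.f a) (s.f a') (l.map s.push) (l'.map s.push)
      ((D.pushIso s l).inv ≫ φ ≫ (D.pushIso s l').hom) := by
  cases h with
  | @loop r B B' h p q =>
    have hp := hl.perm p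
    have e1 := pushIso_naturality (D := D) s p hl (p.map s.push)
    have e2 := pushIso_naturality (D := D) s q (hp.loop h) (q.map s.push)
    have e3 := hD.loopMap_imageIso rfl rfl h (s.isLoop h) (s.isImage B) (s.isImage B')
    have := loop (D := D) (r := r.map s.push) (s.isLoop h) (p.map s.push) (q.map s.push)
    convert this using 1
    rw [Iso.inv_comp_eq, ← reassoc_of% e1, Category.assoc, Category.assoc, e2]
    refine whisker_eq _ ?_
    rw [pushIso_cons_hom, pushIso_cons_hom, whiskerRight_comp_tensorHom_assoc, e3,
      tensorHom_comp_whiskerRight_assoc]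
  | @edge r B₁ B₂ B' h p q =>
    have hp := hl.perm p
    have e1 := pushIso_naturality (D := D) s p hl (p.map s.push)
    have e2 := pushIso_naturality (D := D) s q (hp.edge h) (q.map s.push)
    have e3 := hD.edgeMap_imageIso rfl rfl h (s.isEdge h) (s.isImage B₁) (s.isImage B₂)
      (s.isImage B')
    have := edge (D := D) (r := r.map s.push) (s.isEdge h) (p.map s.push) (q.map s.push)
    convert this using 1
    rw [Iso.inv_comp_eq, ← reassoc_of% e1, Category.assoc, Category.assoc, Category.assoc, e2]
    refine whisker_eq _ ?_
    rw [pushIso_cons_hom, pushIso_cons_hom, pushIso_cons_hom,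
      whiskerRight_comp_tensorHom_assoc, e3, associator_inv_naturality_assoc,
      tensorHom_comp_whiskerRight_assoc]

theorem Runs.push (hD : D.IsCompatible) (s : BlockMap F V F' V') {es : List (Sym2 F)}
    {l l' : List (Block F V)} {φ : D.stageObj l ⟶ D.stageObj l'} (h : D.Runs es l l' φ)
    (hl : IsStage l) :
    D.Runs (es.map (Sym2.map s.f)) (l.map s.push) (l'.map s.push)
      ((D.pushIso s l).inv ≫ φ ≫ (D.pushIso s l').hom) := by
  induction es generalizing l with
  | nil =>
    obtain ⟨p, rfl⟩ := h
    refine ⟨p.map s.push, ?_⟩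
    rw [Iso.inv_comp_eq]
    exact pushIso_naturality s p hl _
  | cons e es ih =>
    obtain ⟨a, a', m, χ, ψ, rfl, h₁, h₂, rfl⟩ := h
    exact ⟨s.f a, s.f a', _, _, _, rfl, h₁.push hD s hl, ih h₂ (h₁.isStage hl), by simp⟩

/-- The identification of the object of a list of blocks with the object of a permutation of the
transported list. -/
noncomputable def transport (D : GluingData.{u} C) (s : BlockMap F V F' V') {l : List (Block F V)}
    {m : List (Block F' V')} (p : (l.map s.push).Perm m) : D.stageObj l ⟶ D.stageObj m :=
  (D.pushIso s l).hom ≫ permHom D.blockObj p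

theorem isIso_transport (s : BlockMap F V F' V') {l : List (Block F V)} {m : List (Block F' V')}
    (p : (l.map s.push).Perm m) (hl : IsStage l) : IsIso (D.transport s p) := by
  have : IsIso (permHom D.blockObj p) :=
    (permIso (X := D.blockObj) p (s.isStage hl).nodup).isIso_hom
  exact IsIso.comp_isIso

theorem permHom_transport (s : BlockMap F V F' V') {l l' : List (Block F V)}
    {m : List (Block F' V')} (p : l.Perm l') (q : (l'.map s.push).Perm m) (hl : IsStage l) :
    permHom D.blockObj p ≫ D.transport s q = D.transport s ((p.map s.push).trans q) := by
  rw [transport, ← Category.assoc, pushIso_naturality s p hl (p.map s.push), Category.assoc,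
    permHom_trans _ _ ((s.isStage (hl.perm p)).perm q).nodup, transport]

theorem transport_permHom (s : BlockMap F V F' V') {l : List (Block F V)}
    {m m' : List (Block F' V')} (p : (l.map s.push).Perm m) (q : m.Perm m') (hl : IsStage l) :
    D.transport s p ≫ permHom D.blockObj q = D.transport s (p.trans q) := by
  rw [transport, Category.assoc, permHom_trans _ _ (((s.isStage hl).perm p).perm q).nodup,
    transport]

/-- The permutations are arbitrary, since the lists have no duplicates. The composite enters through
the equation `hr`, so that different factorizations of one `BlockMap` can be compared. -/
theorem transport_transport (hD : D.IsCompatible) (s : BlockMap F V F' V')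
    (t : BlockMap F' V' F'' V'') (r : BlockMap F V F'' V'') (hr : s.comp t = r)
    {l : List (Block F V)} {m : List (Block F' V')} {n : List (Block F'' V'')}
    (p : (l.map s.push).Perm m) (q : (m.map t.push).Perm n) (k : (l.map r.push).Perm n)
    (hl : IsStage l) : D.transport s p ≫ D.transport t q = D.transport r k := by
  subst hr
  have e1 := permHom_transport (D := D) t p q (s.isStage hl)
  have hn := (((s.comp t).isStage hl).perm k).nodup
  have k' := List.Perm.of_eq (s.map_push_comp t l).symm
  rw [transport, Category.assoc, e1, transport, transport, ← pushIso_comp hD s t l hl k',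
    Category.assoc, Category.assoc, permHom_trans _ _ hn]

theorem transport_eq_comp (hD : D.IsCompatible) (s : BlockMap F V F' V')
    (t : BlockMap F' V' F'' V'') (r : BlockMap F V F'' V'') (hr : s.comp t = r)
    {l : List (Block F V)} (p : (l.map r.push).Perm ((l.map s.push).map t.push)) (hl : IsStage l) :
    D.transport r p = (D.pushIso s l).hom ≫ (D.pushIso t (l.map s.push)).hom := by
  subst hr
  have hn := (t.isStage (s.isStage hl)).nodup
  rw [transport, ← pushIso_comp hD s t l hl p.symm, Category.assoc, Category.assoc,
    permHom_trans _ _ hn, permHom_refl hn, Category.comp_id]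

/-- The identification of a tensor product of the objects of two lists of blocks with the object of
a permutation of the concatenation of the transported lists. -/
noncomputable def join (D : GluingData.{u} C) (s : BlockMap F V F'' V'')
    (t : BlockMap F' V' F'' V'') {l : List (Block F V)} {m : List (Block F' V')}
    {n : List (Block F'' V'')} (p : (l.map s.push ++ m.map t.push).Perm n) :
    D.stageObj l ⊗ D.stageObj m ⟶ D.stageObj n :=
  ((D.pushIso s l).hom ⊗ₘ (D.pushIso t m).hom) ≫ (appendIso D.blockObj _ _).hom ≫
    permHom D.blockObj p

end GluingData

end

/-! ### Joining lists of blocks -/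

section

open SymmetricCategory

variable {F V F' V' F'' V'' G W G' W' G'' W'' : Type u}

namespace CategoryTheory.SymmetricCategory

variable {C : Type w} [Category.{v} C] [MonoidalCategory C] [SymmetricCategory C] {B : Type*}
variable {X : B → C}

theorem permHom_append {l l' m m' : List B} (p : l.Perm l') (q : m.Perm m')
    (r : (l ++ m).Perm (l' ++ m')) (hl : (l' ++ m').Nodup) :
    (permHom X p ⊗ₘ permHom X q) ≫ (appendIso X l' m').hom =
      (appendIso X l m).hom ≫ permHom X r := by
  have h := (q.append_left l').nodup_iff.2 hl
  rw [MonoidalCategory.tensorHom_def, Category.assoc,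
    ← permHom_append_left l' q (q.append_left l') hl,
    ← Category.assoc, ← permHom_append_right m p (p.append_right m) h, Category.assoc,
    permHom_trans _ _ hl]

end CategoryTheory.SymmetricCategory

namespace GluingData

variable {C : Type w} [Category.{v} C] [MonoidalCategory C] [SymmetricCategory C]
variable {D : GluingData.{u} C}

theorem isIso_join (s : BlockMap F V F'' V'') (t : BlockMap F' V' F'' V'') {l : List (Block F V)}
    {m : List (Block F' V')} {n : List (Block F'' V'')}
    (p : (l.map s.push ++ m.map t.push).Perm n) (hn : IsStage n) : IsIso (D.join s t p) := by
  have : IsIso (permHom D.blockObj p) :=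
    (permIso (X := D.blockObj) p (hn.perm p.symm).nodup).isIso_hom
  have : IsIso ((D.pushIso s l).hom ⊗ₘ (D.pushIso t m).hom) :=
    (D.pushIso s l ⊗ᵢ D.pushIso t m).isIso_hom
  unfold join
  infer_instance

theorem join_permHom (s : BlockMap F V F'' V'') (t : BlockMap F' V' F'' V'')
    {l : List (Block F V)} {m : List (Block F' V')} {n n' : List (Block F'' V'')}
    (p : (l.map s.push ++ m.map t.push).Perm n) (q : n.Perm n') (hn : IsStage n) :
    D.join s t p ≫ permHom D.blockObj q = D.join s t (p.trans q) := by
  rw [join, Category.assoc, Category.assoc, permHom_trans _ _ (hn.perm q).nodup, join]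

theorem permHom_join (s : BlockMap F V F'' V'') (t : BlockMap F' V' F'' V'')
    {l l' : List (Block F V)} {m m' : List (Block F' V')} {n : List (Block F'' V'')}
    (p : l.Perm l') (q : m.Perm m') (r : (l'.map s.push ++ m'.map t.push).Perm n)
    (k : (l.map s.push ++ m.map t.push).Perm n) (hl : IsStage l) (hm : IsStage m)
    (hn : IsStage n) :
    (permHom D.blockObj p ⊗ₘ permHom D.blockObj q) ≫ D.join s t r = D.join s t k := by
  have hn' := (hn.perm r.symm).nodup
  have e := permHom_append (X := D.blockObj) (p.map s.push) (q.map t.push)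
    ((p.map s.push).append (q.map t.push)) hn'
  rw [join, ← Category.assoc, tensorHom_comp_tensorHom, pushIso_naturality s p hl (p.map s.push),
    pushIso_naturality t q hm (q.map t.push), ← tensorHom_comp_tensorHom, Category.assoc,
    reassoc_of% e, permHom_trans _ _ hn.nodup, join]

theorem join_pushIso (hD : D.IsCompatible) (s : BlockMap F V F' V') (t : BlockMap G W F' V')
    (u : BlockMap F' V' F'' V'') {l : List (Block F V)} {m : List (Block G W)}
    {n : List (Block F' V')} (p : (l.map s.push ++ m.map t.push).Perm n)
    (k : (l.map (s.comp u).push ++ m.map (t.comp u).push).Perm (n.map u.push))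
    (hl : IsStage l) (hm : IsStage m) (hn : IsStage n) :
    D.join s t p ≫ (D.pushIso u n).hom = D.join (s.comp u) (t.comp u) k := by
  have k₁ := List.Perm.of_eq (s.map_push_comp u l).symm
  have k₂ := List.Perm.of_eq (t.map_push_comp u m).symm
  have hn₁ := hn.perm p.symm
  have hn₂ := u.isStage hn₁
  have hn₃ := (u.isStage hn).nodup
  have k₃ : ((l.map s.push).map u.push ++ (m.map t.push).map u.push).Perm
      ((l.map s.push ++ m.map t.push).map u.push) := by rw [List.map_append]
  have e := pushIso_append (D := D) u (l.map s.push) (m.map t.push) k₃ hn₁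
  have e' := permHom_append (X := D.blockObj) k₁ k₂ (k₁.append k₂)
    (((u.isStage hn).perm k.symm).nodup)
  rw [join, Category.assoc, Category.assoc, pushIso_naturality u p hn₁ (p.map u.push),
    ← reassoc_of% e, permHom_trans _ _ hn₃, ← Category.assoc, tensorHom_comp_tensorHom,
    join, ← pushIso_comp hD s u l hl k₁, ← pushIso_comp hD t u m hm k₂,
    ← Category.assoc (D.pushIso s l).hom,
    ← Category.assoc (D.pushIso t m).hom, ← tensorHom_comp_tensorHom _ _ (permHom _ _),
    Category.assoc, reassoc_of% e', permHom_trans _ _ hn₃]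

theorem join_transport (hD : D.IsCompatible) (s : BlockMap F V F' V') (t : BlockMap G W F' V')
    (u : BlockMap F' V' F'' V'') (s' : BlockMap F V F'' V'') (t' : BlockMap G W F'' V'')
    (hs : s.comp u = s') (ht : t.comp u = t') {l : List (Block F V)} {m : List (Block G W)}
    {n : List (Block F' V')} {n' : List (Block F'' V'')}
    (p : (l.map s.push ++ m.map t.push).Perm n) (q : (n.map u.push).Perm n')
    (k : (l.map s'.push ++ m.map t'.push).Perm n')
    (hl : IsStage l) (hm : IsStage m) (hn : IsStage n) :
    D.join s t p ≫ D.transport u q = D.join s' t' k := by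
  subst hs ht
  rw [transport, ← Category.assoc, join_pushIso hD s t u p (k.trans q.symm) hl hm hn,
    join_permHom _ _ _ _ (u.isStage hn)]

theorem transport_join (hD : D.IsCompatible) (s : BlockMap F V F' V') (t : BlockMap G W G' W')
    (u : BlockMap F' V' F'' V'') (w : BlockMap G' W' F'' V'') (u' : BlockMap F V F'' V'')
    (w' : BlockMap G W F'' V'') (hu : s.comp u = u') (hw : t.comp w = w')
    {l : List (Block F V)} {m : List (Block G W)} {l' : List (Block F' V')}
    {m' : List (Block G' W')} {n : List (Block F'' V'')} (p : (l.map s.push).Perm l')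
    (q : (m.map t.push).Perm m') (r : (l'.map u.push ++ m'.map w.push).Perm n)
    (k : (l.map u'.push ++ m.map w'.push).Perm n)
    (hl : IsStage l) (hm : IsStage m) (hn : IsStage n) :
    (D.transport s p ⊗ₘ D.transport t q) ≫ D.join u w r = D.join u' w' k := by
  subst hu hw
  have k₁ := List.Perm.of_eq (s.map_push_comp u l).symm
  have k₂ := List.Perm.of_eq (t.map_push_comp w m).symm
  have e' := permHom_append (X := D.blockObj) k₁ k₂ (k₁.append k₂)
    ((hn.perm k.symm).nodup)
  rw [transport, transport, ← tensorHom_comp_tensorHom, Category.assoc,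
    permHom_join u w p q r (((p.map u.push).append (q.map w.push)).trans r) (s.isStage hl)
      (t.isStage hm) hn, join, ← Category.assoc, tensorHom_comp_tensorHom, join,
    ← pushIso_comp hD s u l hl k₁, ← pushIso_comp hD t w m hm k₂,
    ← Category.assoc (D.pushIso s l).hom, ← Category.assoc (D.pushIso t m).hom,
    ← tensorHom_comp_tensorHom _ _ (permHom _ _), Category.assoc, reassoc_of% e',
    permHom_trans _ _ hn.nodup]

/-- The braiding corresponds to the permutation that interchanges the concatenated lists, and such a
permutation is absorbed in the target. -/
theorem braiding_join (s : BlockMap F V F'' V'') (t : BlockMap F' V' F'' V'')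
    {l : List (Block F V)} {m : List (Block F' V')} {n : List (Block F'' V'')}
    (p : (l.map s.push ++ m.map t.push).Perm n) (q : (m.map t.push ++ l.map s.push).Perm n)
    (hn : IsStage n) : (β_ _ _).hom ≫ D.join t s q = D.join s t p := by
  have e := permHom_append_comm (X := D.blockObj) (l.map s.push) (m.map t.push)
    (p.trans q.symm) (hn.perm q.symm).nodup
  rw [join, join, ← BraidedCategory.braiding_naturality_assoc, ← reassoc_of% e,
    permHom_trans _ _ hn.nodup]

theorem nil_join (s : BlockMap F V F'' V'') (t : BlockMap F' V' F'' V'')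
    {m : List (Block F' V')} {n : List (Block F'' V'')}
    (p : (([] : List (Block F V)).map s.push ++ m.map t.push).Perm n) :
    D.join s t p = (λ_ _).hom ≫ D.transport t p := by
  rw [transport, ← leftUnitor_naturality_assoc]
  exact eq_whisker (id_tensorHom _ _) _

theorem join_nil (s : BlockMap F V F'' V'') (t : BlockMap F' V' F'' V'')
    {l : List (Block F V)} {n : List (Block F'' V'')}
    (p : (l.map s.push ++ ([] : List (Block F' V')).map t.push).Perm n)
    (q : (l.map s.push).Perm n) (hl : IsStage l) :
    D.join s t p = (ρ_ _).hom ≫ D.transport s q := by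
  have h := s.isStage hl
  have k : (l.map s.push ++ []).Perm (l.map s.push) := by rw [List.append_nil]
  have e := appendIso_nil_right (X := D.blockObj) (l.map s.push) k h.nodup
  rw [transport, ← rightUnitor_naturality_assoc, ← e, Category.assoc,
    permHom_trans _ _ (h.perm q).nodup]
  exact eq_whisker (tensorHom_id _ _) _

/-- Since a join is invertible, `θ` is determined by `φ` and `ψ` through `e`: it is the tensor
product of the two runs, pushed into common sets of flags and vertices and rearranged. -/
theorem Runs.join (hD : D.IsCompatible) (s : BlockMap F V F'' V'') (t : BlockMap F' V' F'' V'')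
    {es : List (Sym2 F)} {es' : List (Sym2 F')} {l l' : List (Block F V)}
    {m m' : List (Block F' V')} {n n' : List (Block F'' V'')} {φ : D.stageObj l ⟶ D.stageObj l'}
    {ψ : D.stageObj m ⟶ D.stageObj m'} {θ : D.stageObj n ⟶ D.stageObj n'}
    (h : D.Runs es l l' φ) (h' : D.Runs es' m m' ψ) (hl : IsStage l) (hm : IsStage m)
    (hn : IsStage n) (p : (l.map s.push ++ m.map t.push).Perm n)
    (p' : (l'.map s.push ++ m'.map t.push).Perm n')
    (e : (φ ⊗ₘ ψ) ≫ D.join s t p' = D.join s t p ≫ θ) :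
    D.Runs (es.map (Sym2.map s.f) ++ es'.map (Sym2.map t.f)) n n' θ := by
  have hn₁ := hn.perm p.symm
  have h1 := (((h.push hD s hl).tensor (h'.push hD t hm) hn₁).perm_left hn₁ p.symm).perm_right
    hn p'
  convert h1 using 1
  have : IsIso (D.join s t p) := isIso_join s t p hn
  rw [← cancel_epi (D.join s t p), ← e, GluingData.join, GluingData.join]
  have e1 : permHom D.blockObj p ≫ permHom D.blockObj p.symm = 𝟙 _ :=
    (permIso (X := D.blockObj) p hn₁.nodup).hom_inv_id
  simp only [Category.assoc]
  rw [reassoc_of% e1]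
  simp

/-- Once all three lists are pushed to the final set of flags, the two sides differ by the
associativity of concatenation, `appendIso_assoc`. The maps `u'`, `w'`, `w` are tied to composites
by equations in order to apply to the inclusions into a triple disjoint union. -/
theorem whiskerRight_join_join (hD : D.IsCompatible) (s : BlockMap F V F' V')
    (t : BlockMap G W F' V') (u : BlockMap F' V' F'' V'') (w : BlockMap G' W' F'' V'')
    (s' : BlockMap G W G'' W'') (t' : BlockMap G' W' G'' W'') (u' : BlockMap F V F'' V'')
    (w' : BlockMap G'' W'' F'' V'') (h₁ : s.comp u = u') (h₂ : t.comp u = s'.comp w')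
    (h₃ : t'.comp w' = w) {l : List (Block F V)} {m : List (Block G W)} {k : List (Block G' W')}
    {n : List (Block F' V')} {n' : List (Block G'' W'')} {N : List (Block F'' V'')}
    (p : (l.map s.push ++ m.map t.push).Perm n) (q : (n.map u.push ++ k.map w.push).Perm N)
    (p' : (m.map s'.push ++ k.map t'.push).Perm n')
    (q' : (l.map u'.push ++ n'.map w'.push).Perm N)
    (hl : IsStage l) (hm : IsStage m) (hk : IsStage k) (hn : IsStage n) (hn' : IsStage n')
    (hN : IsStage N) :
    D.join s t p ▷ _ ≫ D.join u w q = (α_ _ _ _).hom ≫ _ ◁ D.join s' t' p' ≫ D.join u' w' q' := by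
  subst h₁ h₃
  have hu := u.isStage hn
  have a₁ : (l.map (s.comp u).push ++ m.map (t.comp u).push).Perm (n.map u.push) := by
    rw [s.map_push_comp, t.map_push_comp, ← List.map_append]
    exact p.map u.push
  have a₂ : (m.map (s'.comp w').push ++ k.map (t'.comp w').push).Perm (n'.map w'.push) := by
    rw [s'.map_push_comp, t'.map_push_comp, ← List.map_append]
    exact p'.map w'.push
  -- The middle list reaches the final flags along two composites, which `h₂` identifies.
  rw [h₂] at a₁
  have e₁ := join_pushIso hD s t u p (h₂ ▸ a₁) hl hm hn
  have e₂ := join_pushIso hD s' t' w' p' a₂ hm hk hn'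
  have e₁' : D.join s t p ≫ (D.pushIso u n).hom = D.join (s.comp u) (s'.comp w') a₁ := by
    rw [e₁]; congr 1
  have b₁ := (a₁.append_right (k.map (t'.comp w').push))
  have b₂ := (a₂.append_left (l.map (s.comp u).push))
  have f₁ := permHom_append_right (X := D.blockObj) (k.map (t'.comp w').push) a₁ b₁
    (hN.perm q.symm).nodup
  have f₂ := permHom_append_left (X := D.blockObj) (l.map (s.comp u).push) a₂ b₂
    (hN.perm q'.symm).nodup
  have c := (b₁.trans q).trans (b₂.trans q').symm
  have f := appendIso_assoc (X := D.blockObj) (l.map (s.comp u).push) (m.map (s'.comp w').push)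
    (k.map (t'.comp w').push) c (hN.perm (b₂.trans q').symm).nodup
  calc
    _ = (D.join (s.comp u) (s'.comp w') a₁ ⊗ₘ (D.pushIso (t'.comp w') k).hom) ≫
        (appendIso D.blockObj _ _).hom ≫ permHom D.blockObj q := by
      rw [← e₁', ← whiskerRight_comp_tensorHom, Category.assoc]
      rfl
    _ = (((D.pushIso (s.comp u) l).hom ⊗ₘ (D.pushIso (s'.comp w') m).hom) ⊗ₘ
          (D.pushIso (t'.comp w') k).hom) ≫ (appendIso D.blockObj _ _).hom ▷ _ ≫
        (appendIso D.blockObj _ _).hom ≫ permHom D.blockObj (b₁.trans q) := by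
      rw [GluingData.join, ← tensorHom_comp_whiskerRight, comp_whiskerRight, Category.assoc,
        Category.assoc, ← reassoc_of% f₁, permHom_trans _ _ hN.nodup]
    _ = (α_ _ _ _).hom ≫ ((D.pushIso (s.comp u) l).hom ⊗ₘ (D.pushIso (s'.comp w') m).hom ⊗ₘ
          (D.pushIso (t'.comp w') k).hom) ≫ _ ◁ (appendIso D.blockObj _ _).hom ≫
        (appendIso D.blockObj _ _).hom ≫ permHom D.blockObj (b₂.trans q') := by
      rw [← associator_naturality_assoc, ← reassoc_of% f, permHom_trans _ _ hN.nodup]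
    _ = (α_ _ _ _).hom ≫ ((D.pushIso (s.comp u) l).hom ⊗ₘ D.join (s'.comp w') (t'.comp w') a₂) ≫
        (appendIso D.blockObj _ _).hom ≫ permHom D.blockObj q' := by
      rw [GluingData.join, ← tensorHom_comp_whiskerLeft, MonoidalCategory.whiskerLeft_comp,
        Category.assoc, Category.assoc, ← reassoc_of% f₂, permHom_trans _ _ hN.nodup]
    _ = _ := by
      rw [← e₂, ← whiskerLeft_comp_tensorHom, Category.assoc]
      rfl

end GluingData

end

/-! ### Vertices that are joined by gluing -/

section

open SymmetricCategory

variable {F V : Type u} {W : Type*}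

namespace Block

/-- `2 g - 2 + n` for a block of genus `g` with `n` flags. -/
noncomputable def euler (B : Block F V) : ℤ := 2 * B.g - 2 + B.S.ncard

/-- The genus goes up by one and two flags disappear. -/
theorem IsLoop.euler_eq {a a' : F} {B B' : Block F V} (h : IsLoop a a' B B') :
    B'.euler = B.euler := by
  have h1 := ncard_sdiff_pair B.finite_S h.ne h.left h.right
  have h2 : B'.S = B.S \ {a, a'} := Set.ext fun x => by simp [h.mem_S]
  rw [euler, euler, h2, ← h.g_eq]
  push_cast
  omega

/-- One term `-2` is lost in adding up, and compensated by the two flags that disappear. -/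
theorem IsEdge.euler_eq {a a' : F} {B₁ B₂ B' : Block F V} (h : IsEdge a a' B₁ B₂ B') :
    B'.euler = B₁.euler + B₂.euler := by
  have hS₁ : B₁.S.Finite := B₁.finite_S
  have hS₂ : B₂.S.Finite := B₂.finite_S
  have h1 := ncard_sdiff_pair (hS₁.union hS₂) h.ne (Or.inl h.left) (Or.inr h.right)
  have h2 : B'.S = (B₁.S ∪ B₂.S) \ {a, a'} := Set.ext fun x => by simp [h.mem_S]
  have h3 := Set.ncard_union_eq h.disj hS₁ hS₂
  rw [euler, euler, euler, h2, ← h.g_eq]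
  push_cast
  omega

end Block

/-- The blocks `l` are obtained by merging the vertices of a graph with boundary map `bdry`, within
the fibres of `p`. -/
structure IsMerged (bdry : F → V) (c : V → ℤ) (p : V → W) (l : List (Block F V)) : Prop where
  isStage : IsStage l
  bdry_mem : ∀ B ∈ l, ∀ f ∈ B.S, bdry f ∈ B.A
  euler_eq : ∀ B ∈ l, B.euler = ∑ᶠ x ∈ B.A, c x
  eq_of_mem : ∀ B ∈ l, ∀ x ∈ B.A, ∀ y ∈ B.A, p x = p y
  cover : ∀ x, ∃ B ∈ l, x ∈ B.A

namespace GluingData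

variable {C : Type w} [Category.{v} C] [MonoidalCategory C] [SymmetricCategory C]
variable {D : GluingData.{u} C}

variable {bdry : F → V} {c : V → ℤ} {p : V → W} {l l' : List (Block F V)} {a a' : F}
  {φ : D.stageObj l ⟶ D.stageObj l'}

namespace Contracts

theorem mem_iff (h : D.Contracts a a' l l' φ) (hl : IsStage l) (x : F) :
    (∃ B ∈ l', x ∈ B.S) ↔ (∃ B ∈ l, x ∈ B.S) ∧ x ≠ a ∧ x ≠ a' := by
  refine ⟨fun ⟨B, hB, hx⟩ => h.mem_of_mem hl hB hx, ?_⟩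
  rintro ⟨⟨B, hB, hx⟩, h1⟩
  cases h with
  | @loop r X X' h p q =>
    rcases List.mem_cons.1 (p.mem_iff.1 hB) with rfl | hB
    · exact ⟨X', q.mem_iff.1 List.mem_cons_self, (h.mem_S x).2 ⟨hx, h1⟩⟩
    · exact ⟨B, q.mem_iff.1 (List.mem_cons_of_mem _ hB), hx⟩
  | @edge r X Y X' h p q =>
    have hX' := q.mem_iff.1 List.mem_cons_self
    rcases List.mem_cons.1 (p.mem_iff.1 hB) with rfl | hB
    · exact ⟨X', hX', (h.mem_S x).2 ⟨Or.inl hx, h1⟩⟩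
    rcases List.mem_cons.1 hB with rfl | hB
    · exact ⟨X', hX', (h.mem_S x).2 ⟨Or.inr hx, h1⟩⟩
    · exact ⟨B, q.mem_iff.1 (List.mem_cons_of_mem _ hB), hx⟩

theorem exists_subset (h : D.Contracts a a' l l' φ) :
    ∀ B ∈ l, ∃ B' ∈ l', B.A ⊆ B'.A := by
  intro B hB
  cases h with
  | @loop r X X' h p q =>
    rcases List.mem_cons.1 (p.mem_iff.1 hB) with rfl | hB
    · exact ⟨X', q.mem_iff.1 List.mem_cons_self, h.A_eq.symm.subset⟩
    · exact ⟨B, q.mem_iff.1 (List.mem_cons_of_mem _ hB), subset_rfl⟩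
  | @edge r X Y X' h p q =>
    have hX' := q.mem_iff.1 List.mem_cons_self
    rcases List.mem_cons.1 (p.mem_iff.1 hB) with rfl | hB
    · exact ⟨X', hX', Set.subset_union_left.trans h.A_eq.symm.subset⟩
    rcases List.mem_cons.1 hB with rfl | hB
    · exact ⟨X', hX', Set.subset_union_right.trans h.A_eq.symm.subset⟩
    · exact ⟨B, q.mem_iff.1 (List.mem_cons_of_mem _ hB), subset_rfl⟩

theorem exists_bdry_mem (h : D.Contracts a a' l l' φ) (hl : IsMerged bdry c p l) :
    ∃ B ∈ l', bdry a ∈ B.A ∧ bdry a' ∈ B.A := by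
  cases h with
  | @loop r X X' h p q =>
    have hX := p.mem_iff.2 List.mem_cons_self
    refine ⟨X', q.mem_iff.1 List.mem_cons_self, ?_⟩
    rw [h.A_eq]
    exact ⟨hl.bdry_mem _ hX _ h.left, hl.bdry_mem _ hX _ h.right⟩
  | @edge r X Y X' h p q =>
    refine ⟨X', q.mem_iff.1 List.mem_cons_self, ?_⟩
    rw [h.A_eq]
    exact ⟨Or.inl (hl.bdry_mem _ (p.mem_iff.2 List.mem_cons_self) _ h.left),
      Or.inr (hl.bdry_mem _ (p.mem_iff.2 (List.mem_cons_of_mem _ List.mem_cons_self)) _ h.right)⟩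

/-- Two blocks are merged only if they contain `bdry a` and `bdry a'`, which lie in the same fibre,
so the union stays within that fibre. The Euler numbers add up because the sets of vertices are
disjoint. -/
theorem isMerged [Finite V] (h : D.Contracts a a' l l' φ) (hl : IsMerged bdry c p l)
    (hp : p (bdry a) = p (bdry a')) : IsMerged bdry c p l' := by
  have hl' := h.isStage hl.isStage
  suffices ∀ B ∈ l', (∀ f ∈ B.S, bdry f ∈ B.A) ∧ B.euler = ∑ᶠ x ∈ B.A, c x ∧
      ∀ x ∈ B.A, ∀ y ∈ B.A, p x = p y from
    ⟨hl', fun B hB => (this B hB).1, fun B hB => (this B hB).2.1, fun B hB => (this B hB).2.2,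
      fun x => by
        obtain ⟨B, hB, hx⟩ := hl.cover x
        obtain ⟨B', hB', hs⟩ := h.exists_subset B hB
        exact ⟨B', hB', hs hx⟩⟩
  intro B hB
  have old : B ∈ l → (∀ f ∈ B.S, bdry f ∈ B.A) ∧ B.euler = ∑ᶠ x ∈ B.A, c x ∧
      ∀ x ∈ B.A, ∀ y ∈ B.A, p x = p y := fun hB =>
    ⟨hl.bdry_mem B hB, hl.euler_eq B hB, hl.eq_of_mem B hB⟩
  cases h with
  | @loop r X X' h p q =>
    have hX := p.mem_iff.2 List.mem_cons_self
    rcases List.mem_cons.1 (q.mem_iff.2 hB) with rfl | hB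
    · rw [h.euler_eq, h.A_eq]
      exact ⟨fun f hf => hl.bdry_mem X hX f ((h.mem_S f).1 hf).1, hl.euler_eq X hX,
        hl.eq_of_mem X hX⟩
    · exact old (p.mem_iff.2 (List.mem_cons_of_mem _ hB))
  | @edge r X Y X' h q q' =>
    have hX := q.mem_iff.2 List.mem_cons_self
    have hY := q.mem_iff.2 (List.mem_cons_of_mem _ List.mem_cons_self)
    rcases List.mem_cons.1 (q'.mem_iff.2 hB) with rfl | hB
    · have ha := hl.bdry_mem X hX a h.left
      have ha' := hl.bdry_mem Y hY a' h.right
      have hd := ((IsStage.cons_iff.1 (hl.isStage.perm q)).1 Y List.mem_cons_self).2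
      rw [h.euler_eq, h.A_eq, finsum_mem_union hd (Set.toFinite _) (Set.toFinite _),
        hl.euler_eq X hX, hl.euler_eq Y hY]
      refine ⟨fun f hf => ((h.mem_S f).1 hf).1.imp (hl.bdry_mem X hX f) (hl.bdry_mem Y hY f),
        rfl, ?_⟩
      rintro x (hx | hx) y (hy | hy)
      · exact hl.eq_of_mem X hX x hx y hy
      · exact (hl.eq_of_mem X hX x hx _ ha).trans (hp.trans (hl.eq_of_mem Y hY _ ha' y hy))
      · exact (hl.eq_of_mem Y hY x hx _ ha').trans (hp.symm.trans (hl.eq_of_mem X hX _ ha y hy))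
      · exact hl.eq_of_mem Y hY x hx y hy
    · exact old (q.mem_iff.2 (List.mem_cons_of_mem _ (List.mem_cons_of_mem _ hB)))

end Contracts

-- As the pairs are disjoint, the flags of the later pairs survive each gluing, so the run never
-- gets stuck. The conclusion keeps track of the surviving flags and of the vertices known to lie
-- together, which suffices to identify the final blocks.
variable (D) in
theorem Runs.exists_of_isMerged [Finite V] (hl : IsMerged bdry c p l) (es : List (Sym2 F))
    (hes : es.Pairwise fun e e' => ∀ x ∈ e, x ∉ e') (hd : ∀ e ∈ es, ¬ e.IsDiag)
    (hm : ∀ e ∈ es, ∀ x ∈ e, ∃ B ∈ l, x ∈ B.S)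
    (hp : ∀ e ∈ es, ∀ x ∈ e, ∀ y ∈ e, p (bdry x) = p (bdry y)) :
    ∃ (l' : List (Block F V)) (φ : D.stageObj l ⟶ D.stageObj l'), D.Runs es l l' φ ∧
      IsMerged bdry c p l' ∧
      (∀ x, (∃ B ∈ l', x ∈ B.S) ↔ (∃ B ∈ l, x ∈ B.S) ∧ ∀ e ∈ es, x ∉ e) ∧
      (∀ B ∈ l, ∃ B' ∈ l', B.A ⊆ B'.A) ∧
      ∀ e ∈ es, ∃ B ∈ l', ∀ x ∈ e, bdry x ∈ B.A := by
  induction es generalizing l with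
  | nil => exact ⟨l, 𝟙 _, .refl hl.isStage, hl, by simp, fun B hB => ⟨B, hB, subset_rfl⟩, by simp⟩
  | cons e es ih =>
    rw [List.pairwise_cons] at hes
    obtain ⟨he, hes⟩ := hes
    rw [List.forall_mem_cons] at hd hm hp
    induction e with | _ a a'
    obtain ⟨B, hB, ha⟩ := hm.1 a (Sym2.mem_mk_left a a')
    obtain ⟨B', hB', ha'⟩ := hm.1 a' (Sym2.mem_mk_right a a')
    obtain ⟨n, χ, hχ⟩ := Contracts.exists_of_mem (D := D) hl.isStage
      (fun e => hd.1 (Sym2.mk_isDiag_iff.2 e)) hB ha hB' ha'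
    have hn := hχ.isMerged hl (hp.1 a (Sym2.mem_mk_left a a') a' (Sym2.mem_mk_right a a'))
    have hU := hχ.mem_iff hl.isStage
    obtain ⟨l', ψ, h1, h2, h3, h4, h5⟩ := ih hn hes hd.2 (fun e' he' x hx => by
      refine (hU x).2 ⟨hm.2 e' he' x hx, ?_, ?_⟩
      · rintro rfl
        exact he e' he' x (Sym2.mem_mk_left x a') hx
      · rintro rfl
        exact he e' he' x (Sym2.mem_mk_right a x) hx) hp.2
    refine ⟨l', χ ≫ ψ, ⟨a, a', n, χ, ψ, rfl, hχ, h1, rfl⟩, h2, fun x => ?_, fun X hX => ?_, ?_⟩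
    · rw [h3, hU, List.forall_mem_cons, Sym2.mem_iff, not_or, and_assoc]
    · obtain ⟨Y, hY, hXY⟩ := hχ.exists_subset X hX
      obtain ⟨Z, hZ, hYZ⟩ := h4 Y hY
      exact ⟨Z, hZ, hXY.trans hYZ⟩
    · rw [List.forall_mem_cons]
      refine ⟨?_, h5⟩
      obtain ⟨Y, hY, hYa, hYa'⟩ := hχ.exists_bdry_mem hl
      obtain ⟨Z, hZ, hYZ⟩ := h4 Y hY
      refine ⟨Z, hZ, fun x hx => ?_⟩
      rcases Sym2.mem_iff.1 hx with rfl | rfl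
      exacts [hYZ hYa, hYZ hYa']

end GluingData

end

/-! ### The blocks and the contracted edges of a graph -/

section

open SymmetricCategory

namespace StableModularGraph

/-- The block of a vertex. -/
def vertexBlock (τ : StableModularGraph.{u}) (x : τ.obj.V) : Block τ.obj.F τ.obj.V where
  g := τ.obj.genus x
  S := {f | τ.obj.bdry f = x}
  A := {x}
  finite_S := inferInstance
  stable := τ.property x

/-- The blocks of the vertices of a graph. -/
noncomputable def blocks (τ : StableModularGraph.{u}) : List (Block τ.obj.F τ.obj.V) :=
  (Finset.univ : Finset τ.obj.V).toList.map τ.vertexBlock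

theorem mem_blocks {τ : StableModularGraph.{u}} {B : Block τ.obj.F τ.obj.V} :
    B ∈ τ.blocks ↔ ∃ x, τ.vertexBlock x = B := by
  simp [blocks]

theorem isStage_blocks (τ : StableModularGraph.{u}) : IsStage τ.blocks := by
  have h (x y : τ.obj.V) (hxy : x ≠ y) : Disjoint (τ.vertexBlock x).S (τ.vertexBlock y).S ∧
      Disjoint (τ.vertexBlock x).A (τ.vertexBlock y).A :=
    ⟨Set.disjoint_left.2 fun f hx hy => hxy (hx.symm.trans hy), Set.disjoint_singleton.2 hxy⟩
  refine ⟨List.pairwise_map.2 ((Finset.nodup_toList _).imp fun {x y} => h x y), fun B hB => ?_⟩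
  obtain ⟨x, rfl⟩ := mem_blocks.1 hB
  exact Set.singleton_nonempty x

theorem isMerged_blocks (τ : StableModularGraph.{u}) {W : Type*} (p : τ.obj.V → W) :
    IsMerged τ.obj.bdry (fun x => (τ.vertexBlock x).euler) p τ.blocks where
  isStage := τ.isStage_blocks
  bdry_mem B hB f hf := by
    obtain ⟨x, rfl⟩ := mem_blocks.1 hB
    exact hf
  euler_eq B hB := by
    obtain ⟨x, rfl⟩ := mem_blocks.1 hB
    exact (finsum_mem_singleton (f := fun x => (τ.vertexBlock x).euler)).symm
  eq_of_mem B hB := by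
    obtain ⟨x, rfl⟩ := mem_blocks.1 hB
    rintro y rfl z rfl
    rfl
  cover x := ⟨τ.vertexBlock x, mem_blocks.2 ⟨x, rfl⟩, rfl⟩

variable {τ σ ρ : StableModularGraph.{u}}

/-- A morphism transports blocks from the target to the source. -/
def blockMap (h : τ ⟶ σ) : BlockMap σ.obj.F σ.obj.V τ.obj.F τ.obj.V where
  f := h.hom.flagMap
  A := Set.preimage h.hom.vertexMap
  injective := h.hom.flagMap_injective
  union _ _ := rfl
  disjoint _ _ hst := hst.preimage _
  nonempty _ hs := hs.preimage h.hom.vertexMap_surjective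

open scoped Classical in
/-- The contracted edges. -/
noncomputable def edges (h : τ ⟶ σ) : List (Sym2 τ.obj.F) :=
  ((Finset.univ.filter fun f => h.hom.pair f ≠ f).image fun f => s(f, h.hom.pair f)).toList

theorem mem_edges {h : τ ⟶ σ} {e : Sym2 τ.obj.F} :
    e ∈ edges h ↔ ∃ f, h.hom.pair f ≠ f ∧ s(f, h.hom.pair f) = e := by
  simp [edges]

theorem nodup_edges (h : τ ⟶ σ) : (edges h).Nodup := Finset.nodup_toList _

theorem eq_of_mem_edges {h : τ ⟶ σ} {e : Sym2 τ.obj.F} (he : e ∈ edges h) {f : τ.obj.F}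
    (hf : f ∈ e) : h.hom.pair f ≠ f ∧ e = s(f, h.hom.pair f) := by
  obtain ⟨a, ha, rfl⟩ := mem_edges.1 he
  rcases Sym2.mem_iff.1 hf with rfl | rfl
  · exact ⟨ha, rfl⟩
  · rw [h.hom.pair_pair]
    exact ⟨ha.symm, Sym2.eq_swap⟩

theorem edges_eq_nil {h : τ ⟶ σ} (hh : ∀ f, h.hom.pair f = f) : edges h = [] := by
  rw [List.eq_nil_iff_forall_not_mem]
  intro e he
  obtain ⟨f, hf, -⟩ := mem_edges.1 he
  exact hf (hh f)

/-- After all contracted edges are glued, a block is determined by any of its vertices: its vertices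
form a fibre of `h_V`, its flags are the uncontracted ones over that fibre, and its genus is forced
by the Euler number. -/
theorem eq_push_vertexBlock (h : τ ⟶ σ) {l : List (Block τ.obj.F τ.obj.V)}
    (hl : IsMerged τ.obj.bdry (fun x => (τ.vertexBlock x).euler) h.hom.vertexMap l)
    (h₁ : ∀ f, (∃ B ∈ l, f ∈ B.S) ↔ h.hom.pair f = f)
    (h₂ : ∀ f, h.hom.pair f ≠ f → ∃ B ∈ l, τ.obj.bdry f ∈ B.A ∧ τ.obj.bdry (h.hom.pair f) ∈ B.A)
    {B : Block τ.obj.F τ.obj.V} (hB : B ∈ l) {x : τ.obj.V} (hx : x ∈ B.A) :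
    B = (blockMap h).push (σ.vertexBlock (h.hom.vertexMap x)) := by
  classical
  -- A block stays within a fibre by `IsMerged`. Conversely, a path of contracted edges inside the
  -- fibre cannot leave the block, as both ends of each edge share a block.
  have hA : B.A = h.hom.vertexMap ⁻¹' {h.hom.vertexMap x} := by
    ext y
    refine ⟨fun hy => hl.eq_of_mem B hB y hy x hx, fun hy => ?_⟩
    have := h.hom.connected x y (Eq.symm hy)
    clear hy
    induction this with
    | refl => exact hx
    | tail _ hyz ih =>
      obtain ⟨f, hf, rfl, rfl⟩ := hyz
      obtain ⟨B', hB', hf₁, hf₂⟩ := h₂ f hf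
      rwa [hl.isStage.eq_of_mem_A hB hB' ih hf₁]
  have hS' : ∀ f, f ∈ B.S ↔ h.hom.pair f = f ∧ τ.obj.bdry f ∈ B.A := by
    intro f
    refine ⟨fun hf => ⟨(h₁ f).1 ⟨B, hB, hf⟩, hl.bdry_mem B hB f hf⟩, fun hf => ?_⟩
    obtain ⟨B', hB', hf'⟩ := (h₁ f).2 hf.1
    rwa [hl.isStage.eq_of_mem_A hB hB' hf.2 (hl.bdry_mem B' hB' f hf')]
  have hS : B.S = h.hom.flagMap '' {f | σ.obj.bdry f = h.hom.vertexMap x} := by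
    ext f
    rw [hS', hA, h.hom.pair_eq_self_iff]
    constructor
    · rintro ⟨⟨f, rfl⟩, hf⟩
      exact ⟨f, (h.hom.vertexMap_bdry f).symm.trans hf, rfl⟩
    · rintro ⟨f, hf, rfl⟩
      exact ⟨⟨f, rfl⟩, (h.hom.vertexMap_bdry f).trans hf⟩
  refine Block.ext ?_ hS hA
  change B.g = σ.obj.genus (h.hom.vertexMap x)
  -- The flags over `y` are the flags of `B` and the contracted ones. Cancelling the former from the
  -- Euler number of `B` gives `2 B.g - 2 = ∑ (2 g(z) - 2) + #{contracted flags over y}`, which is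
  -- the genus condition for `y`.
  have e₁ := hl.euler_eq B hB
  have e₂ := h.hom.genus_eq (h.hom.vertexMap x)
  generalize h.hom.vertexMap x = y at *
  have hfin : B.A = ↑(Finset.univ.filter fun x => h.hom.vertexMap x = y) := by
    rw [hA]
    ext z
    simp
  rw [hfin, finsum_mem_coe_finset] at e₁
  have e₃ : ∀ z, (τ.vertexBlock z).euler = (2 * (τ.obj.genus z : ℤ) - 2) +
      ((Finset.univ.filter fun f => τ.obj.bdry f = z).card : ℤ) := by
    intro z
    rw [← Set.ncard_coe_finset, Finset.coe_filter_univ]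
    rfl
  rw [Finset.sum_congr rfl fun z _ => e₃ z, Finset.sum_add_distrib] at e₁
  have e₄ : (Finset.univ.filter fun f => h.hom.vertexMap (τ.obj.bdry f) = y).card =
      ∑ z with h.hom.vertexMap z = y, (Finset.univ.filter fun f => τ.obj.bdry f = z).card := by
    rw [Finset.card_eq_sum_card_fiberwise (f := τ.obj.bdry)
      (t := Finset.univ.filter fun z => h.hom.vertexMap z = y) (by intro f; simp)]
    refine Finset.sum_congr rfl fun z hz => ?_
    congr 1
    ext f
    simp only [Finset.mem_filter, Finset.mem_univ, true_and] at hz ⊢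
    exact ⟨fun h => h.2, fun h => ⟨h ▸ hz, h⟩⟩
  have e₅ : B.S.ncard + (Finset.univ.filter fun f => h.hom.pair f ≠ f ∧
      h.hom.vertexMap (τ.obj.bdry f) = y).card =
        (Finset.univ.filter fun f => h.hom.vertexMap (τ.obj.bdry f) = y).card := by
    have : B.S = ↑(Finset.univ.filter fun f => h.hom.pair f = f ∧
        h.hom.vertexMap (τ.obj.bdry f) = y) := by
      ext f
      rw [hS', hA]
      simp
    rw [this, Set.ncard_coe_finset, ← Finset.card_union_of_disjoint]
    · congr 1
      ext f
      simp only [Finset.mem_union, Finset.mem_filter, Finset.mem_univ, true_and]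
      tauto
    · rw [Finset.disjoint_left]
      intro f
      simp only [Finset.mem_filter, Finset.mem_univ, true_and]
      tauto
  rw [Block.euler] at e₁
  have e₆ : (∑ z with h.hom.vertexMap z = y,
      ((Finset.univ.filter fun f => τ.obj.bdry f = z).card : ℤ)) =
      (B.S.ncard : ℤ) + (Finset.univ.filter fun f => h.hom.pair f ≠ f ∧
      h.hom.vertexMap (τ.obj.bdry f) = y).card := by
    rw [← Nat.cast_sum, ← e₄, ← e₅, Nat.cast_add]
  rw [e₆] at e₁
  have e₇ : (2 * (σ.obj.genus y : ℤ) - 2) = _ := e₂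
  suffices (B.g : ℤ) = σ.obj.genus y by exact_mod_cast this
  linarith

end StableModularGraph

namespace GluingData

open StableModularGraph

variable {C : Type w} [Category.{v} C] [MonoidalCategory C] [SymmetricCategory C]
variable (D : GluingData.{u} C) {τ σ ρ : StableModularGraph.{u}}

/-- The contracted edges are orbits of an involution without fixed points on the contracted flags,
hence disjoint pairs, and both ends of each lie over the same vertex; so they can all be glued. -/
theorem exists_runs_edges (h : τ ⟶ σ) :
    ∃ φ, D.Runs (edges h) τ.blocks (σ.blocks.map (blockMap h).push) φ := by
  have mem_bdry : ∀ f, ∃ B ∈ τ.blocks, f ∈ B.S := fun f => ⟨_, mem_blocks.2 ⟨_, rfl⟩, rfl⟩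
  obtain ⟨l, φ, h₁, h₂, h₃, -, h₄⟩ := Runs.exists_of_isMerged D
    (τ.isMerged_blocks h.hom.vertexMap) (edges h) (by
      refine (nodup_edges h).pairwise_of_forall_ne ?_
      intro e he e' he' hne x hx hx'
      exact hne ((eq_of_mem_edges he hx).2.trans (eq_of_mem_edges he' hx').2.symm))
    (fun e he hd => by
      obtain ⟨f, hf, rfl⟩ := mem_edges.1 he
      exact hf (Sym2.mk_isDiag_iff.1 hd).symm)
    (fun e he x hx => mem_bdry x)
    (fun e he x hx y hy => by
      obtain ⟨-, rfl⟩ := eq_of_mem_edges he hx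
      rcases Sym2.mem_iff.1 hy with rfl | rfl
      exacts [rfl, (h.hom.vertexMap_pair x).symm])
  have key := fun {B} hB {x} hx => eq_push_vertexBlock h h₂ (fun f => by
      rw [h₃, and_iff_right (mem_bdry f)]
      refine ⟨fun hf => ?_, fun hf e he hfe => (eq_of_mem_edges he hfe).1 hf⟩
      by_contra hne
      exact hf _ (mem_edges.2 ⟨f, hne, rfl⟩) (Sym2.mem_mk_left _ _))
    (fun f hf => by
      obtain ⟨B, hB, hf'⟩ := h₄ _ (mem_edges.2 ⟨f, hf, rfl⟩)
      exact ⟨B, hB, hf' _ (Sym2.mem_mk_left _ _), hf' _ (Sym2.mem_mk_right _ _)⟩) (B := B) hB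
    (x := x) hx
  -- Neither list has duplicates, so it suffices to compare members; surjectivity of `h_V` provides
  -- a block over every vertex of `σ`.
  have p : l.Perm (σ.blocks.map (blockMap h).push) := by
    refine (List.perm_ext_iff_of_nodup h₂.isStage.nodup
      ((blockMap h).isStage σ.isStage_blocks).nodup).2 fun B => ?_
    rw [List.mem_map]
    constructor
    · intro hB
      obtain ⟨x, hx⟩ := h₂.isStage.nonempty B hB
      exact ⟨_, mem_blocks.2 ⟨_, rfl⟩, (key hB hx).symm⟩
    · rintro ⟨B, hB, rfl⟩
      obtain ⟨y, rfl⟩ := mem_blocks.1 hB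
      obtain ⟨x, rfl⟩ := h.hom.vertexMap_surjective y
      obtain ⟨B, hB, hx⟩ := h₂.cover x
      rwa [← key hB hx]
  exact ⟨_, h₁.perm_right τ.isStage_blocks p⟩

end GluingData

end

/-! ### The functor of gluing data -/

section

open SymmetricCategory

namespace StableModularGraph

variable {τ σ ρ : StableModularGraph.{u}}

/-- A flag contracted by `h ≫ k` is either contracted by `h`, with the same partner, or the image
under `h^F` of a flag contracted by `k`, whose partner is transported. -/
theorem edges_comp (h : τ ⟶ σ) (k : σ ⟶ ρ) :
    (edges h ++ (edges k).map (Sym2.map h.hom.flagMap)).Perm (edges (h ≫ k)) := by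
  have hpair (f : σ.obj.F) : (h ≫ k).hom.pair (h.hom.flagMap f) = h.hom.flagMap (k.hom.pair f) :=
    ModularGraph.comp_pair_flagMap h.hom k.hom f
  have hpair' (f : τ.obj.F) (hf : h.hom.pair f ≠ f) : (h ≫ k).hom.pair f = h.hom.pair f :=
    ModularGraph.comp_pair_of_notMem h.hom k.hom f
      fun hf' => hf ((h.hom.pair_eq_self_iff f).2 hf')
  have hn : (edges h ++ (edges k).map (Sym2.map h.hom.flagMap)).Nodup := by
    refine (nodup_edges h).append ((nodup_edges k).map
      (Sym2.map.injective h.hom.flagMap_injective)) ?_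
    intro e he he'
    obtain ⟨e, -, rfl⟩ := List.mem_map.1 he'
    induction e with | _ a b
    exact (eq_of_mem_edges he (Sym2.mem_mk_left _ _)).1 ((h.hom.pair_eq_self_iff _).2 ⟨a, rfl⟩)
  refine (List.perm_ext_iff_of_nodup hn (nodup_edges _)).2 fun e => ?_
  simp only [List.mem_append, List.mem_map, mem_edges]
  constructor
  · rintro (⟨f, hf, rfl⟩ | ⟨-, ⟨f, hf, rfl⟩, rfl⟩)
    · exact ⟨f, by rwa [hpair' f hf], by rw [hpair' f hf]⟩
    · refine ⟨h.hom.flagMap f, ?_, ?_⟩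
      · rw [hpair]
        exact h.hom.flagMap_injective.ne hf
      · rw [hpair, Sym2.map_mk]
  · rintro ⟨f, hf, rfl⟩
    by_cases hf' : h.hom.pair f = f
    · obtain ⟨f, rfl⟩ := (h.hom.pair_eq_self_iff f).1 hf'
      rw [hpair] at hf ⊢
      exact Or.inr ⟨_, ⟨f, fun e => hf (congrArg _ e), rfl⟩, Sym2.map_mk ..⟩
    · exact Or.inl ⟨f, hf', by rw [hpair' f hf']⟩

end StableModularGraph

namespace GluingData

open StableModularGraph

variable {C : Type w} [Category.{v} C] [MonoidalCategory C] [SymmetricCategory C]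

/-- An idempotent isomorphism is the identity. -/
theorem transport_eq_id {F V : Type u} {D : GluingData.{u} C} (hD : D.IsCompatible)
    (s : BlockMap F V F V) (hs : s.comp s = s) {l : List (Block F V)} (p : (l.map s.push).Perm l)
    (hl : IsStage l) : D.transport s p = 𝟙 _ := by
  have : IsIso (D.transport s p) := isIso_transport s p hl
  rw [← cancel_epi (D.transport s p), transport_transport hD s s s hs p p p hl, Category.comp_id]

variable (D : GluingData.{u} C) {τ σ ρ : StableModularGraph.{u}}

/-- The morphism of a morphism of graphs. -/
noncomputable def graphMap (h : τ ⟶ σ) : D.stageObj τ.blocks ⟶ D.stageObj σ.blocks :=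
  (D.exists_runs_edges h).choose ≫ (D.pushIso (blockMap h) σ.blocks).inv

theorem runs_graphMap (h : τ ⟶ σ) :
    D.Runs (edges h) τ.blocks (σ.blocks.map (blockMap h).push)
      (D.graphMap h ≫ (D.pushIso (blockMap h) σ.blocks).hom) := by
  rw [graphMap, Category.assoc, Iso.inv_hom_id, Category.comp_id]
  exact (D.exists_runs_edges h).choose_spec

variable {D} (hD : D.IsCompatible)
include hD

/-- The recognition principle for `graphMap`: any order of the contracted edges and any arrangement
of the resulting blocks will do. -/
theorem graphMap_eq (h : τ ⟶ σ) {φ : D.stageObj τ.blocks ⟶ D.stageObj σ.blocks}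
    {l : List (Block τ.obj.F τ.obj.V)} (p : (σ.blocks.map (blockMap h).push).Perm l)
    {es : List (Sym2 τ.obj.F)} (hes : es.Perm (edges h))
    (hφ : D.Runs es τ.blocks l (φ ≫ D.transport (blockMap h) p)) : D.graphMap h = φ := by
  have h₁ := (D.runs_graphMap h).perm_right τ.isStage_blocks p
  rw [Category.assoc] at h₁
  have h₂ := h₁.unique hD (hφ.of_perm hD τ.isStage_blocks hes) τ.isStage_blocks
  have : IsIso (D.transport (blockMap h) p) := isIso_transport _ p σ.isStage_blocks
  exact (cancel_mono (D.transport (blockMap h) p)).1 h₂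

-- With no edge to glue, the run is a mere permutation, and `graphMap h` is inverse to a relabeling.
-- Identities, structural isomorphisms and graftings are all treated this way.
omit hD in
theorem exists_graphMap_transport (h : τ ⟶ σ) (hh : ∀ f, h.hom.pair f = f) :
    ∃ p : (σ.blocks.map (blockMap h).push).Perm τ.blocks,
      D.graphMap h ≫ D.transport (blockMap h) p = 𝟙 _ := by
  have := D.runs_graphMap h
  rw [edges_eq_nil hh] at this
  obtain ⟨p, hp⟩ := this
  refine ⟨p.symm, ?_⟩
  rw [transport, ← Category.assoc, hp, permHom_trans _ _ τ.isStage_blocks.nodup,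
    permHom_refl τ.isStage_blocks.nodup]

theorem graphMap_id (τ : StableModularGraph.{u}) : D.graphMap (𝟙 τ) = 𝟙 _ := by
  obtain ⟨p, hp⟩ := exists_graphMap_transport (D := D) (𝟙 τ) fun _ => rfl
  rwa [transport_eq_id hD (blockMap (𝟙 τ)) rfl p τ.isStage_blocks, Category.comp_id] at hp

/-- Gluing the edges of `h`, and then those of `k` carried into the flags of `τ` by `h^F`, is a run
for `h ≫ k`. -/
theorem graphMap_comp (h : τ ⟶ σ) (k : σ ⟶ ρ) :
    D.graphMap (h ≫ k) = D.graphMap h ≫ D.graphMap k := by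
  have h₁ := (D.runs_graphMap k).push hD (blockMap h) σ.isStage_blocks
  have h₂ := (D.runs_graphMap h).append h₁ τ.isStage_blocks
  have p := List.Perm.of_eq ((blockMap k).map_push_comp (blockMap h) ρ.blocks)
  refine graphMap_eq hD (h ≫ k) p (edges_comp h k) ?_
  have e := transport_eq_comp hD (blockMap k) (blockMap h) (blockMap (h ≫ k)) rfl p
    ρ.isStage_blocks
  rw [e]
  refine (congrArg (D.Runs _ _ _) ?_).mp h₂
  simp

/-- The functor of gluing data. -/
noncomputable def graphFunctor : StableModularGraph.{u} ⥤ C where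
  obj τ := D.stageObj τ.blocks
  map h := D.graphMap h
  map_id τ := graphMap_id hD τ
  map_comp h k := graphMap_comp hD h k

end GluingData

end

/-! ### Blocks of disjoint unions -/

section

open SymmetricCategory

namespace StableModularGraph

/-- These four facts are stated for plain sums and applied to the flags and vertices of `τ ⊗ σ`,
which are sums by definition. -/
theorem inl_mem_image_inl {α β : Type*} (s : Set α) (x : α) :
    (Sum.inl x : α ⊕ β) ∈ Sum.inl '' s ↔ x ∈ s :=
  Sum.inl_injective.mem_set_image

theorem inr_mem_image_inr {α β : Type*} (s : Set β) (x : β) :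
    (Sum.inr x : α ⊕ β) ∈ Sum.inr '' s ↔ x ∈ s :=
  Sum.inr_injective.mem_set_image

theorem inr_notMem_image_inl {α β : Type*} (s : Set α) (x : β) :
    (Sum.inr x : α ⊕ β) ∉ Sum.inl '' s := by simp

theorem inl_notMem_image_inr {α β : Type*} (s : Set β) (x : α) :
    (Sum.inl x : α ⊕ β) ∉ Sum.inr '' s := by simp

variable (τ σ ρ : StableModularGraph.{u})

/-- The inclusion of the first graph in a disjoint union. -/
def inlMap : BlockMap τ.obj.F τ.obj.V (τ ⊗ σ).obj.F (τ ⊗ σ).obj.V where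
  f := (Sum.inl : τ.obj.F → τ.obj.F ⊕ σ.obj.F)
  A := Set.image (Sum.inl : τ.obj.V → τ.obj.V ⊕ σ.obj.V)
  injective := Sum.inl_injective
  union := Set.image_union _
  disjoint _ _ := (Set.disjoint_image_iff Sum.inl_injective).2
  nonempty _ := Set.Nonempty.image _

/-- The inclusion of the second graph in a disjoint union. -/
def inrMap : BlockMap σ.obj.F σ.obj.V (τ ⊗ σ).obj.F (τ ⊗ σ).obj.V where
  f := (Sum.inr : σ.obj.F → τ.obj.F ⊕ σ.obj.F)
  A := Set.image (Sum.inr : σ.obj.V → τ.obj.V ⊕ σ.obj.V)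
  injective := Sum.inr_injective
  union := Set.image_union _
  disjoint _ _ := (Set.disjoint_image_iff Sum.inr_injective).2
  nonempty _ := Set.Nonempty.image _

theorem inlMap_push (x : τ.obj.V) :
    (inlMap τ σ).push (τ.vertexBlock x) = (τ ⊗ σ).vertexBlock (Sum.inl x : τ.obj.V ⊕ σ.obj.V) := by
  refine Block.ext rfl (Set.ext ?_) Set.image_singleton
  rintro (f | f)
  · exact (inl_mem_image_inl _ f).trans Sum.inl_injective.eq_iff.symm
  · exact iff_of_false (inr_notMem_image_inl _ f) Sum.inr_ne_inl

theorem inrMap_push (x : σ.obj.V) :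
    (inrMap τ σ).push (σ.vertexBlock x) = (τ ⊗ σ).vertexBlock (Sum.inr x : τ.obj.V ⊕ σ.obj.V) := by
  refine Block.ext rfl (Set.ext ?_) Set.image_singleton
  rintro (f | f)
  · exact iff_of_false (inl_notMem_image_inr _ f) Sum.inl_ne_inr
  · exact (inr_mem_image_inr _ f).trans Sum.inr_injective.eq_iff.symm

/-- The vertices of each graph are enumerated by an arbitrary choice, so the lists agree only up to
a permutation. -/
theorem perm_blocks_tensor :
    (τ.blocks.map (inlMap τ σ).push ++ σ.blocks.map (inrMap τ σ).push).Perm (τ ⊗ σ).blocks := by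
  have hn : (τ.blocks.map (inlMap τ σ).push ++ σ.blocks.map (inrMap τ σ).push).Nodup := by
    refine ((inlMap τ σ).isStage τ.isStage_blocks).nodup.append
      ((inrMap τ σ).isStage σ.isStage_blocks).nodup ?_
    intro X hX hX'
    obtain ⟨B, hB, rfl⟩ := List.mem_map.1 hX
    obtain ⟨B', hB', e⟩ := List.mem_map.1 hX'
    obtain ⟨x, rfl⟩ := mem_blocks.1 hB
    obtain ⟨y, rfl⟩ := mem_blocks.1 hB'
    rw [inlMap_push, inrMap_push] at e
    have : (Sum.inr y : τ.obj.V ⊕ σ.obj.V) = Sum.inl x :=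
      Set.singleton_injective (congrArg Block.A e)
    cases this
  refine (List.perm_ext_iff_of_nodup hn (τ ⊗ σ).isStage_blocks.nodup).2 fun B => ?_
  simp only [List.mem_append, List.mem_map, mem_blocks]
  constructor
  · rintro (⟨-, ⟨x, rfl⟩, rfl⟩ | ⟨-, ⟨x, rfl⟩, rfl⟩)
    · exact ⟨_, (inlMap_push τ σ x).symm⟩
    · exact ⟨_, (inrMap_push τ σ x).symm⟩
  · rintro ⟨x | x, rfl⟩
    · exact Or.inl ⟨_, ⟨x, rfl⟩, inlMap_push τ σ x⟩
    · exact Or.inr ⟨_, ⟨x, rfl⟩, inrMap_push τ σ x⟩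

theorem blocks_tensorUnit : (𝟙_ StableModularGraph.{u}).blocks = [] := by
  rw [List.eq_nil_iff_forall_not_mem]
  intro B hB
  obtain ⟨x, -⟩ := mem_blocks.1 hB
  exact PEmpty.elim x

variable {τ σ ρ} {τ' σ' : StableModularGraph.{u}}

theorem edges_tensor (h : τ ⟶ σ) (k : τ' ⟶ σ') :
    ((edges h).map (Sym2.map (inlMap τ τ').f) ++ (edges k).map (Sym2.map (inrMap τ τ').f)).Perm
      (edges (h ⊗ₘ k)) := by
  have hl (f : τ.obj.F) : (h ⊗ₘ k).hom.pair ((inlMap τ τ').f f) =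
    (inlMap τ τ').f (h.hom.pair f) := rfl
  have hr (f : τ'.obj.F) : (h ⊗ₘ k).hom.pair ((inrMap τ τ').f f) =
    (inrMap τ τ').f (k.hom.pair f) := rfl
  have hn : ((edges h).map (Sym2.map (inlMap τ τ').f) ++
      (edges k).map (Sym2.map (inrMap τ τ').f)).Nodup := by
    refine ((nodup_edges h).map (Sym2.map.injective (inlMap τ τ').injective)).append
      ((nodup_edges k).map (Sym2.map.injective (inrMap τ τ').injective)) fun e he he' => ?_
    obtain ⟨e, -, rfl⟩ := List.mem_map.1 he
    obtain ⟨e', -, h'⟩ := List.mem_map.1 he'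
    induction e with | _ a b
    have : (inlMap τ τ').f a ∈ Sym2.map (inrMap τ τ').f e' := by
      rw [h']
      exact Sym2.mem_mk_left _ _
    obtain ⟨x, -, hx⟩ := Sym2.mem_map.1 this
    cases hx
  refine (List.perm_ext_iff_of_nodup hn (nodup_edges _)).2 fun e => ?_
  simp only [List.mem_append, List.mem_map, mem_edges]
  constructor
  · rintro (⟨-, ⟨f, hf, rfl⟩, rfl⟩ | ⟨-, ⟨f, hf, rfl⟩, rfl⟩)
    · exact ⟨(inlMap τ τ').f f, (inlMap τ τ').injective.ne hf, rfl⟩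
    · exact ⟨(inrMap τ τ').f f, (inrMap τ τ').injective.ne hf, rfl⟩
  · rintro ⟨f | f, hf, rfl⟩
    · exact Or.inl ⟨_, ⟨f, fun e => hf (congrArg Sum.inl e), rfl⟩, rfl⟩
    · exact Or.inr ⟨_, ⟨f, fun e => hf (congrArg Sum.inr e), rfl⟩, rfl⟩

theorem blockMap_comp_inlMap (h : τ ⟶ σ) (k : τ' ⟶ σ') :
    (blockMap h).comp (inlMap τ τ') = (inlMap σ σ').comp (blockMap (h ⊗ₘ k)) := by
  refine BlockMap.ext rfl (funext fun s => Set.ext ?_)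
  rintro (x | x)
  · exact (inl_mem_image_inl _ x).trans (inl_mem_image_inl s (h.hom.vertexMap x)).symm
  · exact iff_of_false (inr_notMem_image_inl _ x) (inr_notMem_image_inl s (k.hom.vertexMap x))

theorem blockMap_comp_inrMap (h : τ ⟶ σ) (k : τ' ⟶ σ') :
    (blockMap k).comp (inrMap τ τ') = (inrMap σ σ').comp (blockMap (h ⊗ₘ k)) := by
  refine BlockMap.ext rfl (funext fun s => Set.ext ?_)
  rintro (x | x)
  · exact iff_of_false (inl_notMem_image_inr _ x) (inl_notMem_image_inr s (h.hom.vertexMap x))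
  · exact (inr_mem_image_inr _ x).trans (inr_mem_image_inr s (k.hom.vertexMap x)).symm

/-- This and the next two equations compare the inclusions of three summands under the two
bracketings; they are the hypotheses of `whiskerRight_join_join` for the associator. -/
theorem inlMap_comp_inlMap : (inlMap τ σ).comp (inlMap (τ ⊗ σ) ρ) =
    (inlMap τ (σ ⊗ ρ)).comp (blockMap (α_ τ σ ρ).hom) := by
  refine BlockMap.ext rfl (funext fun s => Set.ext ?_)
  rintro ((x | x) | x)
  · exact ((inl_mem_image_inl _ (Sum.inl x)).trans (inl_mem_image_inl s x)).trans
      (inl_mem_image_inl s x).symm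
  · exact ((inl_mem_image_inl _ (Sum.inr x)).trans
      (iff_of_false (inr_notMem_image_inl s x) (inr_notMem_image_inl s (Sum.inl x))))
  · exact iff_of_false (inr_notMem_image_inl _ x) (inr_notMem_image_inl s (Sum.inr x))

theorem inrMap_comp_inlMap : (inrMap τ σ).comp (inlMap (τ ⊗ σ) ρ) =
    (inlMap σ ρ).comp ((inrMap τ (σ ⊗ ρ)).comp (blockMap (α_ τ σ ρ).hom)) := by
  refine BlockMap.ext rfl (funext fun s => Set.ext ?_)
  rintro ((x | x) | x)
  · exact ((inl_mem_image_inl _ (Sum.inl x)).trans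
      (iff_of_false (inl_notMem_image_inr s x) (inl_notMem_image_inr _ x)))
  · exact ((inl_mem_image_inl _ (Sum.inr x)).trans (inr_mem_image_inr s x)).trans
      ((inr_mem_image_inr _ (Sum.inl x)).trans (inl_mem_image_inl s x)).symm
  · exact iff_of_false (inr_notMem_image_inl _ x) fun h =>
      inr_notMem_image_inl s x ((inr_mem_image_inr _ (Sum.inr x)).1 h)

theorem inrMap_comp_inrMap : (inrMap σ ρ).comp ((inrMap τ (σ ⊗ ρ)).comp (blockMap (α_ τ σ ρ).hom)) =
    inrMap (τ ⊗ σ) ρ := by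
  refine BlockMap.ext rfl (funext fun s => Set.ext ?_)
  rintro ((x | x) | x)
  · exact iff_of_false (inl_notMem_image_inr _ x) (inl_notMem_image_inr s (Sum.inl x))
  · exact ((inr_mem_image_inr _ (Sum.inl x)).trans
      (iff_of_false (inl_notMem_image_inr s x) (inl_notMem_image_inr s (Sum.inr x))))
  · exact ((inr_mem_image_inr _ (Sum.inr x)).trans (inr_mem_image_inr s x)).trans
      (inr_mem_image_inr s x).symm

theorem blockMap_leftUnitor : blockMap (λ_ τ).hom = inrMap (𝟙_ _) τ := by
  refine BlockMap.ext rfl (funext fun s => Set.ext ?_)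
  rintro (x | x)
  · exact PEmpty.elim x
  · exact (inr_mem_image_inr s x).symm

theorem blockMap_rightUnitor : blockMap (ρ_ τ).hom = inlMap τ (𝟙_ _) := by
  refine BlockMap.ext rfl (funext fun s => Set.ext ?_)
  rintro (x | x)
  · exact (inl_mem_image_inl s x).symm
  · exact PEmpty.elim x

theorem inlMap_comp_braiding : (inlMap σ τ).comp (blockMap (β_ τ σ).hom) = inrMap τ σ := by
  refine BlockMap.ext rfl (funext fun s => Set.ext ?_)
  rintro (x | x)
  · exact iff_of_false (inr_notMem_image_inl s x) (inl_notMem_image_inr s x)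
  · exact (inl_mem_image_inl s x).trans (inr_mem_image_inr s x).symm

theorem inrMap_comp_braiding : (inrMap σ τ).comp (blockMap (β_ τ σ).hom) = inlMap τ σ := by
  refine BlockMap.ext rfl (funext fun s => Set.ext ?_)
  rintro (x | x)
  · exact (inr_mem_image_inr s x).trans (inl_mem_image_inl s x).symm
  · exact iff_of_false (inl_notMem_image_inr s x) (inr_notMem_image_inl s x)

end StableModularGraph

end

/-! ### The functor of gluing data is symmetric monoidal -/

section

open SymmetricCategory

namespace GluingData

open StableModularGraph

variable {C : Type w} [Category.{v} C] [MonoidalCategory C] [SymmetricCategory C]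

theorem transport_congr {F V F' V' : Type u} {D : GluingData.{u} C} {s t : BlockMap F V F' V'}
    (h : s = t) {l : List (Block F V)} {m : List (Block F' V')} (p : (l.map s.push).Perm m)
    (q : (l.map t.push).Perm m) : D.transport s p = D.transport t q := by
  subst h
  rfl

theorem transport_refl {F V F' V' : Type u} {D : GluingData.{u} C} (s : BlockMap F V F' V')
    {l : List (Block F V)} (hl : IsStage l) :
    D.transport s (.refl (l.map s.push)) = (D.pushIso s l).hom := by
  rw [transport, permHom_refl (s.isStage hl).nodup, Category.comp_id]

variable (D : GluingData.{u} C) (τ σ ρ : StableModularGraph.{u})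

/-- The tensorator. -/
noncomputable def tensorMap :
    D.stageObj τ.blocks ⊗ D.stageObj σ.blocks ⟶ D.stageObj (τ ⊗ σ).blocks :=
  D.join (inlMap τ σ) (inrMap τ σ) (perm_blocks_tensor τ σ)

instance : IsIso (D.tensorMap τ σ) := isIso_join _ _ _ (τ ⊗ σ).isStage_blocks

/-- The tensorator as an isomorphism. -/
noncomputable def tensorMapIso :
    D.stageObj τ.blocks ⊗ D.stageObj σ.blocks ≅ D.stageObj (τ ⊗ σ).blocks :=
  asIso (D.tensorMap τ σ)

variable {D} (hD : D.IsCompatible)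
include hD

/-- The contracted edges of a disjoint union of morphisms are those of the two morphisms
(`edges_tensor`), so `Runs.join` produces a run for it out of the two given runs. -/
theorem tensorHom_tensorMap {τ σ τ' σ' : StableModularGraph.{u}} (h : τ ⟶ σ) (k : τ' ⟶ σ') :
    (D.graphMap h ⊗ₘ D.graphMap k) ≫ D.tensorMap σ σ' =
      D.tensorMap τ τ' ≫ D.graphMap (h ⊗ₘ k) := by
  -- This brings the goal into the form `graphMap (h ⊗ₘ k) = φ` required by `graphMap_eq`.
  rw [← IsIso.inv_comp_eq, eq_comm]
  have hn : IsStage ((σ.blocks.map (blockMap h).push).map (inlMap τ τ').push ++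
      (σ'.blocks.map (blockMap k).push).map (inrMap τ τ').push) := by
    have := (blockMap (h ⊗ₘ k)).isStage
      ((σ ⊗ σ').isStage_blocks.perm (perm_blocks_tensor σ σ').symm)
    rwa [List.map_append, ← BlockMap.map_push_comp, ← BlockMap.map_push_comp,
      ← blockMap_comp_inlMap, ← blockMap_comp_inrMap, BlockMap.map_push_comp,
      BlockMap.map_push_comp] at this
  have r : ((σ ⊗ σ').blocks.map (blockMap (h ⊗ₘ k)).push).Perm
      ((σ.blocks.map (blockMap h).push).map (inlMap τ τ').push ++
        (σ'.blocks.map (blockMap k).push).map (inrMap τ τ').push) := by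
    have := (perm_blocks_tensor σ σ').symm.map (blockMap (h ⊗ₘ k)).push
    rwa [List.map_append, ← BlockMap.map_push_comp, ← BlockMap.map_push_comp,
      ← blockMap_comp_inlMap, ← blockMap_comp_inrMap, BlockMap.map_push_comp,
      BlockMap.map_push_comp] at this
  have c : (σ.blocks.map ((blockMap h).comp (inlMap τ τ')).push ++
      σ'.blocks.map ((blockMap k).comp (inrMap τ τ')).push).Perm
      ((σ.blocks.map (blockMap h).push).map (inlMap τ τ').push ++
        (σ'.blocks.map (blockMap k).push).map (inrMap τ τ').push) := by
    rw [BlockMap.map_push_comp, BlockMap.map_push_comp]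
  refine graphMap_eq hD (h ⊗ₘ k) r (edges_tensor h k) ?_
  refine (D.runs_graphMap h).join hD (inlMap τ τ') (inrMap τ τ') (D.runs_graphMap k)
    τ.isStage_blocks τ'.isStage_blocks (τ ⊗ τ').isStage_blocks (perm_blocks_tensor τ τ')
    (.refl _) ?_
  have e₁ := transport_join hD (blockMap h) (blockMap k) (inlMap τ τ') (inrMap τ τ') _ _ rfl rfl
    (.refl _) (.refl _) (.refl _) c σ.isStage_blocks σ'.isStage_blocks hn
  rw [transport_refl _ σ.isStage_blocks, transport_refl _ σ'.isStage_blocks] at e₁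
  have e₂ := join_transport hD (inlMap σ σ') (inrMap σ σ') (blockMap (h ⊗ₘ k)) _ _
    (blockMap_comp_inlMap h k).symm (blockMap_comp_inrMap h k).symm (perm_blocks_tensor σ σ') r c
    σ.isStage_blocks σ'.isStage_blocks (σ ⊗ σ').isStage_blocks
  rw [← tensorHom_comp_tensorHom, Category.assoc, e₁, Category.assoc, Category.assoc, ← e₂]
  exact (IsIso.hom_inv_id_assoc (D.tensorMap τ τ') _).symm

/-- The associator contracts nothing, so its image is inverse to a transport. Composed with that
transport, both sides are joins of the same three lists. Braiding and unitors are handled alike. -/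
theorem tensorMap_associator :
    D.tensorMap τ σ ▷ D.stageObj ρ.blocks ≫ D.tensorMap (τ ⊗ σ) ρ ≫ D.graphMap (α_ τ σ ρ).hom =
      (α_ _ _ _).hom ≫ D.stageObj τ.blocks ◁ D.tensorMap σ ρ ≫ D.tensorMap τ (σ ⊗ ρ) := by
  obtain ⟨p, hp⟩ := exists_graphMap_transport (D := D) (α_ τ σ ρ).hom fun _ => rfl
  have : IsIso (D.transport (blockMap (α_ τ σ ρ).hom) p) :=
    isIso_transport _ p (τ ⊗ (σ ⊗ ρ)).isStage_blocks
  rw [← cancel_mono (D.transport (blockMap (α_ τ σ ρ).hom) p)]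
  simp only [Category.assoc]
  have k : (τ.blocks.map ((inlMap τ (σ ⊗ ρ)).comp (blockMap (α_ τ σ ρ).hom)).push ++
      (σ ⊗ ρ).blocks.map ((inrMap τ (σ ⊗ ρ)).comp (blockMap (α_ τ σ ρ).hom)).push).Perm
      ((τ ⊗ σ) ⊗ ρ).blocks := by
    rw [BlockMap.map_push_comp, BlockMap.map_push_comp, ← List.map_append]
    exact ((perm_blocks_tensor τ (σ ⊗ ρ)).map _).trans p
  have e := join_transport hD (inlMap τ (σ ⊗ ρ)) (inrMap τ (σ ⊗ ρ)) (blockMap (α_ τ σ ρ).hom) _ _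
    rfl rfl (perm_blocks_tensor τ (σ ⊗ ρ)) p k τ.isStage_blocks (σ ⊗ ρ).isStage_blocks
    (τ ⊗ (σ ⊗ ρ)).isStage_blocks
  rw [hp, Category.comp_id]
  refine Eq.trans ?_ (whisker_eq _ (whisker_eq _ e.symm))
  exact whiskerRight_join_join hD (inlMap τ σ) (inrMap τ σ) (inlMap (τ ⊗ σ) ρ) (inrMap (τ ⊗ σ) ρ)
    (inlMap σ ρ) (inrMap σ ρ) _ _ inlMap_comp_inlMap inrMap_comp_inlMap inrMap_comp_inrMap
    (perm_blocks_tensor τ σ) (perm_blocks_tensor (τ ⊗ σ) ρ) (perm_blocks_tensor σ ρ) k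
    τ.isStage_blocks σ.isStage_blocks ρ.isStage_blocks (τ ⊗ σ).isStage_blocks
    (σ ⊗ ρ).isStage_blocks ((τ ⊗ σ) ⊗ ρ).isStage_blocks

theorem tensorMap_braiding :
    D.tensorMap τ σ ≫ D.graphMap (β_ τ σ).hom = (β_ _ _).hom ≫ D.tensorMap σ τ := by
  obtain ⟨p, hp⟩ := exists_graphMap_transport (D := D) (β_ τ σ).hom fun _ => rfl
  have : IsIso (D.transport (blockMap (β_ τ σ).hom) p) :=
    isIso_transport _ p (σ ⊗ τ).isStage_blocks
  rw [← cancel_mono (D.transport (blockMap (β_ τ σ).hom) p)]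
  simp only [Category.assoc]
  have k := List.perm_append_comm.trans (perm_blocks_tensor τ σ)
  have e := join_transport hD (inlMap σ τ) (inrMap σ τ) (blockMap (β_ τ σ).hom) _ _
    inlMap_comp_braiding inrMap_comp_braiding (perm_blocks_tensor σ τ) p k
    σ.isStage_blocks τ.isStage_blocks (σ ⊗ τ).isStage_blocks
  rw [hp, Category.comp_id]
  refine Eq.trans ?_ (whisker_eq _ e.symm)
  exact (braiding_join _ _ _ _ (τ ⊗ σ).isStage_blocks).symm

omit hD in
variable (D) in
/-- The unit comparison. -/
noncomputable def unitIso : 𝟙_ C ≅ D.stageObj (𝟙_ StableModularGraph.{u}).blocks :=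
  permIso (X := D.blockObj) (l := []) (.of_eq blocks_tensorUnit.symm) .nil

omit hD in
theorem tensorMap_leftUnitor :
    (λ_ (D.stageObj τ.blocks)).hom = D.unitIso.hom ▷ D.stageObj τ.blocks ≫
      D.tensorMap (𝟙_ _) τ ≫ D.graphMap (λ_ τ).hom := by
  obtain ⟨p, hp⟩ := exists_graphMap_transport (D := D) (λ_ τ).hom fun _ => rfl
  have : IsIso (D.transport (blockMap (λ_ τ).hom) p) := isIso_transport _ p τ.isStage_blocks
  rw [← cancel_mono (D.transport (blockMap (λ_ τ).hom) p)]
  simp only [Category.assoc]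
  rw [hp, Category.comp_id]
  have k : (τ.blocks.map (inrMap (𝟙_ _) τ).push).Perm (𝟙_ StableModularGraph.{u} ⊗ τ).blocks := by
    rwa [← blockMap_leftUnitor]
  have e := permHom_join (D := D) (inlMap (𝟙_ _) τ) (inrMap (𝟙_ _) τ)
    (.of_eq blocks_tensorUnit.symm) (.refl τ.blocks) (perm_blocks_tensor _ τ) k
    ⟨.nil, by simp⟩ τ.isStage_blocks (𝟙_ StableModularGraph.{u} ⊗ τ).isStage_blocks
  rw [permHom_refl τ.isStage_blocks.nodup, tensorHom_id] at e
  refine Eq.trans ?_ e.symm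
  rw [transport_congr blockMap_leftUnitor p k]
  exact (nil_join (D := D) (inlMap (𝟙_ _) τ) (inrMap (𝟙_ _) τ) k).symm

omit hD in
theorem tensorMap_rightUnitor :
    (ρ_ (D.stageObj τ.blocks)).hom = D.stageObj τ.blocks ◁ D.unitIso.hom ≫
      D.tensorMap τ (𝟙_ _) ≫ D.graphMap (ρ_ τ).hom := by
  obtain ⟨p, hp⟩ := exists_graphMap_transport (D := D) (ρ_ τ).hom fun _ => rfl
  have : IsIso (D.transport (blockMap (ρ_ τ).hom) p) := isIso_transport _ p τ.isStage_blocks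
  rw [← cancel_mono (D.transport (blockMap (ρ_ τ).hom) p)]
  simp only [Category.assoc]
  rw [hp, Category.comp_id]
  have k : (τ.blocks.map (inlMap τ (𝟙_ _)).push).Perm (τ ⊗ 𝟙_ StableModularGraph.{u}).blocks := by
    rwa [← blockMap_rightUnitor]
  have k' : (τ.blocks.map (inlMap τ (𝟙_ _)).push ++ [].map (inrMap τ (𝟙_ _)).push).Perm
      (τ ⊗ 𝟙_ StableModularGraph.{u}).blocks := by
    rwa [List.map_nil, List.append_nil]
  have e := permHom_join (D := D) (inlMap τ (𝟙_ _)) (inrMap τ (𝟙_ _)) (.refl τ.blocks)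
    (.of_eq blocks_tensorUnit.symm) (perm_blocks_tensor τ _) k'
    τ.isStage_blocks ⟨.nil, by simp⟩ (τ ⊗ 𝟙_ StableModularGraph.{u}).isStage_blocks
  rw [permHom_refl τ.isStage_blocks.nodup, id_tensorHom] at e
  refine Eq.trans ?_ e.symm
  rw [transport_congr blockMap_rightUnitor p k]
  exact (join_nil (D := D) (inlMap τ (𝟙_ _)) (inrMap τ (𝟙_ _)) k' k τ.isStage_blocks).symm

/-- The functor of gluing data is monoidal. -/
noncomputable def graphFunctorCoreMonoidal : (graphFunctor hD).CoreMonoidal where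
  εIso := D.unitIso
  μIso τ σ := D.tensorMapIso τ σ
  μIso_hom_natural_left {τ σ} h ρ := by
    have := tensorHom_tensorMap hD h (𝟙 ρ)
    rwa [graphMap_id hD, tensorHom_id, tensorHom_id] at this
  μIso_hom_natural_right {τ σ} ρ h := by
    have := tensorHom_tensorMap hD (𝟙 ρ) h
    rwa [graphMap_id hD, id_tensorHom, id_tensorHom] at this
  associativity τ σ ρ := tensorMap_associator τ σ ρ hD
  left_unitality τ := tensorMap_leftUnitor τ
  right_unitality τ := tensorMap_rightUnitor τ

/-- The functor of gluing data is symmetric monoidal. -/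
@[reducible]
noncomputable def graphFunctorBraided : (graphFunctor hD).Braided where
  toMonoidal := (graphFunctorCoreMonoidal hD).toMonoidal
  braided τ σ := tensorMap_braiding τ σ hD

end GluingData

end

/-! ### Graphs with a single vertex -/

section

open SymmetricCategory

namespace StableModularGraph

variable {τ σ : StableModularGraph.{u}}

theorem perm_blocks_of_unique (τ : StableModularGraph.{u}) [Unique τ.obj.V] :
    τ.blocks.Perm [τ.vertexBlock default] := by
  refine (List.perm_ext_iff_of_nodup τ.isStage_blocks.nodup (List.nodup_singleton _)).2 fun B => ?_
  rw [mem_blocks, List.mem_singleton, Unique.exists_iff, eq_comm]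

theorem isStage_vertexBlock (τ : StableModularGraph.{u}) [Unique τ.obj.V] :
    IsStage [τ.vertexBlock default] :=
  τ.isStage_blocks.perm τ.perm_blocks_of_unique

/-- Only `f` and `f'` are contracted, and an involution without fixed points must interchange them.
-/
theorem edges_perm_singleton {h : τ ⟶ σ} {f f' : τ.obj.F} (hne : f ≠ f')
    (hr : ∀ x, (x ≠ f ∧ x ≠ f') ↔ x ∈ Set.range h.hom.flagMap) :
    (edges h).Perm [s(f, f')] := by
  have hp : ∀ x, h.hom.pair x ≠ x ↔ x = f ∨ x = f' := fun x => by
    rw [ne_eq, h.hom.pair_eq_self_iff, ← hr]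
    tauto
  have hf : h.hom.pair f = f' := by
    have h₁ := (hp f).2 (Or.inl rfl)
    have h₂ := (hp (h.hom.pair f)).1 (by rw [h.hom.pair_pair]; exact h₁.symm)
    exact h₂.resolve_left h₁
  refine (List.perm_ext_iff_of_nodup (nodup_edges h) (List.nodup_singleton _)).2 fun e => ?_
  rw [mem_edges, List.mem_singleton]
  constructor
  · rintro ⟨x, hx, rfl⟩
    rcases (hp x).1 hx with rfl | rfl
    · rw [hf]
    · rw [← hf, h.hom.pair_pair, Sym2.eq_swap]
  · rintro rfl
    exact ⟨f, (hp f).2 (Or.inl rfl), by rw [hf]⟩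

theorem IsContraction.flagMap_flagEquiv {h : τ ⟶ σ} {f f' : τ.obj.F} (hc : IsContraction h f f')
    (x : {x : τ.obj.F // x ≠ f ∧ x ≠ f'}) : h.hom.flagMap (hc.flagEquiv x) = x.1 :=
  congrArg Subtype.val ((Equiv.ofInjective h.hom.flagMap
    h.hom.flagMap_injective).apply_symm_apply _)

/-- Every flag belongs to the only vertex. -/
def vertexEquiv (τ : StableModularGraph.{u}) [Unique τ.obj.V] :
    (τ.vertexBlock default).pair.I ≃ τ.stablePair.I :=
  Equiv.subtypeUnivEquiv fun _ => Subsingleton.elim _ _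

/-- The labels of an image of the only vertex. -/
noncomputable def imageEquiv [Unique τ.obj.V] {F' V' : Type u} {f : τ.obj.F → F'}
    {B : Block F' V'} (k : Block.IsImage f (τ.vertexBlock default) B) :
    B.pair.I ≃ τ.stablePair.I :=
  k.equiv.symm.trans τ.vertexEquiv

theorem apply_imageEquiv [Unique τ.obj.V] {F' V' : Type u} {f : τ.obj.F → F'}
    {B : Block F' V'} (k : Block.IsImage f (τ.vertexBlock default) B) (x : B.pair.I) :
    f (imageEquiv k x) = x.1 :=
  congrArg Subtype.val (k.equiv.apply_symm_apply x)

end StableModularGraph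

namespace GluingData

open StableModularGraph

variable {C : Type w} [Category.{v} C] [MonoidalCategory C] [SymmetricCategory C]

theorem transport_singleton {F V F' V' : Type u} {D : GluingData.{u} C} (s : BlockMap F V F' V')
    {B : Block F V} {B' : Block F' V'} (p : ([B].map s.push).Perm [B'])
    (k : Block.IsImage s.f B B') :
    D.transport s p = (D.imageIso k).hom ▷ 𝟙_ C := by
  obtain rfl : s.push B = B' := List.singleton_perm_singleton.1 p
  have h : D.transport s p = (D.pushIso s [B]).hom :=
    (whisker_eq _ (permHom_refl (List.nodup_singleton _) p)).trans (Category.comp_id _)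
  rw [h, pushIso_cons_hom]
  exact tensorHom_id _ _

-- The tensor product of a one-element list carries a factor `𝟙_ C`; this removes these factors on
-- both sides of a gluing map.
omit [SymmetricCategory C] in
theorem tensor_rightUnitor_comp {x x' y y' z : C} (a : x ⟶ x') (b : y ⟶ y') (m : x' ⊗ y' ⟶ z) :
    (a ▷ 𝟙_ C ⊗ₘ b ▷ 𝟙_ C) ≫ (α_ x' (𝟙_ C) (y' ⊗ 𝟙_ C)).hom ≫ x' ◁ (λ_ (y' ⊗ 𝟙_ C)).hom ≫
      (α_ x' y' (𝟙_ C)).inv ≫ m ▷ 𝟙_ C ≫ (ρ_ z).hom =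
    ((ρ_ x).hom ⊗ₘ (ρ_ y).hom) ≫ (a ⊗ₘ b) ≫ m := by
  rw [rightUnitor_naturality]
  simp only [MonoidalCategory.tensorHom_def]
  monoidal

theorem join_singleton {F V F' V' F'' V'' : Type u} {D : GluingData.{u} C}
    (s : BlockMap F V F'' V'') (t : BlockMap F' V' F'' V'') {B : Block F V} {B' : Block F' V'}
    (r : ([B].map s.push ++ [B'].map t.push).Perm [s.push B, t.push B'])
    (hn : [s.push B, t.push B'].Nodup) :
    D.join s t r =
      ((D.imageIso (s.isImage B)).hom ▷ 𝟙_ C ⊗ₘ (D.imageIso (t.isImage B')).hom ▷ 𝟙_ C) ≫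
      (α_ (D.blockObj (s.push B)) (𝟙_ C) (D.blockObj (t.push B') ⊗ 𝟙_ C)).hom ≫
        _ ◁ (λ_ (D.blockObj (t.push B') ⊗ 𝟙_ C)).hom := by
  have h₁ : (D.pushIso s [B]).hom = (D.imageIso (s.isImage B)).hom ▷ 𝟙_ C :=
    (pushIso_cons_hom s B []).trans (tensorHom_id _ _)
  have h₂ : (D.pushIso t [B']).hom = (D.imageIso (t.isImage B')).hom ▷ 𝟙_ C :=
    (pushIso_cons_hom t B' []).trans (tensorHom_id _ _)
  rw [join, h₁, h₂]
  exact whisker_eq _ ((whisker_eq _ (permHom_refl hn r)).trans (Category.comp_id _))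

/-! ### Values on graphs with a single vertex -/

section

variable (D : GluingData.{u} C) {τ σ : StableModularGraph.{u}}

/-- The object of a graph with one vertex. -/
noncomputable def vertexIso (τ : StableModularGraph.{u}) [Unique τ.obj.V] :
    D.stageObj τ.blocks ≅ D.blockObj (τ.vertexBlock default) :=
  permIso (X := D.blockObj) τ.perm_blocks_of_unique τ.isStage_blocks.nodup ≪≫ ρ_ _

/-- The object of a graph with one vertex. -/
noncomputable def singleIso (τ : StableModularGraph.{u}) [Unique τ.obj.V] :
    D.stageObj τ.blocks ≅ D.obj τ.stablePair :=
  D.vertexIso τ ≪≫ D.relabel (X := (τ.vertexBlock default).pair) (by rfl) τ.vertexEquiv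

variable {D}

theorem transport_rightUnitor {F' V' : Type u} [Unique τ.obj.V] (s : BlockMap τ.obj.F τ.obj.V F' V')
    {B : Block F' V'} (p : (τ.blocks.map s.push).Perm [B])
    (k : Block.IsImage s.f (τ.vertexBlock default) B) :
    D.transport s p ≫ (ρ_ _).hom = (D.vertexIso τ).hom ≫ (D.imageIso k).hom := by
  have p' : ([τ.vertexBlock default].map s.push).Perm [B] :=
    (τ.perm_blocks_of_unique.symm.map s.push).trans p
  have h := permHom_transport (D := D) s τ.perm_blocks_of_unique p' τ.isStage_blocks
  rw [transport_singleton s p' k] at h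
  refine (eq_whisker h.symm _).trans ?_
  refine (Category.assoc _ _ _).trans ((whisker_eq _ (rightUnitor_naturality _)).trans ?_)
  exact (Category.assoc _ _ _).symm

variable (hD : D.IsCompatible)
include hD

/-- The object of `τ` is reached through any block `B` that is an image of its only vertex. In the
applications `B` consists of flags of another graph, where the gluing takes place. -/
theorem imageIso_relabel [Unique τ.obj.V] {F' V' : Type u} {f : τ.obj.F → F'}
    {B : Block F' V'} (k : Block.IsImage f (τ.vertexBlock default) B)
    (hg : B.pair.g = τ.stablePair.g) :
    (D.vertexIso τ).hom ≫ (D.imageIso k).hom ≫ (D.relabel hg (imageEquiv k)).hom =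
      (D.singleIso τ).hom := by
  refine whisker_eq _ ?_
  refine (hD.relabel_trans k.g_eq hg k.equiv (imageEquiv k)).symm.trans (D.relabel_congr _ _ ?_)
  exact fun x => congrArg τ.vertexEquiv (k.equiv.symm_apply_apply x)

theorem graphMap_singleIso_of_iso [Unique τ.obj.V] [Unique σ.obj.V] (h : τ ≅ σ) :
    D.graphMap h.hom ≫ (D.singleIso σ).hom = (D.singleIso τ).hom ≫
      (D.relabel (X := τ.stablePair) (Y := σ.stablePair) (genus_of_iso h)
        (flagEquivOfIso h)).hom := by
  obtain ⟨p, hp⟩ := exists_graphMap_transport (D := D) h.hom fun f =>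
    (h.hom.hom.pair_eq_self_iff f).2 ⟨_, (flagEquivOfIso h).left_inv f⟩
  have k : Block.IsImage h.hom.hom.flagMap (σ.vertexBlock default) (τ.vertexBlock default) :=
    ⟨h.hom.hom.flagMap_injective, (genus_of_iso h).symm, Set.ext fun x =>
      iff_of_true (Subsingleton.elim _ _) ⟨_, Subsingleton.elim _ _,
        (flagEquivOfIso h).left_inv x⟩⟩
  have e := transport_rightUnitor (D := D) (blockMap h.hom) (p.trans τ.perm_blocks_of_unique) k
  have e₀ := transport_permHom (D := D) (blockMap h.hom) p τ.perm_blocks_of_unique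
    σ.isStage_blocks
  have e' : D.graphMap h.hom ≫ (D.vertexIso σ).hom ≫ (D.imageIso k).hom = (D.vertexIso τ).hom := by
    refine (whisker_eq _ (e.symm.trans ((eq_whisker e₀.symm _).trans (Category.assoc _ _ _)))).trans
      ?_
    rw [reassoc_of% hp]
    rfl
  rw [← imageIso_relabel hD k (genus_of_iso h), reassoc_of% e', singleIso, Iso.trans_hom,
    Category.assoc]
  refine whisker_eq _ (hD.relabel_eq_comp fun x => h.hom.hom.flagMap_injective ?_)
  exact (apply_imageEquiv k x).trans ((flagEquivOfIso h).left_inv x.1).symm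

/-- A run along the only contracted edge is a single gluing. -/
theorem graphMap_transport_of_contracts {h : τ ⟶ σ} {f f' : τ.obj.F} (hne : f ≠ f')
    (hr : ∀ x, (x ≠ f ∧ x ≠ f') ↔ x ∈ Set.range h.hom.flagMap) {l : List (Block τ.obj.F τ.obj.V)}
    (p : (σ.blocks.map (blockMap h).push).Perm l) {φ : D.stageObj τ.blocks ⟶ D.stageObj l}
    (hφ : D.Contracts f f' τ.blocks l φ) : D.graphMap h ≫ D.transport (blockMap h) p = φ := by
  have h₁ := ((D.runs_graphMap h).perm_right τ.isStage_blocks p).of_perm hD τ.isStage_blocks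
    (edges_perm_singleton hne hr)
  rw [Category.assoc] at h₁
  exact h₁.unique hD ⟨f, f', l, φ, 𝟙 _, rfl, hφ, .refl (hφ.isStage τ.isStage_blocks),
    (Category.comp_id _).symm⟩ τ.isStage_blocks

omit hD in
theorem mem_push_vertexBlock [Unique σ.obj.V] {h : τ ⟶ σ} {f f' : τ.obj.F}
    (hr : ∀ x, (x ≠ f ∧ x ≠ f') ↔ x ∈ Set.range h.hom.flagMap) (x : τ.obj.F) :
    x ∈ ((blockMap h).push (σ.vertexBlock default)).S ↔ x ≠ f ∧ x ≠ f' := by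
  rw [hr]
  exact ⟨fun ⟨y, _, hy⟩ => ⟨y, hy⟩, fun ⟨y, hy⟩ => ⟨y, Subsingleton.elim _ _, hy⟩⟩

omit hD in
theorem mem_push_vertexBlock_A [Unique σ.obj.V] (h : τ ⟶ σ) (x : τ.obj.V) :
    x ∈ ((blockMap h).push (σ.vertexBlock default)).A :=
  Subsingleton.elim (h.hom.vertexMap x) default

theorem graphMap_singleIso_of_loop [Unique τ.obj.V] [Unique σ.obj.V] (h : τ ⟶ σ) (f f' : τ.obj.F)
    (hc : IsContraction h f f') :
    D.graphMap h ≫ (D.singleIso σ).hom = (D.singleIso τ).hom ≫ D.loop τ.stablePair f f' hc.ne ≫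
      (D.relabel (X := τ.stablePair.loop f f' hc.ne) (Y := σ.stablePair)
        hc.genus_loop hc.flagEquiv).hom := by
  have k := (blockMap h).isImage (σ.vertexBlock default)
  have hl : Block.IsLoop f f' (τ.vertexBlock default)
      ((blockMap h).push (σ.vertexBlock default)) :=
    ⟨hc.ne, Subsingleton.elim _ _, Subsingleton.elim _ _, hc.genus_loop, fun x =>
      (mem_push_vertexBlock hc.mem_range x).trans
        (and_iff_right (Subsingleton.elim (τ.obj.bdry x) default)).symm,
      Set.ext fun x => iff_of_true (mem_push_vertexBlock_A h x) (Subsingleton.elim x default)⟩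
  have p : (σ.blocks.map (blockMap h).push).Perm [(blockMap h).push (σ.vertexBlock default)] :=
    σ.perm_blocks_of_unique.map _
  have e₁ := graphMap_transport_of_contracts hD hc.ne hc.mem_range p
    ((Contracts.head_loop (D := D) hl τ.isStage_vertexBlock).perm_left τ.isStage_vertexBlock
      τ.perm_blocks_of_unique)
  have e₂ := transport_rightUnitor (D := D) (blockMap h) p k
  have e₃ : D.graphMap h ≫ (D.vertexIso σ).hom ≫ (D.imageIso k).hom =
      (D.vertexIso τ).hom ≫ D.loopMap hl := by
    rw [← e₂, reassoc_of% e₁]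
    refine (whisker_eq _ (rightUnitor_naturality _)).trans ?_
    exact (Category.assoc _ _ _).symm
  rw [← imageIso_relabel hD k rfl, reassoc_of% e₃, singleIso, Iso.trans_hom, Category.assoc]
  refine whisker_eq _ ?_
  refine hD.loop_relabel_relabel (X := (τ.vertexBlock default).pair)
    (Y := ((blockMap h).push (σ.vertexBlock default)).pair) (Z := τ.stablePair)
    (W := σ.stablePair) (i := ⟨f, hl.left⟩) (j := ⟨f', hl.right⟩) _ hl.g_eq hl.equiv rfl
    (imageEquiv k) rfl τ.vertexEquiv hc.ne hc.genus_loop hc.flagEquiv fun x => ?_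
  refine h.hom.flagMap_injective ((apply_imageEquiv k _).trans ?_)
  exact (hc.flagMap_flagEquiv (StablePair.restrictLoop (X := (τ.vertexBlock default).pair)
    (Y := τ.stablePair) τ.vertexEquiv ⟨f, hl.left⟩ ⟨f', hl.right⟩ _ x)).symm

/-- The glued labels `i'` and `j'` are variables, because the values of `imageEquiv` agree with the
given flags only propositionally; the remaining labels are compared in the disjoint union. -/
theorem edge_relabel_of_eq {X Y X' Y' Z W : StablePair.{u}} {i : X.I} {j : Y.I} {i' : X'.I}
    {j' : Y'.I} (hg₁ : (X.edge Y i j).g = Z.g) (s₁ : (X.edge Y i j).I ≃ Z.I) (hg₁' : Z.g = W.g)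
    (t₁ : Z.I ≃ W.I) (hg₂ : X.g = X'.g) (s₂ : X.I ≃ X'.I) (hg₂' : Y.g = Y'.g) (s₂' : Y.I ≃ Y'.I)
    (hg₃ : (X'.edge Y' i' j').g = W.g) (t₂ : (X'.edge Y' i' j').I ≃ W.I) (hi : s₂ i = i')
    (hj : s₂' j = j') (hst : ∀ (x : (X.edge Y i j).I) (y : (X'.edge Y' i' j').I),
      Sum.map s₂ s₂' x.1 = y.1 → t₁ (s₁ x) = t₂ y) :
    (D.edge X Y i j ≫ (D.relabel hg₁ s₁).hom) ≫ (D.relabel hg₁' t₁).hom =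
      ((D.relabel hg₂ s₂).hom ⊗ₘ (D.relabel hg₂' s₂').hom) ≫ D.edge X' Y' _ _ ≫
        (D.relabel hg₃ t₂).hom := by
  subst hi hj
  exact hD.edge_relabel_relabel hg₁ s₁ hg₁' t₁ hg₂ s₂ hg₂' s₂' hg₃ t₂ fun x => hst x _ rfl

/-- Only the set of contracted flags matters, not whether they form an edge of the source. So the
statement concerns a morphism out of `τ₁ ⊗ τ₂` itself, which contracts a pair of flags that is not
an edge there; the composite of a grafting with the contraction of the new edge is of this kind. -/
theorem graphMap_singleIso_of_edge {τ₁ τ₂ : StableModularGraph.{u}} [Unique τ₁.obj.V]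
    [Unique τ₂.obj.V] [Unique σ.obj.V] (k : τ₁ ⊗ τ₂ ⟶ σ) (f₁ : τ₁.obj.F) (f₂ : τ₂.obj.F)
    (hr : ∀ x, (x ≠ (Sum.inl f₁ : τ₁.obj.F ⊕ τ₂.obj.F) ∧ x ≠ (Sum.inr f₂ : τ₁.obj.F ⊕ τ₂.obj.F)) ↔
      x ∈ Set.range k.hom.flagMap)
    (hg : (τ₁.stablePair.edge τ₂.stablePair f₁ f₂).g = σ.stablePair.g)
    (s : (τ₁.stablePair.edge τ₂.stablePair f₁ f₂).I ≃ σ.stablePair.I)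
    (hs : ∀ x, k.hom.flagMap (s x) = x.1) :
    D.tensorMap τ₁ τ₂ ≫ D.graphMap k ≫ (D.singleIso σ).hom =
      ((D.singleIso τ₁).hom ⊗ₘ (D.singleIso τ₂).hom) ≫ D.edge τ₁.stablePair τ₂.stablePair f₁ f₂ ≫
        (D.relabel hg s).hom := by
  have m₁ (x : τ₁.obj.F) : x ∈ (τ₁.vertexBlock default).S := Subsingleton.elim (τ₁.obj.bdry x) _
  have m₂ (x : τ₂.obj.F) : x ∈ (τ₂.vertexBlock default).S := Subsingleton.elim (τ₂.obj.bdry x) _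
  have he : Block.IsEdge (F := (τ₁ ⊗ τ₂).obj.F) (Sum.inl f₁ : τ₁.obj.F ⊕ τ₂.obj.F)
      (Sum.inr f₂ : τ₁.obj.F ⊕ τ₂.obj.F) ((inlMap τ₁ τ₂).push (τ₁.vertexBlock default))
      ((inrMap τ₁ τ₂).push (τ₂.vertexBlock default))
      ((blockMap k).push (σ.vertexBlock default)) := by
    refine ⟨Set.disjoint_left.2 ?_, ⟨f₁, m₁ f₁, rfl⟩, ⟨f₂, m₂ f₂, rfl⟩, hg, fun x => ?_,
      Set.ext fun x => ?_⟩
    · rintro - ⟨x, -, rfl⟩ ⟨y, -, e⟩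
      exact Sum.inr_ne_inl e
    · refine (mem_push_vertexBlock hr x).trans (and_iff_right ?_).symm
      rcases x with x | x
      exacts [Or.inl ⟨x, m₁ x, rfl⟩, Or.inr ⟨x, m₂ x, rfl⟩]
    · refine iff_of_true (mem_push_vertexBlock_A k x) ?_
      rcases x with x | x
      exacts [Or.inl ⟨x, Subsingleton.elim x default, rfl⟩,
        Or.inr ⟨x, Subsingleton.elim x default, rfl⟩]
  have k₁ := (inlMap τ₁ τ₂).isImage (τ₁.vertexBlock default)
  have k₂ := (inrMap τ₁ τ₂).isImage (τ₂.vertexBlock default)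
  have k₃ := (blockMap k).isImage (σ.vertexBlock default)
  have p : (σ.blocks.map (blockMap k).push).Perm [(blockMap k).push (σ.vertexBlock default)] :=
    σ.perm_blocks_of_unique.map _
  have q := (perm_blocks_tensor τ₁ τ₂).symm.trans ((τ₁.perm_blocks_of_unique.map _).append
    (τ₂.perm_blocks_of_unique.map _))
  have hn := (τ₁ ⊗ τ₂).isStage_blocks.perm q
  have e₁ := graphMap_transport_of_contracts hD he.ne hr p
    ((Contracts.head_edge (D := D) he hn).perm_left hn q)
  have e₂ := transport_rightUnitor (D := D) (blockMap k) p k₃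
  have e₃ := join_permHom (D := D) (inlMap τ₁ τ₂) (inrMap τ₁ τ₂) (perm_blocks_tensor τ₁ τ₂) q
    (τ₁ ⊗ τ₂).isStage_blocks
  have e₄ := permHom_join (D := D) (inlMap τ₁ τ₂) (inrMap τ₁ τ₂) τ₁.perm_blocks_of_unique
    τ₂.perm_blocks_of_unique (.refl _) ((perm_blocks_tensor τ₁ τ₂).trans q) τ₁.isStage_blocks
    τ₂.isStage_blocks hn
  have e₅ := join_singleton (D := D) (inlMap τ₁ τ₂) (inrMap τ₁ τ₂) (.refl _) hn.nodup
  have e₆ : D.tensorMap τ₁ τ₂ ≫ D.graphMap k ≫ (D.vertexIso σ).hom ≫ (D.imageIso k₃).hom =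
      ((D.vertexIso τ₁).hom ⊗ₘ (D.vertexIso τ₂).hom) ≫
        ((D.imageIso k₁).hom ⊗ₘ (D.imageIso k₂).hom) ≫ D.edgeMap he := by
    rw [← e₂, reassoc_of% e₁]
    refine ((Category.assoc _ _ _).symm.trans (eq_whisker (e₃.trans e₄.symm) _)).trans ?_
    refine (Category.assoc _ _ _).trans ((whisker_eq _ (eq_whisker e₅ _)).trans ?_)
    rw [Category.assoc, Category.assoc]
    refine (whisker_eq _ (tensor_rightUnitor_comp (D.imageIso k₁).hom (D.imageIso k₂).hom
      (D.edgeMap he))).trans ?_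
    refine (Category.assoc _ _ _).symm.trans (eq_whisker ?_ _)
    exact tensorHom_comp_tensorHom ..
  have e₇ : ((D.singleIso τ₁).hom ⊗ₘ (D.singleIso τ₂).hom) = _ := congrArg₂ (· ⊗ₘ ·)
    (imageIso_relabel hD k₁ rfl).symm (imageIso_relabel hD k₂ rfl).symm
  rw [← imageIso_relabel hD k₃ rfl, reassoc_of% e₆, e₇, ← tensorHom_comp_tensorHom,
    ← tensorHom_comp_tensorHom, Category.assoc, Category.assoc]
  refine whisker_eq _ (whisker_eq _ ?_)
  refine edge_relabel_of_eq hD (X := ((inlMap τ₁ τ₂).push (τ₁.vertexBlock default)).pair)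
    (Y := ((inrMap τ₁ τ₂).push (τ₂.vertexBlock default)).pair) (X' := τ₁.stablePair)
    (Y' := τ₂.stablePair) (Z := ((blockMap k).push (σ.vertexBlock default)).pair)
    (W := σ.stablePair) (i := ⟨_, he.left⟩) (j := ⟨_, he.right⟩) he.g_eq he.equiv rfl
    (imageEquiv k₃) rfl (imageEquiv k₁) rfl (imageEquiv k₂) hg s
    (Sum.inl_injective (apply_imageEquiv k₁ ⟨_, he.left⟩))
    (Sum.inr_injective (apply_imageEquiv k₂ ⟨_, he.right⟩)) fun x y hxy => ?_
  refine k.hom.flagMap_injective ((apply_imageEquiv k₃ _).trans ((hs y).trans ?_).symm)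
  rw [← hxy]
  obtain ⟨x | x, hx⟩ := x
  · exact apply_imageEquiv k₁ x
  · exact apply_imageEquiv k₂ x

end

end GluingData

end

/-! ### The modular operad of gluing data -/

section

open SymmetricCategory

namespace CategoryTheory.Functor

variable {A : Type*} [Category A] [MonoidalCategory A] [BraidedCategory A] {B : Type*} [Category B]
  [MonoidalCategory B] [BraidedCategory B] (G : A ⥤ B) [G.Braided] (obj : A → B)
  (e : ∀ a, G.obj a ≅ obj a)

/-- The structure of a braided functor on a copy of a braided functor with given objects. -/
@[reducible]
def braidedCopyObj : (G.copyObj obj e).Braided where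
  toMonoidal := Monoidal.transport (G.isoCopyObj obj e)
  braided a b := by
    have h : (((e a).inv ⊗ₘ (e b).inv) ≫ LaxMonoidal.μ G a b ≫ (e (a ⊗ b)).hom) ≫
        (e (a ⊗ b)).inv ≫ G.map (β_ a b).hom ≫ (e (b ⊗ a)).hom =
        (β_ (obj a) (obj b)).hom ≫ ((e b).inv ⊗ₘ (e a).inv) ≫ LaxMonoidal.μ G b a ≫
          (e (b ⊗ a)).hom := by
      simp only [Category.assoc, Iso.hom_inv_id_assoc]
      rw [LaxBraided.braided_assoc]
      exact BraidedCategory.braiding_naturality_assoc (e a).inv (e b).inv _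
    exact h

end CategoryTheory.Functor

namespace GluingData

open StableModularGraph

variable {C : Type w} [Category.{v} C] [MonoidalCategory C] [SymmetricCategory C]

theorem isIso_graphMap {D : GluingData.{u} C} {τ σ : StableModularGraph.{u}} {h : τ ⟶ σ}
    (hh : IsGrafting h) : IsIso (D.graphMap h) := by
  obtain ⟨p, hp⟩ := exists_graphMap_transport (D := D) h fun f =>
    (h.hom.pair_eq_self_iff f).2 (hh.1.2 f)
  have : IsIso (D.transport (blockMap h) p) := isIso_transport _ p σ.isStage_blocks
  have : IsIso (D.graphMap h ≫ D.transport (blockMap h) p) := hp ▸ inferInstance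
  exact IsIso.of_isIso_comp_right _ (D.transport (blockMap h) p)

/-- The blocks of a graph and of its grafting are the same by definition, and so are the block maps
of the grafting and of `𝟙 τ`. -/
theorem graphMap_graftHom {D : GluingData.{u} C} (hD : D.IsCompatible) (τ : StableModularGraph.{u})
    (j : τ.obj.F → τ.obj.F) (hj : ∀ f, j (j f) = f)
    (hτ : ∀ f, τ.obj.inv f ≠ f → j f = τ.obj.inv f) :
    D.graphMap (τ.graftHom j hj hτ) = 𝟙 (D.stageObj τ.blocks) := by
  obtain ⟨p, hp⟩ := exists_graphMap_transport (D := D) (τ.graftHom j hj hτ) fun _ => rfl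
  have e := transport_eq_id hD (blockMap (𝟙 τ)) rfl p τ.isStage_blocks
  exact (Category.comp_id _).symm.trans ((whisker_eq _ e.symm).trans hp)

open scoped Classical in
/-- The object of a graph, which is an object of the gluing data if there is a single vertex. -/
noncomputable def strictObj (D : GluingData.{u} C) (τ : StableModularGraph.{u}) : C :=
  if h : Nonempty (Unique τ.obj.V) then D.obj (@stablePair τ h.some) else D.stageObj τ.blocks

-- The `Unique` instance chosen in `strictObj` equals any given one, since such instances form a
-- subsingleton.
omit [SymmetricCategory C] in
theorem strictObj_eq (D : GluingData.{u} C) (τ : StableModularGraph.{u}) [i : Unique τ.obj.V] :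
    D.strictObj τ = D.obj τ.stablePair := by
  rw [strictObj, dif_pos ⟨i⟩, Subsingleton.elim (Nonempty.some ⟨i⟩) i]

open scoped Classical in
/-- The comparison of the two objects of a graph. -/
noncomputable def strictIso (D : GluingData.{u} C) (τ : StableModularGraph.{u}) :
    D.stageObj τ.blocks ≅ D.strictObj τ :=
  if h : Nonempty (Unique τ.obj.V) then
    @singleIso C _ _ _ D τ h.some ≪≫ (eqToIso (dif_pos h : D.strictObj τ = _)).symm
  else (eqToIso (dif_neg h : D.strictObj τ = _)).symm

theorem strictIso_hom_eqToHom (D : GluingData.{u} C) (τ : StableModularGraph.{u})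
    [i : Unique τ.obj.V] :
    (D.strictIso τ).hom ≫ eqToHom (D.strictObj_eq τ) = (D.singleIso τ).hom := by
  have h : Nonempty (Unique τ.obj.V) := ⟨i⟩
  obtain rfl : i = h.some := Subsingleton.elim _ _
  have e : D.strictIso τ = @singleIso C _ _ _ D τ h.some ≪≫
      (eqToIso (@strictObj_eq C _ _ D τ h.some)).symm := dif_pos h
  rw [e, Iso.trans_hom, Iso.symm_hom, eqToIso.inv, Category.assoc, eqToHom_trans, eqToHom_refl,
    Category.comp_id]

theorem eqToHom_strictIso_inv (D : GluingData.{u} C) (τ : StableModularGraph.{u})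
    [Unique τ.obj.V] :
    eqToHom (D.strictObj_eq τ).symm ≫ (D.strictIso τ).inv = (D.singleIso τ).inv := by
  rw [← cancel_epi (D.singleIso τ).hom, Iso.hom_inv_id]
  simp [← strictIso_hom_eqToHom]

/-- The modular operad of gluing data. -/
noncomputable def modularOperad (D : GluingData.{u} C) (hD : D.IsCompatible) :
    ModularOperad.{u} C where
  functor := (graphFunctor hD).copyObj D.strictObj D.strictIso
  braided :=
    have := graphFunctorBraided hD
    (graphFunctor hD).braidedCopyObj D.strictObj D.strictIso
  isIso_map {τ σ} h hh := by
    have := isIso_graphMap (D := D) hh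
    exact inferInstanceAs (IsIso ((D.strictIso τ).inv ≫ D.graphMap h ≫ (D.strictIso σ).hom))

theorem strictMap_eq (D : GluingData.{u} C) {τ σ : StableModularGraph.{u}} [Unique τ.obj.V]
    [Unique σ.obj.V] {h : τ ⟶ σ} {φ : D.obj τ.stablePair ⟶ D.obj σ.stablePair}
    (e : D.graphMap h ≫ (D.singleIso σ).hom = (D.singleIso τ).hom ≫ φ) :
    eqToHom (D.strictObj_eq τ).symm ≫
      ((D.strictIso τ).inv ≫ D.graphMap h ≫ (D.strictIso σ).hom) ≫ eqToHom (D.strictObj_eq σ) =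
        φ := by
  rw [Category.assoc, Category.assoc, strictIso_hom_eqToHom, e,
    reassoc_of% D.eqToHom_strictIso_inv τ, Iso.inv_hom_id_assoc]

/-- The left side is the tensorator of the copied functor, followed by its values on `g` and `h`,
with the definitions unfolded; all intermediate copies of `strictIso` cancel. -/
theorem strictMap_tensor_eq (D : GluingData.{u} C) (hD : D.IsCompatible)
    {τ₁ τ₂ τ σ : StableModularGraph.{u}}
    [Unique τ₁.obj.V] [Unique τ₂.obj.V] [Unique σ.obj.V] (g : τ₁ ⊗ τ₂ ⟶ τ) (h : τ ⟶ σ)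
    {φ : D.obj τ₁.stablePair ⊗ D.obj τ₂.stablePair ⟶ D.obj σ.stablePair}
    (e : D.tensorMap τ₁ τ₂ ≫ D.graphMap (g ≫ h) ≫ (D.singleIso σ).hom =
      ((D.singleIso τ₁).hom ⊗ₘ (D.singleIso τ₂).hom) ≫ φ) :
    (eqToHom (D.strictObj_eq τ₁).symm ⊗ₘ eqToHom (D.strictObj_eq τ₂).symm) ≫
      (((D.strictIso τ₁).inv ⊗ₘ (D.strictIso τ₂).inv) ≫ D.tensorMap τ₁ τ₂ ≫
        (D.strictIso (τ₁ ⊗ τ₂)).hom) ≫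
      ((D.strictIso (τ₁ ⊗ τ₂)).inv ≫ D.graphMap g ≫ (D.strictIso τ).hom) ≫
      ((D.strictIso τ).inv ≫ D.graphMap h ≫ (D.strictIso σ).hom) ≫ eqToHom (D.strictObj_eq σ) =
        φ := by
  simp only [Category.assoc, Iso.hom_inv_id_assoc, strictIso_hom_eqToHom]
  rw [graphMap_comp hD, Category.assoc] at e
  rw [e, tensorHom_comp_tensorHom_assoc, eqToHom_strictIso_inv, eqToHom_strictIso_inv,
    tensorHom_comp_tensorHom_assoc, Iso.inv_hom_id, Iso.inv_hom_id, id_tensorHom_id,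
    Category.id_comp]

end GluingData

end

open StableModularGraph Functor.LaxMonoidal in
theorem mainTheorem4 {C : Type w} [Category.{v} C] [MonoidalCategory C] [SymmetricCategory C]
    (D : GluingData.{u} C) (hD : D.IsCompatible) :
    ∃ (O : ModularOperad.{u} C)
      -- a graph with a single vertex is sent to `C(g, F)`
      (e : ∀ (τ : StableModularGraph.{u}) [Unique τ.obj.V],
        O.functor.obj τ = D.obj τ.stablePair),
      -- graftings are sent to identities
      (∀ (τ : StableModularGraph.{u}) (j : τ.obj.F → τ.obj.F) (hj : ∀ f, j (j f) = f)
        (hτ : ∀ f, τ.obj.inv f ≠ f → j f = τ.obj.inv f),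
        ∃ heq : O.functor.obj τ = O.functor.obj (τ.graft j hj hτ),
          O.functor.map (τ.graftHom j hj hτ) = eqToHom heq) ∧
      -- an isomorphism `h` of graphs with a single vertex is sent to `c_s` for `s = (h^F)⁻¹`
      (∀ (τ σ : StableModularGraph.{u}) [Unique τ.obj.V] [Unique σ.obj.V] (h : τ ≅ σ),
        eqToHom (e τ).symm ≫ O.functor.map h.hom ≫ eqToHom (e σ) =
          (D.relabel (X := τ.stablePair) (Y := σ.stablePair)
            (genus_of_iso h) (flagEquivOfIso h)).hom) ∧
      -- the contraction of the loop `{f, f'}` at the only vertex of `τ` is sent to `c^l(f, f')`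
      (∀ (τ σ : StableModularGraph.{u}) [Unique τ.obj.V] [Unique σ.obj.V] (h : τ ⟶ σ)
        (f f' : τ.obj.F) (hc : IsContraction h f f'),
        eqToHom (e τ).symm ≫ O.functor.map h ≫ eqToHom (e σ) =
          D.loop τ.stablePair f f' hc.ne ≫
            (D.relabel (X := τ.stablePair.loop f f' hc.ne) (Y := σ.stablePair)
              hc.genus_loop hc.flagEquiv).hom) ∧
      -- the contraction of an edge `{f₁, f₂}` between the two vertices of a graph obtained by
      -- grafting `τ₁ ⊔ τ₂` is sent to `c(f₁, f₂)`
      (∀ (τ₁ τ₂ σ : StableModularGraph.{u}) [Unique τ₁.obj.V] [Unique τ₂.obj.V]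
        [Unique σ.obj.V] (j : (τ₁ ⊗ τ₂).obj.F → (τ₁ ⊗ τ₂).obj.F) (hj : ∀ f, j (j f) = f)
        (hτ : ∀ f, (τ₁ ⊗ τ₂).obj.inv f ≠ f → j f = (τ₁ ⊗ τ₂).obj.inv f)
        (h : (τ₁ ⊗ τ₂).graft j hj hτ ⟶ σ) (f₁ : τ₁.obj.F) (f₂ : τ₂.obj.F)
        (hc : IsContraction h (Sum.inl f₁) (Sum.inr f₂)),
        (eqToHom (e τ₁).symm ⊗ₘ eqToHom (e τ₂).symm) ≫ μ O.functor τ₁ τ₂ ≫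
            O.functor.map ((τ₁ ⊗ τ₂).graftHom j hj hτ) ≫ O.functor.map h ≫ eqToHom (e σ) =
          D.edge τ₁.stablePair τ₂.stablePair f₁ f₂ ≫
            (D.relabel (X := τ₁.stablePair.edge τ₂.stablePair f₁ f₂) (Y := σ.stablePair)
              hc.genus_edge hc.flagEquiv).hom) := by
  refine ⟨D.modularOperad hD, fun τ _ => D.strictObj_eq τ, fun τ j hj hτ => ⟨rfl, ?_⟩,
    fun τ σ _ _ h => ?_, fun τ σ _ _ h f f' hc => ?_,
    fun τ₁ τ₂ σ _ _ _ j hj hτ h f₁ f₂ hc => ?_⟩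
  · exact (whisker_eq (D.strictIso τ).inv ((eq_whisker
      (GluingData.graphMap_graftHom hD τ j hj hτ) _).trans (Category.id_comp _))).trans
      (D.strictIso τ).inv_hom_id
  · exact D.strictMap_eq (GluingData.graphMap_singleIso_of_iso hD h)
  · exact D.strictMap_eq (GluingData.graphMap_singleIso_of_loop hD h f f' hc)
  -- The grafting is the identity on flags, so the composite with `h` leaves exactly the flags in
  -- the range of `h^F` uncontracted, and `hc` applies to it unchanged.
  · exact D.strictMap_tensor_eq hD _ h (GluingData.graphMap_singleIso_of_edge hD
      ((τ₁ ⊗ τ₂).graftHom j hj hτ ≫ h) f₁ f₂ hc.mem_range hc.genus_edge hc.flagEquiv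
      hc.flagMap_flagEquiv)
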